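/- **Conventions.** Composition is written in diagrammatic order, $f;g$ = "first $f$, then $g$". A symmetric linearly distributive category (SLDC) is a category with two symmetric monoidal structures $(\otimes,\top)$ and $(\oplus,\bot)$ and natural linear distributivities $\delta^L_{A,B,C}:A\otimes(B\oplus C)\to(A\otimes B)\oplus C$, $\delta^R_{A,B,C}:(A\oplus B)\otimes C\to A\oplus(B\otimes C)$, coherent (in the sense of Cockett–Seely) with units, associators, each other and the braidings. We write $u^R_\otimes:A\to A\otimes\top$, $u^R_\oplus:A\oplus\bot\to A$ for the right unitors and $\tau^\otimes_{A,B,C,D}:(A\otimes B)\otimes(C\otimes D)\to(A\otimes C)\otimes(B\otimes D)$, $\tau^\oplus$ for the canonical flips. A cartesian linearly distributive category (CLDC) is an SLDC whose $(\otimes,\top)$ is cartesian monoidal and whose $(\oplus,\bot)$ is cocartesian monoidal. A symmetric medial linearly distributive category (SMLDC) is an SLDC with maps $\Delta_\bot:\bot\to\bot\otimes\bot$, $\nabla_\top:\top\oplus\top\to\top$, $m:\bot\to\top$ and natural medial maps $\mu_{A,B,C,D}:(A\otimes B)\oplus(C\otimes D)\to(A\oplus C)\otimes(B\oplus D)$ such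 that $m$ satisfies the mix law, $(\oplus,\bot,\otimes,\top)$ with these maps is a symmetric duoidal category (in particular $(\bot,\Delta_\bot,m)$ is a cocommutative $\otimes$-comonoid and $(\top,\nabla_\top,m)$ a commutative $\oplus$-monoid), and the medial maps are compatible with the linear distributivities. It is called cartesian if its underlying SLDC is a CLDC. Conversely every CLDC $\mathbb Y$ is canonically an SMLDC $\mathrm{inc}(\mathbb Y)$: $\Delta_\bot,\nabla_\top,m$ are the unique maps out of the initial object, respectively into the terminal object, and $\mu$ is the canonical map from a coproduct of products to a product of coproducts. A bicommutative medial bimonoid in an SMLDC is $\langle A,\Delta,e,\nabla,u\rangle$ where $(A,\Delta:A\to A\otimes A,e:A\to\top)$ is a cocommutative $\otimes$-comonoid, $(A,\nabla:A\oplus A\to A,u:\bot\to A)$ is a commutative $\oplus$-monoid, and $$\nabla;\Delta=(\Delta\oplus\Delta);\mu_{A,A,A,A};(\nabla\otimes\nabla),\quad u;e=m,\quad \nabla;e=(e\oplus e);\nabla_\top,\quad u;\Delta=\Delta_\bot;(u\otimes u).$$ Their category $B[\mathbb X]$ (morphisms: simultaneous comonoid and monoid morphisms) is a CLDC, with $\otimes$,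 $\oplus$ and the structural isomorphisms and linear distributivities of $\mathbb X$, where $A\otimes B$, $A\oplus B$, $\top$, $\bot$ carry the bimonoid structures given by the formulas in (1) below (with $\langle\top,u^R_{\otimes\top},1,\nabla_\top,m\rangle$ and $\langle\bot,\Delta_\bot,m,u^R_{\oplus\bot},1\rangle$ for the units). A strong symmetric medial linear functor $F=(F_\otimes,F_\oplus):\mathbb X\to\mathbb Y$ between SMLDCs is a pair of functors, $F_\otimes$ strong symmetric monoidal for $\otimes$ (maps $m_\top,m_\otimes$) and symmetric monoidal for $\oplus$ (maps $m_\bot,m_\oplus$), $F_\oplus$ strong symmetric comonoidal for $\oplus$ (maps $n_\bot,n_\oplus$) and symmetric comonoidal for $\otimes$ (maps $n_\top,n_\otimes$), with natural linear strengths $\nu^R_\otimes:F_\otimes(A\oplus B)\to F_\oplus(A)\oplus F_\otimes(B)$ and $\nu^R_\oplus:F_\otimes(A)\otimes F_\oplus(B)\to F_\oplus(A\otimes B)$, such that $F_\otimes$ and $F_\oplus$ are bilax duoidal, $F$ is a symmetric linear functor (Cockett–Seely), and the strengths are compatible with $\Delta_\bot$, $\nabla_\top$, $\mu$, $m_\oplus$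 and $n_\otimes$. Two SMLDCs are isomorphic, $\mathbb X\cong\mathbb Y$, if there are mutually inverse strong symmetric medial linear functors between them. **Theorem.** Let $\mathbb X$ be an SMLDC. (1) $\mathbb X$ is cartesian if and only if there are natural transformations $$\Delta_A:A\to A\otimes A,\qquad e_A:A\to\top,\qquad \nabla_A:A\oplus A\to A,\qquad u_A:\bot\to A$$ such that for all objects $A,B$ the tuple $\langle A,\Delta_A,e_A,\nabla_A,u_A\rangle$ is a bicommutative medial bimonoid and \begin{align*} &\Delta_{A\otimes B}=(\Delta_A\otimes\Delta_B);\tau^\otimes_{A,A,B,B}, && e_{A\otimes B}=(e_A\otimes e_B);(u^R_{\otimes\top})^{-1},\\ &\nabla_{A\otimes B}=\mu_{A,B,A,B};(\nabla_A\otimes\nabla_B), && u_{A\otimes B}=\Delta_\bot;(u_A\otimes u_B),\\ &\Delta_{A\oplus B}=(\Delta_A\oplus\Delta_B);\mu_{A,A,B,B}, && e_{A\oplus B}=(e_A\oplus e_B);\nabla_\top,\\ &\nabla_{A\oplus B}=\tau^\oplus_{A,B,A,B};(\nabla_A\oplus\nabla_B), && u_{A\oplus B}=(u^R_{\oplus\bot})^{-1};(u_A\oplus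 u_B), \end{align*} where moreover the components at the units satisfy that the natural transformation $\Delta$ at $\top$ is $u^R_{\otimes\top}$, $e_\top=1_\top$, the natural transformation $\nabla$ at $\bot$ is $u^R_{\oplus\bot}$, $u_\bot=1_\bot$, and $e_\bot=u_\top=m$. (2) $\mathbb X$ is cartesian if and only if there is a CLDC $\mathbb Y$ with $\mathbb X\cong\mathrm{inc}(\mathbb Y)$, and such a $\mathbb Y$ exists if and only if $\mathbb X\cong\mathrm{inc}(B[\mathbb X])$. -/

import Mathlib

open CategoryTheory Limits

universe v v₁ v₂ v₃ u u₁ u₂ u₃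

namespace LD

/-- Two symmetric monoidal structures on one category: the tensor structure `(⊗, ⊤)` and the
par structure `(⊕, ⊥)`. -/
class BiSymMonoidal (C : Type u) [Category.{v} C] where
  ten : MonoidalCategory C
  tenSymm : @SymmetricCategory C _ ten
  par : MonoidalCategory C
  parSymm : @SymmetricCategory C _ par

section Operations

variable {C : Type u} [Category.{v} C] [BiSymMonoidal C]

/-- The tensor product of objects. -/
abbrev tObj (A B : C) : C :=
  (BiSymMonoidal.ten (C := C)).toMonoidalCategoryStruct.tensorObj A B

/-- The par product of objects. -/
abbrev pObj (A B : C) : C :=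
  (BiSymMonoidal.par (C := C)).toMonoidalCategoryStruct.tensorObj A B

variable (C) in
/-- The tensor unit `⊤`. -/
abbrev tOne : C := (BiSymMonoidal.ten (C := C)).toMonoidalCategoryStruct.tensorUnit

variable (C) in
/-- The par unit `⊥`. -/
abbrev pOne : C := (BiSymMonoidal.par (C := C)).toMonoidalCategoryStruct.tensorUnit

infixr:70 " ⊗ᵒ " => tObj
infixr:70 " ⊕ᵒ " => pObj
notation "⊤ᵒ" => tOne _
notation "⊥ᵒ" => pOne _

/-- The tensor product of morphisms. -/
abbrev tHom {A A' B B' : C} (f : A ⟶ A') (g : B ⟶ B') : A ⊗ᵒ B ⟶ A' ⊗ᵒ B' :=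
  (BiSymMonoidal.ten (C := C)).toMonoidalCategoryStruct.tensorHom f g

/-- The par product of morphisms. -/
abbrev pHom {A A' B B' : C} (f : A ⟶ A') (g : B ⟶ B') : A ⊕ᵒ B ⟶ A' ⊕ᵒ B' :=
  (BiSymMonoidal.par (C := C)).toMonoidalCategoryStruct.tensorHom f g

infixr:81 " ⊗ʰ " => tHom
infixr:81 " ⊕ʰ " => pHom

/-- The tensor associator `(A ⊗ B) ⊗ D ≅ A ⊗ (B ⊗ D)`. -/
abbrev tα (A B D : C) : (A ⊗ᵒ B) ⊗ᵒ D ≅ A ⊗ᵒ (B ⊗ᵒ D) :=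
  (BiSymMonoidal.ten (C := C)).toMonoidalCategoryStruct.associator A B D

/-- The right tensor unitor `A ≅ A ⊗ ⊤`. -/
abbrev tR (A : C) : A ≅ A ⊗ᵒ ⊤ᵒ :=
  ((BiSymMonoidal.ten (C := C)).toMonoidalCategoryStruct.rightUnitor A).symm

/-- The left tensor unitor `A ≅ ⊤ ⊗ A`. -/
abbrev tL (A : C) : A ≅ ⊤ᵒ ⊗ᵒ A :=
  ((BiSymMonoidal.ten (C := C)).toMonoidalCategoryStruct.leftUnitor A).symm

/-- The tensor braiding. -/
abbrev tσ (A B : C) : A ⊗ᵒ B ≅ B ⊗ᵒ A :=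
  (BiSymMonoidal.tenSymm (C := C)).toBraidedCategory.braiding A B

/-- The canonical flip of the tensor structure. -/
abbrev tτ (A B D E : C) : (A ⊗ᵒ B) ⊗ᵒ (D ⊗ᵒ E) ⟶ (A ⊗ᵒ D) ⊗ᵒ (B ⊗ᵒ E) :=
  @MonoidalCategory.tensorμ C _ BiSymMonoidal.ten
    (BiSymMonoidal.tenSymm (C := C)).toBraidedCategory A B D E

/-- The par associator `A ⊕ (B ⊕ D) ≅ (A ⊕ B) ⊕ D`. -/
abbrev pα (A B D : C) : A ⊕ᵒ (B ⊕ᵒ D) ≅ (A ⊕ᵒ B) ⊕ᵒ D :=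
  ((BiSymMonoidal.par (C := C)).toMonoidalCategoryStruct.associator A B D).symm

/-- The right par unitor `A ⊕ ⊥ ≅ A`. -/
abbrev pR (A : C) : A ⊕ᵒ ⊥ᵒ ≅ A :=
  (BiSymMonoidal.par (C := C)).toMonoidalCategoryStruct.rightUnitor A

/-- The left par unitor `⊥ ⊕ A ≅ A`. -/
abbrev pL (A : C) : ⊥ᵒ ⊕ᵒ A ≅ A :=
  (BiSymMonoidal.par (C := C)).toMonoidalCategoryStruct.leftUnitor A

/-- The par braiding. -/
abbrev pσ (A B : C) : A ⊕ᵒ B ≅ B ⊕ᵒ A :=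
  (BiSymMonoidal.parSymm (C := C)).toBraidedCategory.braiding A B

/-- The canonical flip of the par structure. -/
abbrev pτ (A B D E : C) : (A ⊕ᵒ B) ⊕ᵒ (D ⊕ᵒ E) ⟶ (A ⊕ᵒ D) ⊕ᵒ (B ⊕ᵒ E) :=
  @MonoidalCategory.tensorμ C _ BiSymMonoidal.par
    (BiSymMonoidal.parSymm (C := C)).toBraidedCategory A B D E

end Operations

/-- A symmetric linearly distributive category. -/
class SLDC (C : Type u) [Category.{v} C] extends BiSymMonoidal C where
  δL : ∀ A B D : C, A ⊗ᵒ (B ⊕ᵒ D) ⟶ (A ⊗ᵒ B) ⊕ᵒ D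
  δR : ∀ A B D : C, (A ⊕ᵒ B) ⊗ᵒ D ⟶ A ⊕ᵒ (B ⊗ᵒ D)
  δL_natural : ∀ {A A' B B' D D' : C} (f : A ⟶ A') (g : B ⟶ B') (h : D ⟶ D'),
    f ⊗ʰ (g ⊕ʰ h) ≫ δL A' B' D' = δL A B D ≫ (f ⊗ʰ g) ⊕ʰ h
  δR_natural : ∀ {A A' B B' D D' : C} (f : A ⟶ A') (g : B ⟶ B') (h : D ⟶ D'),
    (f ⊕ʰ g) ⊗ʰ h ≫ δR A' B' D' = δR A B D ≫ f ⊕ʰ (g ⊗ʰ h)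
  -- units and linear distributivities
  tL_δL : ∀ A B : C, (tL (A ⊕ᵒ B)).hom ≫ δL ⊤ᵒ A B = (tL A).hom ⊕ʰ 𝟙 B
  tR_δR : ∀ A B : C, (tR (A ⊕ᵒ B)).hom ≫ δR A B ⊤ᵒ = 𝟙 A ⊕ʰ (tR B).hom
  δR_pL : ∀ A B : C, δR ⊥ᵒ A B ≫ (pL (A ⊗ᵒ B)).hom = (pL A).hom ⊗ʰ 𝟙 B
  δL_pR : ∀ A B : C, δL A B ⊥ᵒ ≫ (pR (A ⊗ᵒ B)).hom = 𝟙 A ⊗ʰ (pR B).hom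
  -- associativities and linear distributivities
  δL_tα : ∀ A B D E : C, δL (A ⊗ᵒ B) D E ≫ (tα A B D).hom ⊕ʰ 𝟙 E =
    (tα A B (D ⊕ᵒ E)).hom ≫ 𝟙 A ⊗ʰ δL B D E ≫ δL A (B ⊗ᵒ D) E
  δR_tα : ∀ A B D E : C, (tα (A ⊕ᵒ B) D E).hom ≫ δR A B (D ⊗ᵒ E) =
    δR A B D ⊗ʰ 𝟙 E ≫ δR A (B ⊗ᵒ D) E ≫ 𝟙 A ⊕ʰ (tα B D E).hom
  δL_pα : ∀ A B D E : C, δL A B (D ⊕ᵒ E) ≫ (pα (A ⊗ᵒ B) D E).hom =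
    𝟙 A ⊗ʰ (pα B D E).hom ≫ δL A (B ⊕ᵒ D) E ≫ δL A B D ⊕ʰ 𝟙 E
  δR_pα : ∀ A B D E : C, (pα A B D).hom ⊗ʰ 𝟙 E ≫ δR (A ⊕ᵒ B) D E =
    δR A (B ⊕ᵒ D) E ≫ 𝟙 A ⊕ʰ δR B D E ≫ (pα A B (D ⊗ᵒ E)).hom
  -- left and right linear distributivities
  δL_δR : ∀ A B D E : C, δL (A ⊕ᵒ B) D E ≫ δR A B D ⊕ʰ 𝟙 E =
    δR A B (D ⊕ᵒ E) ≫ 𝟙 A ⊕ʰ δL B D E ≫ (pα A (B ⊗ᵒ D) E).hom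
  δR_δL : ∀ A B D E : C, δL A B D ⊗ʰ 𝟙 E ≫ δR (A ⊗ᵒ B) D E =
    (tα A (B ⊕ᵒ D) E).hom ≫ 𝟙 A ⊗ʰ δR B D E ≫ δL A B (D ⊗ᵒ E)
  -- linear distributivities and braidings
  δ_σ : ∀ A B D : C, δR A B D = (tσ (A ⊕ᵒ B) D).hom ≫ 𝟙 D ⊗ʰ (pσ A B).hom ≫ δL D B A ≫
    (tσ D B).hom ⊕ʰ 𝟙 A ≫ (pσ (B ⊗ᵒ D) A).hom


/-- A symmetric medial linearly distributive category: a symmetric linearly distributive category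
which is mix, for which `(⊕, ⊥, ⊗, ⊤)` is symmetric duoidal, and whose medial maps are compatible
with the linear distributivities. -/
class SMLDC (C : Type u) [Category.{v} C] extends SLDC C where
  /-- `⊥`-contraction -/
  Δbot : (⊥ᵒ : C) ⟶ ⊥ᵒ ⊗ᵒ ⊥ᵒ
  /-- `⊤`-cocontraction -/
  nabTop : (⊤ᵒ ⊕ᵒ ⊤ᵒ : C) ⟶ ⊤ᵒ
  /-- nullary mix -/
  mix : (⊥ᵒ : C) ⟶ ⊤ᵒ
  /-- the medial maps -/
  med : ∀ A B D E : C, (A ⊗ᵒ B) ⊕ᵒ (D ⊗ᵒ E) ⟶ (A ⊕ᵒ D) ⊗ᵒ (B ⊕ᵒ E)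
  med_natural : ∀ {A A' B B' D D' E E' : C} (f : A ⟶ A') (g : B ⟶ B') (h : D ⟶ D') (k : E ⟶ E'),
    (f ⊗ʰ g) ⊕ʰ (h ⊗ʰ k) ≫ med A' B' D' E' = med A B D E ≫ (f ⊕ʰ h) ⊗ʰ (g ⊕ʰ k)
  -- the mix law
  mix_law : ∀ A B : C,
    𝟙 A ⊗ʰ (pL B).inv ≫ 𝟙 A ⊗ʰ (mix ⊕ʰ 𝟙 B) ≫ δL A ⊤ᵒ B ≫ (tR A).inv ⊕ʰ 𝟙 B =
    (pR A).inv ⊗ʰ 𝟙 B ≫ (𝟙 A ⊕ʰ mix) ⊗ʰ 𝟙 B ≫ δR A ⊤ᵒ B ≫ 𝟙 A ⊕ʰ (tL B).inv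
  -- `⊥` is a cocommutative `⊗`-comonoid and `⊤` is a commutative `⊕`-monoid
  Δbot_coassoc : Δbot ≫ 𝟙 ⊥ᵒ ⊗ʰ Δbot = Δbot ≫ Δbot ⊗ʰ 𝟙 ⊥ᵒ ≫ (tα ⊥ᵒ ⊥ᵒ ⊥ᵒ).hom
  Δbot_mix_right : Δbot ≫ 𝟙 ⊥ᵒ ⊗ʰ mix = (tR ⊥ᵒ).hom
  Δbot_mix_left : Δbot ≫ mix ⊗ʰ 𝟙 ⊥ᵒ = (tL ⊥ᵒ).hom
  Δbot_cocomm : Δbot ≫ (tσ ⊥ᵒ ⊥ᵒ).hom = Δbot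
  nabTop_assoc : 𝟙 ⊤ᵒ ⊕ʰ nabTop ≫ nabTop = (pα ⊤ᵒ ⊤ᵒ ⊤ᵒ).hom ≫ nabTop ⊕ʰ 𝟙 ⊤ᵒ ≫ nabTop
  mix_nabTop_right : 𝟙 ⊤ᵒ ⊕ʰ mix ≫ nabTop = (pR ⊤ᵒ).hom
  mix_nabTop_left : mix ⊕ʰ 𝟙 ⊤ᵒ ≫ nabTop = (pL ⊤ᵒ).hom
  nabTop_comm : (pσ ⊤ᵒ ⊤ᵒ).hom ≫ nabTop = nabTop
  -- medial maps and associators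
  med_tα : ∀ A B D A' B' D' : C,
    med (A ⊗ᵒ B) D (A' ⊗ᵒ B') D' ≫ med A B A' B' ⊗ʰ 𝟙 (D ⊕ᵒ D') ≫
      (tα (A ⊕ᵒ A') (B ⊕ᵒ B') (D ⊕ᵒ D')).hom =
    (tα A B D).hom ⊕ʰ (tα A' B' D').hom ≫ med A (B ⊗ᵒ D) A' (B' ⊗ᵒ D') ≫
      𝟙 (A ⊕ᵒ A') ⊗ʰ med B D B' D'
  med_pα : ∀ A B D E F G : C,
    (pα (A ⊗ᵒ B) (D ⊗ᵒ E) (F ⊗ᵒ G)).hom ≫ med A B D E ⊕ʰ 𝟙 (F ⊗ᵒ G) ≫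
      med (A ⊕ᵒ D) (B ⊕ᵒ E) F G =
    𝟙 (A ⊗ᵒ B) ⊕ʰ med D E F G ≫ med A B (D ⊕ᵒ F) (E ⊕ᵒ G) ≫ (pα A D F).hom ⊗ʰ (pα B E G).hom
  -- medial maps and unitors
  med_pL : ∀ A B : C,
    Δbot ⊕ʰ 𝟙 (A ⊗ᵒ B) ≫ med ⊥ᵒ ⊥ᵒ A B ≫ (pL A).hom ⊗ʰ (pL B).hom = (pL (A ⊗ᵒ B)).hom
  med_pR : ∀ A B : C,
    𝟙 (A ⊗ᵒ B) ⊕ʰ Δbot ≫ med A B ⊥ᵒ ⊥ᵒ ≫ (pR A).hom ⊗ʰ (pR B).hom = (pR (A ⊗ᵒ B)).hom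
  med_tL : ∀ A B : C,
    (tL A).hom ⊕ʰ (tL B).hom ≫ med ⊤ᵒ A ⊤ᵒ B ≫ nabTop ⊗ʰ 𝟙 (A ⊕ᵒ B) = (tL (A ⊕ᵒ B)).hom
  med_tR : ∀ A B : C,
    (tR A).hom ⊕ʰ (tR B).hom ≫ med A ⊤ᵒ B ⊤ᵒ ≫ 𝟙 (A ⊕ᵒ B) ⊗ʰ nabTop = (tR (A ⊕ᵒ B)).hom
  -- medial maps and braidings
  med_tσ : ∀ A B D E : C,
    med A B D E ≫ (tσ (A ⊕ᵒ D) (B ⊕ᵒ E)).hom = (tσ A B).hom ⊕ʰ (tσ D E).hom ≫ med B A E D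
  med_pσ : ∀ A B D E : C,
    med A B D E ≫ (pσ A D).hom ⊗ʰ (pσ B E).hom = (pσ (A ⊗ᵒ B) (D ⊗ᵒ E)).hom ≫ med D E A B
  -- medial maps and linear distributivities
  med_δR_tα : ∀ A B D E X : C,
    med A B D E ⊗ʰ 𝟙 X ≫ (tα (A ⊕ᵒ D) (B ⊕ᵒ E) X).hom ≫ 𝟙 (A ⊕ᵒ D) ⊗ʰ δR B E X =
    δR (A ⊗ᵒ B) (D ⊗ᵒ E) X ≫ 𝟙 (A ⊗ᵒ B) ⊕ʰ (tα D E X).hom ≫ med A B D (E ⊗ᵒ X)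
  med_δL_tα : ∀ A B D E X : C,
    𝟙 X ⊗ʰ med A B D E ≫ (tα X (A ⊕ᵒ D) (B ⊕ᵒ E)).inv ≫ δL X A D ⊗ʰ 𝟙 (B ⊕ᵒ E) =
    δL X (A ⊗ᵒ B) (D ⊗ᵒ E) ≫ (tα X A B).inv ⊕ʰ 𝟙 (D ⊗ᵒ E) ≫ med (X ⊗ᵒ A) B D E
  med_δR_pα : ∀ A B D E X : C,
    δR X A B ⊕ʰ 𝟙 (D ⊗ᵒ E) ≫ (pα X (A ⊗ᵒ B) (D ⊗ᵒ E)).inv ≫ 𝟙 X ⊕ʰ med A B D E =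
    med (X ⊕ᵒ A) B D E ≫ (pα X A D).inv ⊗ʰ 𝟙 (B ⊕ᵒ E) ≫ δR X (A ⊕ᵒ D) (B ⊕ᵒ E)
  med_δL_pα : ∀ A B D E X : C,
    𝟙 (A ⊗ᵒ B) ⊕ʰ δL D E X ≫ (pα (A ⊗ᵒ B) (D ⊗ᵒ E) X).hom ≫ med A B D E ⊕ʰ 𝟙 X =
    med A B D (E ⊕ᵒ X) ≫ 𝟙 (A ⊕ᵒ D) ⊗ʰ (pα B E X).hom ≫ δL (A ⊕ᵒ D) (B ⊕ᵒ E) X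

end LD
namespace LD

section Generic

set_option linter.unusedSectionVars false

open MonoidalCategory

variable {C : Type u} [Category.{v} C] [MonoidalCategory C] [SymmetricCategory C]

theorem tensorμ_eq (A B D E : C) : tensorμ A B D E = (α_ A B (D ⊗ E)).hom ≫
    (𝟙 A ⊗ₘ ((α_ B D E).inv ≫ ((β_ B D).hom ⊗ₘ 𝟙 E) ≫ (α_ D B E).hom)) ≫
      (α_ A D (B ⊗ E)).inv := by
  simp [tensorμ]

theorem tensorμ_eq' (A B D E : C) : tensorμ A B D E = (α_ (A ⊗ B) D E).inv ≫
    (((β_ (A ⊗ B) D).hom ≫ (α_ D A B).inv ≫ ((β_ D A).hom ⊗ₘ 𝟙 B)) ⊗ₘ 𝟙 E) ≫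
      (α_ (A ⊗ D) B E).hom := by
  simp [tensorμ, SymmetricCategory.braiding_swap_eq_inv_braiding A D]

theorem exchange_eq (A B D : C) : (α_ A B D).inv ≫ ((β_ A B).hom ⊗ₘ 𝟙 D) ≫ (α_ B A D).hom =
    (𝟙 A ⊗ₘ (β_ B D).hom) ≫ (α_ A D B).inv ≫ (β_ (A ⊗ D) B).hom := by
  simp [SymmetricCategory.braiding_swap_eq_inv_braiding B D]

theorem pentagon_h (W X Y Z : C) :
    ((α_ W X Y).hom ⊗ₘ 𝟙 Z) ≫ (α_ W (X ⊗ Y) Z).hom ≫ (𝟙 W ⊗ₘ (α_ X Y Z).hom) =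
      (α_ (W ⊗ X) Y Z).hom ≫ (α_ W X (Y ⊗ Z)).hom := by
  simp

theorem triangle_h (X Y : C) :
    (α_ X (𝟙_ C) Y).hom ≫ (𝟙 X ⊗ₘ (λ_ Y).hom) = (ρ_ X).hom ⊗ₘ 𝟙 Y := by
  simp

theorem hexagon_forward_h (X Y Z : C) :
    (α_ X Y Z).hom ≫ (β_ X (Y ⊗ Z)).hom ≫ (α_ Y Z X).hom =
      ((β_ X Y).hom ⊗ₘ 𝟙 Z) ≫ (α_ Y X Z).hom ≫ (𝟙 Y ⊗ₘ (β_ X Z).hom) := by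
  simp

theorem hexagon_reverse_h (X Y Z : C) :
    (α_ X Y Z).inv ≫ (β_ (X ⊗ Y) Z).hom ≫ (α_ Z X Y).inv =
      (𝟙 X ⊗ₘ (β_ Y Z).hom) ≫ (α_ X Z Y).inv ≫ ((β_ X Z).hom ⊗ₘ 𝟙 Y) := by
  simp

/-- `(A, Δ, e)` is a cocommutative comonoid. -/
structure IsCocommComon (A : C) (Δ : A ⟶ A ⊗ A) (e : A ⟶ 𝟙_ C) : Prop where
  coassoc : Δ ≫ (𝟙 A ⊗ₘ Δ) = Δ ≫ (Δ ⊗ₘ 𝟙 A) ≫ (α_ A A A).hom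
  counit_right : Δ ≫ (𝟙 A ⊗ₘ e) ≫ (ρ_ A).hom = 𝟙 A
  counit_left : Δ ≫ (e ⊗ₘ 𝟙 A) ≫ (λ_ A).hom = 𝟙 A
  cocomm : Δ ≫ (β_ A A).hom = Δ

/-- `(A, ∇, u)` is a commutative monoid. -/
structure IsCommMon (A : C) (nab : A ⊗ A ⟶ A) (u : 𝟙_ C ⟶ A) : Prop where
  assoc : (𝟙 A ⊗ₘ nab) ≫ nab = (α_ A A A).inv ≫ (nab ⊗ₘ 𝟙 A) ≫ nab
  unit_right : (ρ_ A).inv ≫ (𝟙 A ⊗ₘ u) ≫ nab = 𝟙 A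
  unit_left : (λ_ A).inv ≫ (u ⊗ₘ 𝟙 A) ≫ nab = 𝟙 A
  comm : (β_ A A).hom ≫ nab = nab

/-- `f` is a morphism of comonoids from `(A, Δ, e)` to `(B, Δ', e')`. -/
structure IsComonMap {A B : C} (Δ : A ⟶ A ⊗ A) (e : A ⟶ 𝟙_ C) (Δ' : B ⟶ B ⊗ B) (e' : B ⟶ 𝟙_ C)
    (f : A ⟶ B) : Prop where
  comul : f ≫ Δ' = Δ ≫ (f ⊗ₘ f)
  counit : f ≫ e' = e

/-- `f` is a morphism of monoids from `(A, ∇, u)` to `(B, ∇', u')`. -/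
structure IsMonMap {A B : C} (nab : A ⊗ A ⟶ A) (u : 𝟙_ C ⟶ A) (nab' : B ⊗ B ⟶ B) (u' : 𝟙_ C ⟶ B)
    (f : A ⟶ B) : Prop where
  mul : nab ≫ f = (f ⊗ₘ f) ≫ nab'
  unit : u ≫ f = u'

variable {A B D E : C}
  {dA : A ⟶ A ⊗ A} {eA : A ⟶ 𝟙_ C} {dB : B ⟶ B ⊗ B} {eB : B ⟶ 𝟙_ C}
  {dD : D ⟶ D ⊗ D} {eD : D ⟶ 𝟙_ C} {dE : E ⟶ E ⊗ E} {eE : E ⟶ 𝟙_ C}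
  {nA : A ⊗ A ⟶ A} {uA : 𝟙_ C ⟶ A} {nB : B ⊗ B ⟶ B} {uB : 𝟙_ C ⟶ B}
  {nD : D ⊗ D ⟶ D} {uD : 𝟙_ C ⟶ D} {nE : E ⊗ E ⟶ E} {uE : 𝟙_ C ⟶ E}

namespace IsComonMap

theorem id : IsComonMap dA eA dA eA (𝟙 A) := ⟨by simp, by simp⟩

theorem comp {f : A ⟶ B} {g : B ⟶ D} (hf : IsComonMap dA eA dB eB f)
    (hg : IsComonMap dB eB dD eD g) : IsComonMap dA eA dD eD (f ≫ g) :=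
  ⟨by rw [Category.assoc, hg.comul, ← Category.assoc, hf.comul]; simp,
    by rw [Category.assoc, hg.counit, hf.counit]⟩

theorem inv {f : A ≅ B} (hf : IsComonMap dA eA dB eB f.hom) : IsComonMap dB eB dA eA f.inv :=
  ⟨by rw [Iso.inv_comp_eq, ← Category.assoc, hf.comul]; simp,
    by rw [Iso.inv_comp_eq, hf.counit]⟩

theorem tensor {f : A ⟶ B} {g : D ⟶ E} (hf : IsComonMap dA eA dB eB f)
    (hg : IsComonMap dD eD dE eE g) :
    IsComonMap ((dA ⊗ₘ dD) ≫ tensorμ A A D D) ((eA ⊗ₘ eD) ≫ (ρ_ _).hom)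
      ((dB ⊗ₘ dE) ≫ tensorμ B B E E) ((eB ⊗ₘ eE) ≫ (ρ_ _).hom) (f ⊗ₘ g) := by
  constructor
  · rw [Category.assoc, ← tensorμ_natural, ← Category.assoc, ← Category.assoc,
      tensorHom_comp_tensorHom, tensorHom_comp_tensorHom, hf.comul, hg.comul]
  · rw [← Category.assoc, tensorHom_comp_tensorHom, hf.counit, hg.counit]

end IsComonMap

namespace IsMonMap

theorem id : IsMonMap nA uA nA uA (𝟙 A) := ⟨by simp, by simp⟩

theorem comp {f : A ⟶ B} {g : B ⟶ D} (hf : IsMonMap nA uA nB uB f)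
    (hg : IsMonMap nB uB nD uD g) : IsMonMap nA uA nD uD (f ≫ g) :=
  ⟨by rw [← Category.assoc, hf.mul, Category.assoc, hg.mul]; simp,
    by rw [← Category.assoc, hf.unit, hg.unit]⟩

theorem inv {f : A ≅ B} (hf : IsMonMap nA uA nB uB f.hom) : IsMonMap nB uB nA uA f.inv :=
  ⟨by rw [Iso.comp_inv_eq, Category.assoc, hf.mul]; simp,
    by rw [Iso.comp_inv_eq, hf.unit]⟩

theorem tensor {f : A ⟶ B} {g : D ⟶ E} (hf : IsMonMap nA uA nB uB f)
    (hg : IsMonMap nD uD nE uE g) :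
    IsMonMap (tensorμ A D A D ≫ (nA ⊗ₘ nD)) ((ρ_ _).inv ≫ (uA ⊗ₘ uD))
      (tensorμ B E B E ≫ (nB ⊗ₘ nE)) ((ρ_ _).inv ≫ (uB ⊗ₘ uE)) (f ⊗ₘ g) := by
  constructor
  · rw [← Category.assoc, tensorμ_natural, Category.assoc, Category.assoc,
      tensorHom_comp_tensorHom, tensorHom_comp_tensorHom, hf.mul, hg.mul]
  · rw [Category.assoc, tensorHom_comp_tensorHom, hf.unit, hg.unit]

end IsMonMap

namespace IsCocommComon

theorem one : IsCocommComon (𝟙_ C) (ρ_ (𝟙_ C)).inv (𝟙 (𝟙_ C)) where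
  coassoc := by simp
  counit_right := by simp
  counit_left := by simp [unitors_equal]
  cocomm := by simp [unitors_inv_equal]

theorem tensor (hA : IsCocommComon A dA eA) (hB : IsCocommComon B dB eB) :
    IsCocommComon (A ⊗ B) ((dA ⊗ₘ dB) ≫ tensorμ A A B B) ((eA ⊗ₘ eB) ≫ (ρ_ _).hom) where
  coassoc := by
    have h := associator_monoidal A A A B B B
    rw [← tensorHom_id, ← id_tensorHom] at h
    have h1 := tensorμ_natural (𝟙 A) dA (𝟙 B) dB
    have h2 := tensorμ_natural dA (𝟙 A) dB (𝟙 B)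
    rw [id_tensorHom_id] at h1 h2
    calc _ = (dA ⊗ₘ dB) ≫ (tensorμ A A B B ≫ (𝟙 (A ⊗ B) ⊗ₘ (dA ⊗ₘ dB))) ≫
          (𝟙 (A ⊗ B) ⊗ₘ tensorμ A A B B) := by simp
      _ = ((dA ≫ (𝟙 A ⊗ₘ dA)) ⊗ₘ (dB ≫ (𝟙 B ⊗ₘ dB))) ≫ tensorμ A (A ⊗ A) B (B ⊗ B) ≫
          (𝟙 (A ⊗ B) ⊗ₘ tensorμ A A B B) := by
        rw [← h1, ← tensorHom_comp_tensorHom]; simp only [Category.assoc]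
      _ = ((dA ≫ (dA ⊗ₘ 𝟙 A)) ⊗ₘ (dB ≫ (dB ⊗ₘ 𝟙 B))) ≫
          ((α_ A A A).hom ⊗ₘ (α_ B B B).hom) ≫ tensorμ A (A ⊗ A) B (B ⊗ B) ≫
          (𝟙 (A ⊗ B) ⊗ₘ tensorμ A A B B) := by
        rw [hA.coassoc, hB.coassoc, tensorHom_comp_tensorHom_assoc]; simp only [Category.assoc]
      _ = (dA ⊗ₘ dB) ≫ (((dA ⊗ₘ 𝟙 A) ⊗ₘ (dB ⊗ₘ 𝟙 B)) ≫ tensorμ (A ⊗ A) A (B ⊗ B) B) ≫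
          (tensorμ A A B B ⊗ₘ 𝟙 (A ⊗ B)) ≫ (α_ _ _ _).hom := by
        rw [← h, ← tensorHom_comp_tensorHom]; simp only [Category.assoc]
      _ = _ := by rw [h2]; simp
  counit_right := by
    have h := rightUnitor_monoidal A B
    have h1 := tensorμ_natural (𝟙 A) eA (𝟙 B) eB
    rw [id_tensorHom_id] at h1
    calc _ = (dA ⊗ₘ dB) ≫ (tensorμ A A B B ≫ (𝟙 (A ⊗ B) ⊗ₘ (eA ⊗ₘ eB))) ≫
          (𝟙 (A ⊗ B) ⊗ₘ (ρ_ _).hom) ≫ (ρ_ _).hom := by simp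
      _ = ((dA ≫ (𝟙 A ⊗ₘ eA)) ⊗ₘ (dB ≫ (𝟙 B ⊗ₘ eB))) ≫ ((ρ_ A).hom ⊗ₘ (ρ_ B).hom) := by
        rw [← h1, h, ← tensorHom_comp_tensorHom, unitors_equal]; simp
      _ = 𝟙 _ := by
        rw [tensorHom_comp_tensorHom, Category.assoc, Category.assoc, hA.counit_right,
          hB.counit_right, id_tensorHom_id]
  counit_left := by
    have h := leftUnitor_monoidal A B
    have h1 := tensorμ_natural eA (𝟙 A) eB (𝟙 B)
    rw [id_tensorHom_id] at h1
    calc _ = (dA ⊗ₘ dB) ≫ (tensorμ A A B B ≫ ((eA ⊗ₘ eB) ⊗ₘ 𝟙 (A ⊗ B))) ≫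
          ((ρ_ _).hom ⊗ₘ 𝟙 (A ⊗ B)) ≫ (λ_ _).hom := by simp
      _ = ((dA ≫ (eA ⊗ₘ 𝟙 A)) ⊗ₘ (dB ≫ (eB ⊗ₘ 𝟙 B))) ≫ ((λ_ A).hom ⊗ₘ (λ_ B).hom) := by
        rw [← h1, h, ← tensorHom_comp_tensorHom, unitors_equal]; simp
      _ = 𝟙 _ := by
        rw [tensorHom_comp_tensorHom, Category.assoc, Category.assoc, hA.counit_left,
          hB.counit_left, id_tensorHom_id]
  cocomm := by
    rw [Category.assoc, SymmetricCategory.tensorμ_braid_swap, tensorHom_comp_tensorHom_assoc,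
      hA.cocomm, hB.cocomm]

end IsCocommComon

theorem isComonMap_associator :
    IsComonMap ((((dA ⊗ₘ dB) ≫ tensorμ A A B B) ⊗ₘ dD) ≫ tensorμ (A ⊗ B) (A ⊗ B) D D)
      ((((eA ⊗ₘ eB) ≫ (ρ_ _).hom) ⊗ₘ eD) ≫ (ρ_ _).hom)
      ((dA ⊗ₘ ((dB ⊗ₘ dD) ≫ tensorμ B B D D)) ≫ tensorμ A A (B ⊗ D) (B ⊗ D))
      ((eA ⊗ₘ ((eB ⊗ₘ eD) ≫ (ρ_ _).hom)) ≫ (ρ_ _).hom) (α_ A B D).hom where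
  comul := by
    have h := tensor_associativity A A B B D D
    rw [← tensorHom_id, ← id_tensorHom] at h
    calc _ = (α_ A B D).hom ≫ (dA ⊗ₘ (dB ⊗ₘ dD)) ≫ (𝟙 (A ⊗ A) ⊗ₘ tensorμ B B D D) ≫
          tensorμ A A (B ⊗ D) (B ⊗ D) := by
          rw [tensorHom_comp_tensorHom_assoc, Category.comp_id]
      _ = ((dA ⊗ₘ dB) ⊗ₘ dD) ≫ (tensorμ A A B B ⊗ₘ 𝟙 (D ⊗ D)) ≫
        tensorμ (A ⊗ B) (A ⊗ B) D D ≫ ((α_ A B D).hom ⊗ₘ (α_ A B D).hom) := by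
          rw [h, associator_naturality_assoc]
      _ = _ := by rw [tensorHom_comp_tensorHom_assoc, Category.comp_id, Category.assoc]
  counit := by
    calc _ = (α_ A B D).hom ≫ (eA ⊗ₘ (eB ⊗ₘ eD)) ≫ (𝟙 _ ⊗ₘ (ρ_ _).hom) ≫ (ρ_ _).hom := by
          rw [tensorHom_comp_tensorHom_assoc, Category.comp_id]
      _ = ((eA ⊗ₘ eB) ⊗ₘ eD) ≫ ((ρ_ _).hom ⊗ₘ 𝟙 _) ≫ (ρ_ _).hom := by
          rw [← associator_naturality_assoc]; simp
      _ = _ := by rw [tensorHom_comp_tensorHom_assoc, Category.comp_id]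

theorem isComonMap_leftUnitor :
    IsComonMap (((ρ_ (𝟙_ C)).inv ⊗ₘ dA) ≫ tensorμ (𝟙_ C) (𝟙_ C) A A)
      ((𝟙 (𝟙_ C) ⊗ₘ eA) ≫ (ρ_ _).hom) dA eA (λ_ A).hom where
  comul := by
    have h := tensor_left_unitality A A
    rw [← leftUnitor_naturality, h, ← unitors_inv_equal, ← tensorHom_id, ← id_tensorHom,
      tensorHom_comp_tensorHom_assoc]
    simp
  counit := by rw [← unitors_equal]; simp

theorem isComonMap_rightUnitor :
    IsComonMap ((dA ⊗ₘ (ρ_ (𝟙_ C)).inv) ≫ tensorμ A A (𝟙_ C) (𝟙_ C))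
      ((eA ⊗ₘ 𝟙 (𝟙_ C)) ≫ (ρ_ _).hom) dA eA (ρ_ A).hom where
  comul := by
    have h := tensor_right_unitality A A
    rw [← rightUnitor_naturality, h, ← unitors_inv_equal, ← tensorHom_id, ← id_tensorHom,
      tensorHom_comp_tensorHom_assoc]
    simp
  counit := by simp

theorem isComonMap_braiding :
    IsComonMap ((dA ⊗ₘ dB) ≫ tensorμ A A B B) ((eA ⊗ₘ eB) ≫ (ρ_ _).hom)
      ((dB ⊗ₘ dA) ≫ tensorμ B B A A) ((eB ⊗ₘ eA) ≫ (ρ_ _).hom) (β_ A B).hom where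
  comul := by
    rw [← BraidedCategory.braiding_naturality_assoc]
    rw [Category.assoc]
    congr 1
    simp [tensorμ, MonoidalCategory.tensorHom_def,
      SymmetricCategory.braiding_swap_eq_inv_braiding B A]
  counit := by
    rw [← BraidedCategory.braiding_naturality_assoc]
    simp [unitors_inv_equal]

/-- The comultiplication of a cocommutative comonoid is a comonoid morphism. -/
theorem IsCocommComon.isComonMap_comul (h : IsCocommComon A dA eA) :
    IsComonMap dA eA ((dA ⊗ₘ dA) ≫ tensorμ A A A A) ((eA ⊗ₘ eA) ≫ (ρ_ _).hom) dA where
  comul := by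
    have h1 : dA ≫ (dA ⊗ₘ dA) = dA ≫ (𝟙 A ⊗ₘ (dA ≫ (dA ⊗ₘ 𝟙 A))) ≫ (𝟙 A ⊗ₘ (α_ A A A).hom) ≫
        (α_ A A (A ⊗ A)).inv := by
      have h2 := h.coassoc
      rw [← Category.assoc, ← Iso.comp_inv_eq] at h2
      calc _ = dA ≫ (dA ⊗ₘ 𝟙 A) ≫ (𝟙 (A ⊗ A) ⊗ₘ dA) := by
            rw [tensorHom_comp_tensorHom, Category.id_comp, Category.comp_id]
        _ = dA ≫ (𝟙 A ⊗ₘ dA) ≫ (𝟙 A ⊗ₘ (𝟙 A ⊗ₘ dA)) ≫ (α_ A A (A ⊗ A)).inv := by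
          simp only [Category.assoc] at h2
          rw [← reassoc_of% h2, associator_inv_naturality, id_tensorHom_id]
        _ = _ := by
          rw [tensorHom_comp_tensorHom_assoc, h.coassoc]; simp
    have h3 : dA ≫ (dA ⊗ₘ 𝟙 A) ≫ ((β_ A A).hom ⊗ₘ 𝟙 A) = dA ≫ (dA ⊗ₘ 𝟙 A) := by
      rw [tensorHom_comp_tensorHom, h.cocomm, Category.comp_id]
    rw [← Category.assoc, h1]
    calc _ = dA ≫ (𝟙 A ⊗ₘ (dA ≫ (dA ⊗ₘ 𝟙 A) ≫ ((β_ A A).hom ⊗ₘ 𝟙 A))) ≫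
          (𝟙 A ⊗ₘ (α_ A A A).hom) ≫ (α_ A A (A ⊗ A)).inv := by simp [tensorμ]
      _ = _ := by rw [h3]
  counit := by
    calc _ = (dA ≫ (𝟙 A ⊗ₘ eA) ≫ (ρ_ A).hom) ≫ eA := by
          rw [Category.assoc, Category.assoc, ← rightUnitor_naturality, ← tensorHom_id,
            tensorHom_comp_tensorHom_assoc, Category.id_comp, Category.comp_id]
      _ = eA := by rw [h.counit_right, Category.id_comp]

/-- The monoid object of a commutative monoid. -/
abbrev IsCommMon.toObj (h : IsCommMon A nA uA) : MonObj A where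
  one := uA
  mul := nA
  one_mul := by
    have := h.unit_left
    rw [Iso.inv_comp_eq] at this
    simpa using this
  mul_one := by
    have := h.unit_right
    rw [Iso.inv_comp_eq] at this
    simpa using this
  mul_assoc := by
    have := h.assoc
    rw [Iso.eq_inv_comp] at this
    simpa using this.symm

theorem IsCommMon.one : IsCommMon (𝟙_ C) (ρ_ (𝟙_ C)).hom (𝟙 (𝟙_ C)) where
  assoc := by simp
  unit_right := by simp
  unit_left := by simp [unitors_inv_equal]
  comm := by simp [unitors_inv_equal]

theorem IsCommMon.tensor (hA : IsCommMon A nA uA) (hB : IsCommMon B nB uB) :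
    IsCommMon (A ⊗ B) (tensorμ A B A B ≫ (nA ⊗ₘ nB)) ((ρ_ _).inv ≫ (uA ⊗ₘ uB)) := by
  let _ := hA.toObj
  let _ := hB.toObj
  have : IsCommMonObj A := ⟨hA.comm⟩
  have : IsCommMonObj B := ⟨hB.comm⟩
  have h1 := MonObj.mul_assoc (A ⊗ B)
  have h2 := MonObj.mul_one (A ⊗ B)
  have h3 := MonObj.one_mul (A ⊗ B)
  have h4 := IsCommMonObj.mul_comm (A ⊗ B)
  rw [← unitors_inv_equal]
  refine ⟨?_, ?_, ?_, h4⟩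
  · rw [Iso.eq_inv_comp, tensorHom_id, id_tensorHom]; exact h1.symm
  · rw [Iso.inv_comp_eq, id_tensorHom, Category.comp_id]; exact h2
  · rw [Iso.inv_comp_eq, tensorHom_id, Category.comp_id]; exact h3

theorem isMonMap_associator (hA : IsCommMon A nA uA) (hB : IsCommMon B nB uB)
    (hD : IsCommMon D nD uD) :
    IsMonMap (tensorμ (A ⊗ B) D (A ⊗ B) D ≫ ((tensorμ A B A B ≫ (nA ⊗ₘ nB)) ⊗ₘ nD))
      ((ρ_ _).inv ≫ (((ρ_ _).inv ≫ (uA ⊗ₘ uB)) ⊗ₘ uD))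
      (tensorμ A (B ⊗ D) A (B ⊗ D) ≫ (nA ⊗ₘ (tensorμ B D B D ≫ (nB ⊗ₘ nD))))
      ((ρ_ _).inv ≫ (uA ⊗ₘ ((ρ_ _).inv ≫ (uB ⊗ₘ uD)))) (α_ A B D).hom := by
  let _ := hA.toObj
  let _ := hB.toObj
  let _ := hD.toObj
  rw [← unitors_inv_equal]
  exact ⟨IsMonHom.mul_hom (f := (α_ A B D).hom), IsMonHom.one_hom (f := (α_ A B D).hom)⟩

theorem isMonMap_leftUnitor (hA : IsCommMon A nA uA) :
    IsMonMap (tensorμ (𝟙_ C) A (𝟙_ C) A ≫ ((ρ_ (𝟙_ C)).hom ⊗ₘ nA))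
      ((ρ_ _).inv ≫ (𝟙 (𝟙_ C) ⊗ₘ uA)) nA uA (λ_ A).hom := by
  let _ := hA.toObj
  rw [← unitors_inv_equal, ← unitors_equal]
  exact ⟨IsMonHom.mul_hom (f := (λ_ A).hom), IsMonHom.one_hom (f := (λ_ A).hom)⟩

theorem isMonMap_rightUnitor (hA : IsCommMon A nA uA) :
    IsMonMap (tensorμ A (𝟙_ C) A (𝟙_ C) ≫ (nA ⊗ₘ (ρ_ (𝟙_ C)).hom))
      ((ρ_ _).inv ≫ (uA ⊗ₘ 𝟙 (𝟙_ C))) nA uA (ρ_ A).hom := by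
  let _ := hA.toObj
  rw [← unitors_inv_equal, ← unitors_equal]
  exact ⟨IsMonHom.mul_hom (f := (ρ_ A).hom), IsMonHom.one_hom (f := (ρ_ A).hom)⟩

theorem isMonMap_braiding (hA : IsCommMon A nA uA) (hB : IsCommMon B nB uB) :
    IsMonMap (tensorμ A B A B ≫ (nA ⊗ₘ nB)) ((ρ_ _).inv ≫ (uA ⊗ₘ uB))
      (tensorμ B A B A ≫ (nB ⊗ₘ nA)) ((ρ_ _).inv ≫ (uB ⊗ₘ uA)) (β_ A B).hom := by
  let _ := hA.toObj
  let _ := hB.toObj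
  rw [← unitors_inv_equal]
  exact ⟨MonObj.mul_braiding A B, MonObj.one_braiding A B⟩

/-- The multiplication of a commutative monoid is a monoid morphism. -/
theorem IsCommMon.isMonMap_mul (h : IsCommMon A nA uA) :
    IsMonMap (tensorμ A A A A ≫ (nA ⊗ₘ nA)) ((ρ_ _).inv ≫ (uA ⊗ₘ uA)) nA uA nA := by
  let _ := h.toObj
  have : IsCommMonObj A := ⟨h.comm⟩
  constructor
  · rw [Category.assoc]
    exact MonObj.mul_mul_mul_comm A
  · calc _ = uA ≫ ((ρ_ A).inv ≫ (𝟙 A ⊗ₘ uA) ≫ nA) := by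
          rw [rightUnitor_inv_naturality_assoc, ← tensorHom_id,
            tensorHom_comp_tensorHom_assoc, Category.id_comp, Category.comp_id, Category.assoc]
      _ = uA := by rw [h.unit_right, Category.comp_id]

theorem copy_proj (hA : IsCocommComon A dA eA) (hB : IsCocommComon B dB eB) :
    ((dA ⊗ₘ dB) ≫ tensorμ A A B B) ≫ (((𝟙 A ⊗ₘ eB) ≫ (ρ_ A).hom) ⊗ₘ ((eA ⊗ₘ 𝟙 B) ≫ (λ_ B).hom)) =
      𝟙 (A ⊗ B) := by
  have h : tensorμ A (𝟙_ C) (𝟙_ C) B ≫ ((ρ_ A).hom ⊗ₘ (λ_ B).hom) =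
      (ρ_ A).hom ⊗ₘ (λ_ B).hom := by
    have h0 : (β_ (𝟙_ C) (𝟙_ C)).hom = 𝟙 _ := by simp [unitors_inv_equal]
    simp [tensorμ, h0]
  rw [← tensorHom_comp_tensorHom, Category.assoc, ← tensorμ_natural_assoc, h,
    tensorHom_comp_tensorHom, tensorHom_comp_tensorHom, hA.counit_right, hB.counit_left,
    id_tensorHom_id]

theorem cocopy_inj (hA : IsCommMon A nA uA) (hB : IsCommMon B nB uB) :
    (((ρ_ A).inv ≫ (𝟙 A ⊗ₘ uB)) ⊗ₘ ((λ_ B).inv ≫ (uA ⊗ₘ 𝟙 B))) ≫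
      (tensorμ A B A B ≫ (nA ⊗ₘ nB)) = 𝟙 (A ⊗ B) := by
  have h : ((ρ_ A).inv ⊗ₘ (λ_ B).inv) ≫ tensorμ A (𝟙_ C) (𝟙_ C) B =
      (ρ_ A).inv ⊗ₘ (λ_ B).inv := by
    have h0 : (β_ (𝟙_ C) (𝟙_ C)).hom = 𝟙 _ := by simp [unitors_inv_equal]
    simp [tensorμ, h0]
  rw [← tensorHom_comp_tensorHom, Category.assoc, tensorμ_natural_assoc, reassoc_of% h,
    tensorHom_comp_tensorHom, tensorHom_comp_tensorHom, hA.unit_right, hB.unit_left,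
    id_tensorHom_id]

theorem lift_fst (hD : IsCocommComon D dD eD) {f : D ⟶ A} {g : D ⟶ B} (hg : g ≫ eB = eD) :
    (dD ≫ (f ⊗ₘ g)) ≫ ((𝟙 A ⊗ₘ eB) ≫ (ρ_ A).hom) = f := by
  calc _ = dD ≫ (𝟙 D ⊗ₘ eD) ≫ (f ⊗ₘ 𝟙 _) ≫ (ρ_ A).hom := by
        simp only [Category.assoc, tensorHom_comp_tensorHom_assoc, Category.comp_id,
          Category.id_comp, hg]
    _ = (dD ≫ (𝟙 D ⊗ₘ eD) ≫ (ρ_ D).hom) ≫ f := by simp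
    _ = f := by rw [hD.counit_right, Category.id_comp]

theorem lift_snd (hD : IsCocommComon D dD eD) {f : D ⟶ A} {g : D ⟶ B} (hf : f ≫ eA = eD) :
    (dD ≫ (f ⊗ₘ g)) ≫ ((eA ⊗ₘ 𝟙 B) ≫ (λ_ B).hom) = g := by
  calc _ = dD ≫ (eD ⊗ₘ 𝟙 D) ≫ (𝟙 _ ⊗ₘ g) ≫ (λ_ B).hom := by
        simp only [Category.assoc, tensorHom_comp_tensorHom_assoc, Category.comp_id,
          Category.id_comp, hf]
    _ = (dD ≫ (eD ⊗ₘ 𝟙 D) ≫ (λ_ D).hom) ≫ g := by simp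
    _ = g := by rw [hD.counit_left, Category.id_comp]

theorem lift_eta (hA : IsCocommComon A dA eA) (hB : IsCocommComon B dB eB) {m : D ⟶ A ⊗ B}
    (hm : IsComonMap dD eD ((dA ⊗ₘ dB) ≫ tensorμ A A B B) ((eA ⊗ₘ eB) ≫ (ρ_ _).hom) m) :
    m = dD ≫ ((m ≫ (𝟙 A ⊗ₘ eB) ≫ (ρ_ A).hom) ⊗ₘ (m ≫ (eA ⊗ₘ 𝟙 B) ≫ (λ_ B).hom)) := by
  conv_lhs => rw [← Category.comp_id m, ← copy_proj hA hB]
  rw [← Category.assoc, hm.comul, Category.assoc, tensorHom_comp_tensorHom]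

theorem inl_desc (hD : IsCommMon D nD uD) {f : A ⟶ D} {g : B ⟶ D} (hg : uB ≫ g = uD) :
    ((ρ_ A).inv ≫ (𝟙 A ⊗ₘ uB)) ≫ ((f ⊗ₘ g) ≫ nD) = f := by
  calc _ = (ρ_ A).inv ≫ (f ⊗ₘ 𝟙 _) ≫ (𝟙 D ⊗ₘ uD) ≫ nD := by
        simp only [Category.assoc, tensorHom_comp_tensorHom_assoc, Category.comp_id,
          Category.id_comp, hg]
    _ = f ≫ ((ρ_ D).inv ≫ (𝟙 D ⊗ₘ uD) ≫ nD) := by simp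
    _ = f := by rw [hD.unit_right, Category.comp_id]

theorem inr_desc (hD : IsCommMon D nD uD) {f : A ⟶ D} {g : B ⟶ D} (hf : uA ≫ f = uD) :
    ((λ_ B).inv ≫ (uA ⊗ₘ 𝟙 B)) ≫ ((f ⊗ₘ g) ≫ nD) = g := by
  calc _ = (λ_ B).inv ≫ (𝟙 _ ⊗ₘ g) ≫ (uD ⊗ₘ 𝟙 D) ≫ nD := by
        simp only [Category.assoc, tensorHom_comp_tensorHom_assoc, Category.comp_id,
          Category.id_comp, hf]
    _ = g ≫ ((λ_ D).inv ≫ (uD ⊗ₘ 𝟙 D) ≫ nD) := by simp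
    _ = g := by rw [hD.unit_left, Category.comp_id]

theorem desc_eta (hA : IsCommMon A nA uA) (hB : IsCommMon B nB uB) {m : A ⊗ B ⟶ D}
    (hm : IsMonMap (tensorμ A B A B ≫ (nA ⊗ₘ nB)) ((ρ_ _).inv ≫ (uA ⊗ₘ uB)) nD uD m) :
    m = ((((ρ_ A).inv ≫ (𝟙 A ⊗ₘ uB)) ≫ m) ⊗ₘ (((λ_ B).inv ≫ (uA ⊗ₘ 𝟙 B)) ≫ m)) ≫ nD := by
  conv_lhs => rw [← Category.id_comp m, ← cocopy_inj hA hB]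
  rw [Category.assoc, hm.mul, ← Category.assoc, tensorHom_comp_tensorHom]

end Generic

end LD
namespace LD

section TwoStructures

set_option linter.unusedSimpArgs false

variable {C : Type u} [Category.{v} C] [BiSymMonoidal C]

/-- `(A, Δ, e)` is a cocommutative `⊗`-comonoid. -/
abbrev TComon (A : C) (Δ : A ⟶ A ⊗ᵒ A) (e : A ⟶ ⊤ᵒ) : Prop :=
  @IsCocommComon C _ BiSymMonoidal.ten BiSymMonoidal.tenSymm A Δ e

/-- `(A, ∇, u)` is a commutative `⊕`-monoid. -/
abbrev PMon (A : C) (nab : A ⊕ᵒ A ⟶ A) (u : ⊥ᵒ ⟶ A) : Prop :=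
  @IsCommMon C _ BiSymMonoidal.par BiSymMonoidal.parSymm A nab u

/-- Morphisms of `⊗`-comonoids. -/
abbrev TComonMap {A B : C} (Δ : A ⟶ A ⊗ᵒ A) (e : A ⟶ ⊤ᵒ) (Δ' : B ⟶ B ⊗ᵒ B) (e' : B ⟶ ⊤ᵒ)
    (f : A ⟶ B) : Prop :=
  @IsComonMap C _ BiSymMonoidal.ten _ _ Δ e Δ' e' f

/-- Morphisms of `⊕`-monoids. -/
abbrev PMonMap {A B : C} (nab : A ⊕ᵒ A ⟶ A) (u : ⊥ᵒ ⟶ A) (nab' : B ⊕ᵒ B ⟶ B) (u' : ⊥ᵒ ⟶ B)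
    (f : A ⟶ B) : Prop :=
  @IsMonMap C _ BiSymMonoidal.par _ _ nab u nab' u' f

variable {A₁ A₂ A₃ B₁ B₂ B₃ D₁ D₂ E₁ E₂ : C}

theorem tc (f : A₁ ⟶ A₂) (f' : A₂ ⟶ A₃) (g : B₁ ⟶ B₂) (g' : B₂ ⟶ B₃) :
    f ⊗ʰ g ≫ f' ⊗ʰ g' = (f ≫ f') ⊗ʰ (g ≫ g') :=
  @MonoidalCategory.tensorHom_comp_tensorHom C _ BiSymMonoidal.ten _ _ _ _ _ _ f g f' g'

theorem tc' (f : A₁ ⟶ A₂) (f' : A₂ ⟶ A₃) (g : B₁ ⟶ B₂) (g' : B₂ ⟶ B₃) {Z : C}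
    (k : A₃ ⊗ᵒ B₃ ⟶ Z) : f ⊗ʰ g ≫ f' ⊗ʰ g' ≫ k = (f ≫ f') ⊗ʰ (g ≫ g') ≫ k := by
  rw [← Category.assoc, tc]

theorem tid (A B : C) : 𝟙 A ⊗ʰ 𝟙 B = 𝟙 (A ⊗ᵒ B) :=
  @MonoidalCategory.id_tensorHom_id C _ BiSymMonoidal.ten A B

theorem pc (f : A₁ ⟶ A₂) (f' : A₂ ⟶ A₃) (g : B₁ ⟶ B₂) (g' : B₂ ⟶ B₃) :
    f ⊕ʰ g ≫ f' ⊕ʰ g' = (f ≫ f') ⊕ʰ (g ≫ g') :=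
  @MonoidalCategory.tensorHom_comp_tensorHom C _ BiSymMonoidal.par _ _ _ _ _ _ f g f' g'

theorem pc' (f : A₁ ⟶ A₂) (f' : A₂ ⟶ A₃) (g : B₁ ⟶ B₂) (g' : B₂ ⟶ B₃) {Z : C}
    (k : A₃ ⊕ᵒ B₃ ⟶ Z) : f ⊕ʰ g ≫ f' ⊕ʰ g' ≫ k = (f ≫ f') ⊕ʰ (g ≫ g') ≫ k := by
  rw [← Category.assoc, pc]

theorem pid (A B : C) : 𝟙 A ⊕ʰ 𝟙 B = 𝟙 (A ⊕ᵒ B) :=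
  @MonoidalCategory.id_tensorHom_id C _ BiSymMonoidal.par A B

theorem tα_nat (f : A₁ ⟶ A₂) (g : B₁ ⟶ B₂) (h : D₁ ⟶ D₂) :
    (f ⊗ʰ g) ⊗ʰ h ≫ (tα A₂ B₂ D₂).hom = (tα A₁ B₁ D₁).hom ≫ f ⊗ʰ (g ⊗ʰ h) :=
  @MonoidalCategory.associator_naturality C _ BiSymMonoidal.ten _ _ _ _ _ _ f g h

theorem tα_inv_nat (f : A₁ ⟶ A₂) (g : B₁ ⟶ B₂) (h : D₁ ⟶ D₂) :
    f ⊗ʰ (g ⊗ʰ h) ≫ (tα A₂ B₂ D₂).inv = (tα A₁ B₁ D₁).inv ≫ (f ⊗ʰ g) ⊗ʰ h :=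
  @MonoidalCategory.associator_inv_naturality C _ BiSymMonoidal.ten _ _ _ _ _ _ f g h

theorem pα_nat (f : A₁ ⟶ A₂) (g : B₁ ⟶ B₂) (h : D₁ ⟶ D₂) :
    f ⊕ʰ (g ⊕ʰ h) ≫ (pα A₂ B₂ D₂).hom = (pα A₁ B₁ D₁).hom ≫ (f ⊕ʰ g) ⊕ʰ h :=
  @MonoidalCategory.associator_inv_naturality C _ BiSymMonoidal.par _ _ _ _ _ _ f g h

theorem pα_inv_nat (f : A₁ ⟶ A₂) (g : B₁ ⟶ B₂) (h : D₁ ⟶ D₂) :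
    (f ⊕ʰ g) ⊕ʰ h ≫ (pα A₂ B₂ D₂).inv = (pα A₁ B₁ D₁).inv ≫ f ⊕ʰ (g ⊕ʰ h) :=
  @MonoidalCategory.associator_naturality C _ BiSymMonoidal.par _ _ _ _ _ _ f g h

theorem tσ_nat (f : A₁ ⟶ A₂) (g : B₁ ⟶ B₂) :
    f ⊗ʰ g ≫ (tσ A₂ B₂).hom = (tσ A₁ B₁).hom ≫ g ⊗ʰ f :=
  @BraidedCategory.braiding_naturality C _ BiSymMonoidal.ten
    (BiSymMonoidal.tenSymm (C := C)).toBraidedCategory _ _ _ _ f g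

theorem pσ_nat (f : A₁ ⟶ A₂) (g : B₁ ⟶ B₂) :
    f ⊕ʰ g ≫ (pσ A₂ B₂).hom = (pσ A₁ B₁).hom ≫ g ⊕ʰ f :=
  @BraidedCategory.braiding_naturality C _ BiSymMonoidal.par
    (BiSymMonoidal.parSymm (C := C)).toBraidedCategory _ _ _ _ f g

theorem tτ_nat (f : A₁ ⟶ A₂) (g : B₁ ⟶ B₂) (h : D₁ ⟶ D₂) (k : E₁ ⟶ E₂) :
    (f ⊗ʰ g) ⊗ʰ (h ⊗ʰ k) ≫ tτ A₂ B₂ D₂ E₂ = tτ A₁ B₁ D₁ E₁ ≫ (f ⊗ʰ h) ⊗ʰ (g ⊗ʰ k) :=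
  @MonoidalCategory.tensorμ_natural C _ BiSymMonoidal.ten
    (BiSymMonoidal.tenSymm (C := C)).toBraidedCategory _ _ _ _ _ _ _ _ f g h k

theorem pτ_nat (f : A₁ ⟶ A₂) (g : B₁ ⟶ B₂) (h : D₁ ⟶ D₂) (k : E₁ ⟶ E₂) :
    (f ⊕ʰ g) ⊕ʰ (h ⊕ʰ k) ≫ pτ A₂ B₂ D₂ E₂ = pτ A₁ B₁ D₁ E₁ ≫ (f ⊕ʰ h) ⊕ʰ (g ⊕ʰ k) :=
  @MonoidalCategory.tensorμ_natural C _ BiSymMonoidal.par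
    (BiSymMonoidal.parSymm (C := C)).toBraidedCategory _ _ _ _ _ _ _ _ f g h k

theorem tR_nat (f : A₁ ⟶ A₂) : (tR A₁).hom ≫ f ⊗ʰ 𝟙 ⊤ᵒ = f ≫ (tR A₂).hom := by
  have h := @MonoidalCategory.rightUnitor_inv_naturality C _ BiSymMonoidal.ten _ _ f
  rw [← @MonoidalCategory.tensorHom_id C _ BiSymMonoidal.ten] at h
  exact h.symm

theorem tL_nat (f : A₁ ⟶ A₂) : (tL A₁).hom ≫ 𝟙 ⊤ᵒ ⊗ʰ f = f ≫ (tL A₂).hom := by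
  have h := @MonoidalCategory.leftUnitor_inv_naturality C _ BiSymMonoidal.ten _ _ f
  rw [← @MonoidalCategory.id_tensorHom C _ BiSymMonoidal.ten] at h
  exact h.symm

theorem pR_nat (f : A₁ ⟶ A₂) : f ⊕ʰ 𝟙 ⊥ᵒ ≫ (pR A₂).hom = (pR A₁).hom ≫ f := by
  have h := @MonoidalCategory.rightUnitor_naturality C _ BiSymMonoidal.par _ _ f
  rw [← @MonoidalCategory.tensorHom_id C _ BiSymMonoidal.par] at h
  exact h

theorem pL_nat (f : A₁ ⟶ A₂) : 𝟙 ⊥ᵒ ⊕ʰ f ≫ (pL A₂).hom = (pL A₁).hom ≫ f := by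
  have h := @MonoidalCategory.leftUnitor_naturality C _ BiSymMonoidal.par _ _ f
  rw [← @MonoidalCategory.id_tensorHom C _ BiSymMonoidal.par] at h
  exact h

theorem tL_tOne : tL (⊤ᵒ : C) = tR ⊤ᵒ := by
  ext
  exact @MonoidalCategory.unitors_inv_equal C _ BiSymMonoidal.ten

theorem pL_pOne : pL (⊥ᵒ : C) = pR ⊥ᵒ := by
  ext
  exact @MonoidalCategory.unitors_equal C _ BiSymMonoidal.par

/-- The exchange of the first two factors of a triple tensor product. -/
def tJ (B D E : C) : B ⊗ᵒ (D ⊗ᵒ E) ⟶ D ⊗ᵒ (B ⊗ᵒ E) :=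
  (tα B D E).inv ≫ (tσ B D).hom ⊗ʰ 𝟙 E ≫ (tα D B E).hom

/-- The exchange of the first two factors of a triple par product. -/
def pJ (B D E : C) : B ⊕ᵒ (D ⊕ᵒ E) ⟶ D ⊕ᵒ (B ⊕ᵒ E) :=
  (pα B D E).hom ≫ (pσ B D).hom ⊕ʰ 𝟙 E ≫ (pα D B E).inv

theorem tτ_def (A B D E : C) : tτ A B D E = (tα A B (D ⊗ᵒ E)).hom ≫
    𝟙 A ⊗ʰ tJ B D E ≫ (tα A D (B ⊗ᵒ E)).inv :=
  @tensorμ_eq C _ BiSymMonoidal.ten BiSymMonoidal.tenSymm A B D E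

theorem pτ_def (A B D E : C) : pτ A B D E = (pα A B (D ⊕ᵒ E)).inv ≫
    𝟙 A ⊕ʰ pJ B D E ≫ (pα A D (B ⊕ᵒ E)).hom :=
  @tensorμ_eq C _ BiSymMonoidal.par BiSymMonoidal.parSymm A B D E

section

variable {A : C} {Δ : A ⟶ A ⊗ᵒ A} {e : A ⟶ ⊤ᵒ} {nab : A ⊕ᵒ A ⟶ A} {u : ⊥ᵒ ⟶ A}

theorem TComon.intro (h₁ : Δ ≫ 𝟙 A ⊗ʰ Δ = Δ ≫ Δ ⊗ʰ 𝟙 A ≫ (tα A A A).hom)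
    (h₂ : Δ ≫ 𝟙 A ⊗ʰ e = (tR A).hom) (h₃ : Δ ≫ e ⊗ʰ 𝟙 A = (tL A).hom)
    (h₄ : Δ ≫ (tσ A A).hom = Δ) : TComon A Δ e := by
  rw [← Iso.comp_inv_eq_id, Category.assoc] at h₂ h₃
  exact @IsCocommComon.mk C _ BiSymMonoidal.ten BiSymMonoidal.tenSymm A Δ e h₁ h₂ h₃ h₄

theorem PMon.intro (h₁ : 𝟙 A ⊕ʰ nab ≫ nab = (pα A A A).hom ≫ nab ⊕ʰ 𝟙 A ≫ nab)
    (h₂ : 𝟙 A ⊕ʰ u ≫ nab = (pR A).hom) (h₃ : u ⊕ʰ 𝟙 A ≫ nab = (pL A).hom)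
    (h₄ : (pσ A A).hom ≫ nab = nab) : PMon A nab u := by
  rw [← Iso.inv_comp_eq_id] at h₂ h₃
  exact @IsCommMon.mk C _ BiSymMonoidal.par BiSymMonoidal.parSymm A nab u h₁ h₂ h₃ h₄

theorem TComon.co (h : TComon A Δ e) :
    Δ ≫ 𝟙 A ⊗ʰ Δ = Δ ≫ Δ ⊗ʰ 𝟙 A ≫ (tα A A A).hom :=
  @IsCocommComon.coassoc C _ BiSymMonoidal.ten BiSymMonoidal.tenSymm A Δ e h

theorem TComon.cr (h : TComon A Δ e) : Δ ≫ 𝟙 A ⊗ʰ e = (tR A).hom := by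
  rw [← Iso.comp_inv_eq_id, Category.assoc]
  exact @IsCocommComon.counit_right C _ BiSymMonoidal.ten BiSymMonoidal.tenSymm A Δ e h

theorem TComon.cl (h : TComon A Δ e) : Δ ≫ e ⊗ʰ 𝟙 A = (tL A).hom := by
  rw [← Iso.comp_inv_eq_id, Category.assoc]
  exact @IsCocommComon.counit_left C _ BiSymMonoidal.ten BiSymMonoidal.tenSymm A Δ e h

theorem TComon.cc (h : TComon A Δ e) : Δ ≫ (tσ A A).hom = Δ :=
  @IsCocommComon.cocomm C _ BiSymMonoidal.ten BiSymMonoidal.tenSymm A Δ e h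

theorem PMon.as (h : PMon A nab u) :
    𝟙 A ⊕ʰ nab ≫ nab = (pα A A A).hom ≫ nab ⊕ʰ 𝟙 A ≫ nab :=
  @IsCommMon.assoc C _ BiSymMonoidal.par BiSymMonoidal.parSymm A nab u h

theorem PMon.ur (h : PMon A nab u) : 𝟙 A ⊕ʰ u ≫ nab = (pR A).hom := by
  rw [← Iso.inv_comp_eq_id]
  exact @IsCommMon.unit_right C _ BiSymMonoidal.par BiSymMonoidal.parSymm A nab u h

theorem PMon.ul (h : PMon A nab u) : u ⊕ʰ 𝟙 A ≫ nab = (pL A).hom := by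
  rw [← Iso.inv_comp_eq_id]
  exact @IsCommMon.unit_left C _ BiSymMonoidal.par BiSymMonoidal.parSymm A nab u h

theorem PMon.cm (h : PMon A nab u) : (pσ A A).hom ≫ nab = nab :=
  @IsCommMon.comm C _ BiSymMonoidal.par BiSymMonoidal.parSymm A nab u h

theorem TComon.top : TComon (⊤ᵒ : C) (tR ⊤ᵒ).hom (𝟙 _) :=
  @IsCocommComon.one C _ BiSymMonoidal.ten BiSymMonoidal.tenSymm

theorem PMon.bot : PMon (⊥ᵒ : C) (pR ⊥ᵒ).hom (𝟙 _) :=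
  @IsCommMon.one C _ BiSymMonoidal.par BiSymMonoidal.parSymm

variable {B : C} {Δ' : B ⟶ B ⊗ᵒ B} {e' : B ⟶ ⊤ᵒ} {nab' : B ⊕ᵒ B ⟶ B} {u' : ⊥ᵒ ⟶ B}

theorem TComon.ten (h : TComon A Δ e) (h' : TComon B Δ' e') :
    TComon (A ⊗ᵒ B) (Δ ⊗ʰ Δ' ≫ tτ A A B B) (e ⊗ʰ e' ≫ (tR ⊤ᵒ).inv) :=
  @IsCocommComon.tensor C _ BiSymMonoidal.ten BiSymMonoidal.tenSymm _ _ _ _ _ _ h h'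

theorem PMon.par (h : PMon A nab u) (h' : PMon B nab' u') :
    PMon (A ⊕ᵒ B) (pτ A B A B ≫ nab ⊕ʰ nab') ((pR ⊥ᵒ).inv ≫ u ⊕ʰ u') :=
  @IsCommMon.tensor C _ BiSymMonoidal.par BiSymMonoidal.parSymm _ _ _ _ _ _ h h'

theorem TComon.flip (h : TComon A Δ e) : Δ ≫ Δ ⊗ʰ Δ ≫ tτ A A A A = Δ ≫ Δ ⊗ʰ Δ :=
  @IsComonMap.comul C _ BiSymMonoidal.ten _ _ _ _ _ _ _
    (@IsCocommComon.isComonMap_comul C _ BiSymMonoidal.ten BiSymMonoidal.tenSymm A Δ e h)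

theorem TComon.ee (h : TComon A Δ e) : Δ ≫ e ⊗ʰ e ≫ (tR ⊤ᵒ).inv = e :=
  @IsComonMap.counit C _ BiSymMonoidal.ten _ _ _ _ _ _ _
    (@IsCocommComon.isComonMap_comul C _ BiSymMonoidal.ten BiSymMonoidal.tenSymm A Δ e h)

theorem PMon.flip (h : PMon A nab u) : pτ A A A A ≫ nab ⊕ʰ nab ≫ nab = nab ⊕ʰ nab ≫ nab := by
  have := @IsMonMap.mul C _ BiSymMonoidal.par _ _ _ _ _ _ _
    (@IsCommMon.isMonMap_mul C _ BiSymMonoidal.par BiSymMonoidal.parSymm A nab u h)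
  rw [Category.assoc] at this
  exact this

theorem PMon.uu (h : PMon A nab u) : (pR ⊥ᵒ).inv ≫ u ⊕ʰ u ≫ nab = u := by
  have := @IsMonMap.unit C _ BiSymMonoidal.par _ _ _ _ _ _ _
    (@IsCommMon.isMonMap_mul C _ BiSymMonoidal.par BiSymMonoidal.parSymm A nab u h)
  rw [Category.assoc] at this
  exact this

end

end TwoStructures

section Medial

set_option linter.unusedSimpArgs false

open SLDC SMLDC

variable {C : Type u} [Category.{v} C] [SMLDC C]

/-- `(A, Δ, e, ∇, u)` is a bicommutative medial bimonoid. -/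
structure IsBicommMedialBimonoid (A : C) (Δ : A ⟶ A ⊗ᵒ A) (e : A ⟶ ⊤ᵒ) (nab : A ⊕ᵒ A ⟶ A)
    (u : ⊥ᵒ ⟶ A) : Prop where
  comon : TComon A Δ e
  mon : PMon A nab u
  nab_Δ : nab ≫ Δ = Δ ⊕ʰ Δ ≫ med A A A A ≫ nab ⊗ʰ nab
  u_e : u ≫ e = mix
  nab_e : nab ≫ e = e ⊕ʰ e ≫ nabTop
  u_Δ : u ≫ Δ = Δbot ≫ u ⊗ʰ u

theorem tComon_bot : TComon (⊥ᵒ : C) Δbot mix :=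
  TComon.intro Δbot_coassoc Δbot_mix_right Δbot_mix_left Δbot_cocomm

theorem pMon_top : PMon (⊤ᵒ : C) nabTop mix :=
  PMon.intro nabTop_assoc mix_nabTop_right mix_nabTop_left nabTop_comm

theorem med_nat' {A A' B B' D D' E E' Z : C} (f : A ⟶ A') (g : B ⟶ B') (h : D ⟶ D')
    (k : E ⟶ E') (l : (A' ⊕ᵒ D') ⊗ᵒ (B' ⊕ᵒ E') ⟶ Z) :
    (f ⊗ʰ g) ⊕ʰ (h ⊗ʰ k) ≫ med A' B' D' E' ≫ l = med A B D E ≫ (f ⊕ʰ h) ⊗ʰ (g ⊕ʰ k) ≫ l := by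
  rw [← Category.assoc, med_natural, Category.assoc]

theorem med_tα_inv (A B D A' B' D' : C) :
    med A (B ⊗ᵒ D) A' (B' ⊗ᵒ D') ≫ 𝟙 (A ⊕ᵒ A') ⊗ʰ med B D B' D' ≫
      (tα (A ⊕ᵒ A') (B ⊕ᵒ B') (D ⊕ᵒ D')).inv =
    (tα A B D).inv ⊕ʰ (tα A' B' D').inv ≫ med (A ⊗ᵒ B) D (A' ⊗ᵒ B') D' ≫
      med A B A' B' ⊗ʰ 𝟙 (D ⊕ᵒ D') := by
  have h := med_tα A B D A' B' D'
  rw [← Category.assoc, Iso.comp_inv_eq, Category.assoc, Category.assoc, h, pc']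
  simp [pid]

theorem med_pα_inv (A B D E F G : C) :
    (pα (A ⊗ᵒ B) (D ⊗ᵒ E) (F ⊗ᵒ G)).inv ≫ 𝟙 (A ⊗ᵒ B) ⊕ʰ med D E F G ≫ med A B (D ⊕ᵒ F) (E ⊕ᵒ G) =
    med A B D E ⊕ʰ 𝟙 (F ⊗ᵒ G) ≫ med (A ⊕ᵒ D) (B ⊕ᵒ E) F G ≫
      (pα A D F).inv ⊗ʰ (pα B E G).inv := by
  have h := med_pα A B D E F G
  rw [Iso.inv_comp_eq, reassoc_of% h, tc]
  simp

theorem med_tJ (B D E B' D' E' : C) :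
    med B (D ⊗ᵒ E) B' (D' ⊗ᵒ E') ≫ 𝟙 (B ⊕ᵒ B') ⊗ʰ med D E D' E' ≫
      tJ (B ⊕ᵒ B') (D ⊕ᵒ D') (E ⊕ᵒ E') =
    tJ B D E ⊕ʰ tJ B' D' E' ≫
      med D (B ⊗ᵒ E) D' (B' ⊗ᵒ E') ≫ 𝟙 (D ⊕ᵒ D') ⊗ʰ med B E B' E' := by
  rw [tJ, tJ, tJ, reassoc_of% med_tα_inv, ← pc, ← pc]
  simp only [Category.assoc]
  rw [← med_tα, med_nat', pid, tc', tc', med_tσ]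

theorem med_tτ (A B D E A' B' D' E' : C) :
    med (A ⊗ᵒ B) (D ⊗ᵒ E) (A' ⊗ᵒ B') (D' ⊗ᵒ E') ≫ med A B A' B' ⊗ʰ med D E D' E' ≫
      tτ (A ⊕ᵒ A') (B ⊕ᵒ B') (D ⊕ᵒ D') (E ⊕ᵒ E') =
    tτ A B D E ⊕ʰ tτ A' B' D' E' ≫ med (A ⊗ᵒ D) (B ⊗ᵒ E) (A' ⊗ᵒ D') (B' ⊗ᵒ E') ≫
      med A D A' D' ⊗ʰ med B E B' E' := by
  calc _ = (med (A ⊗ᵒ B) (D ⊗ᵒ E) (A' ⊗ᵒ B') (D' ⊗ᵒ E') ≫ med A B A' B' ⊗ʰ 𝟙 _) ≫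
        ((𝟙 _ ⊗ʰ 𝟙 _) ⊗ʰ med D E D' E' ≫ (tα _ _ _).hom) ≫ 𝟙 _ ⊗ʰ tJ _ _ _ ≫
          (tα _ _ _).inv := by
        rw [tτ_def, tid]; simp only [tc', Category.assoc, Category.id_comp, Category.comp_id]
    _ = (tα _ _ _).hom ⊕ʰ (tα _ _ _).hom ≫ med A (B ⊗ᵒ (D ⊗ᵒ E)) A' (B' ⊗ᵒ (D' ⊗ᵒ E')) ≫
          𝟙 _ ⊗ʰ (med B (D ⊗ᵒ E) B' (D' ⊗ᵒ E') ≫ 𝟙 (B ⊕ᵒ B') ⊗ʰ med D E D' E' ≫ tJ _ _ _) ≫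
          (tα _ _ _).inv := by
        rw [tα_nat]
        simp only [Category.assoc]
        rw [reassoc_of% (med_tα A B (D ⊗ᵒ E) A' B' (D' ⊗ᵒ E'))]
        simp only [tc', Category.assoc, Category.id_comp, Category.comp_id]
    _ = (tα _ _ _).hom ⊕ʰ (tα _ _ _).hom ≫ ((𝟙 A ⊗ʰ tJ _ _ _) ⊕ʰ (𝟙 A' ⊗ʰ tJ _ _ _) ≫
          med A (D ⊗ᵒ (B ⊗ᵒ E)) A' (D' ⊗ᵒ (B' ⊗ᵒ E'))) ≫
          𝟙 _ ⊗ʰ (med D (B ⊗ᵒ E) D' (B' ⊗ᵒ E') ≫ 𝟙 (D ⊕ᵒ D') ⊗ʰ med B E B' E') ≫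
          (tα _ _ _).inv := by
        rw [med_tJ, med_natural]
        simp only [tc', Category.assoc, Category.comp_id, pid]
    _ = _ := by
        have h := tα_inv_nat (𝟙 (A ⊕ᵒ A')) (𝟙 (D ⊕ᵒ D')) (med B E B' E')
        rw [← Category.id_comp (𝟙 (A ⊕ᵒ A')), ← tc]
        simp only [Category.assoc]
        rw [h, reassoc_of% (med_tα_inv A D (B ⊗ᵒ E) A' D' (B' ⊗ᵒ E')), tid]
        simp only [tc, pc', tτ_def, Category.assoc, Category.id_comp, Category.comp_id]

theorem med_pJ (A B D E F G : C) :
    pJ (A ⊗ᵒ B) (D ⊗ᵒ E) (F ⊗ᵒ G) ≫ 𝟙 (D ⊗ᵒ E) ⊕ʰ med A B F G ≫ med D E (A ⊕ᵒ F) (B ⊕ᵒ G) =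
    𝟙 (A ⊗ᵒ B) ⊕ʰ med D E F G ≫ med A B (D ⊕ᵒ F) (E ⊕ᵒ G) ≫ pJ A D F ⊗ʰ pJ B E G := by
  rw [pJ, pJ, pJ]
  simp only [Category.assoc]
  rw [med_pα_inv, ← tc, ← tc, ← reassoc_of% (med_pα A B D E F G), pc', ← med_pσ,
    ← tid, ← med_nat', tid, pc']

theorem med_pτ (A B D E F G H K : C) :
    pτ (A ⊗ᵒ B) (D ⊗ᵒ E) (F ⊗ᵒ G) (H ⊗ᵒ K) ≫ med A B F G ⊕ʰ med D E H K ≫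
      med (A ⊕ᵒ F) (B ⊕ᵒ G) (D ⊕ᵒ H) (E ⊕ᵒ K) =
    med A B D E ⊕ʰ med F G H K ≫ med (A ⊕ᵒ D) (B ⊕ᵒ E) (F ⊕ᵒ H) (G ⊕ᵒ K) ≫
      pτ A D F H ⊗ʰ pτ B E G K := by
  calc _ = (pα _ _ _).inv ≫ 𝟙 _ ⊕ʰ pJ _ _ _ ≫
        ((pα (A ⊗ᵒ B) (F ⊗ᵒ G) _).hom ≫ (𝟙 _ ⊕ʰ 𝟙 _) ⊕ʰ med D E H K) ≫ med A B F G ⊕ʰ 𝟙 _ ≫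
          med (A ⊕ᵒ F) (B ⊕ᵒ G) (D ⊕ᵒ H) (E ⊕ᵒ K) := by
        rw [pτ_def, pid]; simp only [pc', Category.assoc, Category.id_comp, Category.comp_id]
    _ = (pα _ _ _).inv ≫ 𝟙 _ ⊕ʰ (pJ _ _ _ ≫ 𝟙 _ ⊕ʰ med D E H K ≫
          med F G (D ⊕ᵒ H) (E ⊕ᵒ K)) ≫ med A B _ _ ≫ (pα _ _ _).hom ⊗ʰ (pα _ _ _).hom := by
        rw [← pα_nat]
        simp only [Category.assoc]
        rw [med_pα]
        simp only [pc', Category.assoc, Category.id_comp, Category.comp_id]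
    _ = (pα _ _ _).inv ≫ 𝟙 _ ⊕ʰ (𝟙 _ ⊕ʰ med F G H K ≫ med D E (F ⊕ᵒ H) (G ⊕ᵒ K)) ≫
          (med A B _ _ ≫ (𝟙 A ⊕ʰ pJ D F H) ⊗ʰ (𝟙 B ⊕ʰ pJ E G K)) ≫
            (pα _ _ _).hom ⊗ʰ (pα _ _ _).hom := by
        rw [med_pJ, ← med_natural]
        simp only [pc', Category.assoc, Category.comp_id, tid]
    _ = _ := by
        have h := pα_inv_nat (𝟙 (A ⊗ᵒ B)) (𝟙 (D ⊗ᵒ E)) (med F G H K)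
        rw [← Category.id_comp (𝟙 (A ⊗ᵒ B)), ← pc]
        simp only [Category.assoc]
        rw [← reassoc_of% h, reassoc_of% (med_pα_inv A B D E (F ⊕ᵒ H) (G ⊕ᵒ K)), pid]
        simp only [pc', tc, pτ_def, Category.assoc, Category.id_comp, Category.comp_id]

variable {A B : C} {dA : A ⟶ A ⊗ᵒ A} {eA : A ⟶ ⊤ᵒ} {nA : A ⊕ᵒ A ⟶ A} {uA : ⊥ᵒ ⟶ A}
  {dB : B ⟶ B ⊗ᵒ B} {eB : B ⟶ ⊤ᵒ} {nB : B ⊕ᵒ B ⟶ B} {uB : ⊥ᵒ ⟶ B}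

theorem TComon.par (hA : TComon A dA eA) (hB : TComon B dB eB) :
    TComon (A ⊕ᵒ B) (dA ⊕ʰ dB ≫ med A A B B) (eA ⊕ʰ eB ≫ nabTop) := by
  apply TComon.intro
  · calc _ = dA ⊕ʰ dB ≫ (med A A B B ≫ (𝟙 A ⊕ʰ 𝟙 B) ⊗ʰ (dA ⊕ʰ dB)) ≫ 𝟙 _ ⊗ʰ med A A B B := by
          simp only [tc, Category.assoc, Category.comp_id, pid]
      _ = (dA ≫ 𝟙 A ⊗ʰ dA) ⊕ʰ (dB ≫ 𝟙 B ⊗ʰ dB) ≫ med A (A ⊗ᵒ A) B (B ⊗ᵒ B) ≫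
          𝟙 _ ⊗ʰ med A A B B := by
          rw [← med_natural]; simp only [pc', Category.assoc]
      _ = (dA ≫ dA ⊗ʰ 𝟙 A) ⊕ʰ (dB ≫ dB ⊗ʰ 𝟙 B) ≫ med (A ⊗ᵒ A) A (B ⊗ᵒ B) B ≫
          med A A B B ⊗ʰ 𝟙 _ ≫ (tα _ _ _).hom := by
          rw [hA.co, hB.co, med_tα]; simp only [pc', Category.assoc]
      _ = dA ⊕ʰ dB ≫ med A A B B ≫ (dA ⊕ʰ dB) ⊗ʰ (𝟙 A ⊕ʰ 𝟙 B) ≫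
          med A A B B ⊗ʰ 𝟙 _ ≫ (tα _ _ _).hom := by
          rw [← med_nat', pc']
      _ = _ := by simp only [tc', Category.assoc, Category.comp_id, pid]
  · calc _ = dA ⊕ʰ dB ≫ (med A A B B ≫ (𝟙 A ⊕ʰ 𝟙 B) ⊗ʰ (eA ⊕ʰ eB)) ≫ 𝟙 _ ⊗ʰ nabTop := by
          simp only [tc, Category.assoc, Category.comp_id, pid]
      _ = (dA ≫ 𝟙 A ⊗ʰ eA) ⊕ʰ (dB ≫ 𝟙 B ⊗ʰ eB) ≫ med A ⊤ᵒ B ⊤ᵒ ≫ 𝟙 _ ⊗ʰ nabTop := by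
          rw [← med_natural]; simp only [pc', Category.assoc]
      _ = _ := by rw [hA.cr, hB.cr, med_tR]
  · calc _ = dA ⊕ʰ dB ≫ (med A A B B ≫ (eA ⊕ʰ eB) ⊗ʰ (𝟙 A ⊕ʰ 𝟙 B)) ≫ nabTop ⊗ʰ 𝟙 _ := by
          simp only [tc, Category.assoc, Category.comp_id, pid]
      _ = (dA ≫ eA ⊗ʰ 𝟙 A) ⊕ʰ (dB ≫ eB ⊗ʰ 𝟙 B) ≫ med ⊤ᵒ A ⊤ᵒ B ≫ nabTop ⊗ʰ 𝟙 _ := by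
          rw [← med_natural]; simp only [pc', Category.assoc]
      _ = _ := by rw [hA.cl, hB.cl, med_tL]
  · rw [Category.assoc, med_tσ, pc', hA.cc, hB.cc]

theorem PMon.ten (hA : PMon A nA uA) (hB : PMon B nB uB) :
    PMon (A ⊗ᵒ B) (med A B A B ≫ nA ⊗ʰ nB) (Δbot ≫ uA ⊗ʰ uB) := by
  apply PMon.intro
  · calc _ = 𝟙 _ ⊕ʰ med A B A B ≫ ((𝟙 A ⊗ʰ 𝟙 B) ⊕ʰ (nA ⊗ʰ nB) ≫ med A B A B) ≫ nA ⊗ʰ nB := by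
          simp only [pc', Category.assoc, Category.comp_id, tid]
      _ = 𝟙 _ ⊕ʰ med A B A B ≫ med A B (A ⊕ᵒ A) (B ⊕ᵒ B) ≫
          (𝟙 A ⊕ʰ nA ≫ nA) ⊗ʰ (𝟙 B ⊕ʰ nB ≫ nB) := by
          rw [med_natural]; simp only [tc, Category.assoc]
      _ = (pα _ _ _).hom ≫ med A B A B ⊕ʰ 𝟙 _ ≫ med (A ⊕ᵒ A) (B ⊕ᵒ B) A B ≫
          (nA ⊕ʰ 𝟙 A ≫ nA) ⊗ʰ (nB ⊕ʰ 𝟙 B ≫ nB) := by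
          rw [hA.as, hB.as, reassoc_of% med_pα]; simp only [tc, Category.assoc]
      _ = (pα _ _ _).hom ≫ med A B A B ⊕ʰ 𝟙 _ ≫ (nA ⊗ʰ nB) ⊕ʰ (𝟙 A ⊗ʰ 𝟙 B) ≫ med A B A B ≫
          nA ⊗ʰ nB := by
          rw [med_nat', tc]
      _ = _ := by simp only [pc', Category.assoc, Category.comp_id, tid]
  · calc _ = 𝟙 _ ⊕ʰ Δbot ≫ ((𝟙 A ⊗ʰ 𝟙 B) ⊕ʰ (uA ⊗ʰ uB) ≫ med A B A B) ≫ nA ⊗ʰ nB := by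
          simp only [pc', Category.assoc, Category.comp_id, tid]
      _ = 𝟙 _ ⊕ʰ Δbot ≫ med A B ⊥ᵒ ⊥ᵒ ≫ (𝟙 A ⊕ʰ uA ≫ nA) ⊗ʰ (𝟙 B ⊕ʰ uB ≫ nB) := by
          rw [med_natural]; simp only [tc, Category.assoc]
      _ = _ := by rw [hA.ur, hB.ur, med_pR]
  · calc _ = Δbot ⊕ʰ 𝟙 _ ≫ ((uA ⊗ʰ uB) ⊕ʰ (𝟙 A ⊗ʰ 𝟙 B) ≫ med A B A B) ≫ nA ⊗ʰ nB := by
          simp only [pc', Category.assoc, Category.comp_id, tid]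
      _ = Δbot ⊕ʰ 𝟙 _ ≫ med ⊥ᵒ ⊥ᵒ A B ≫ (uA ⊕ʰ 𝟙 A ≫ nA) ⊗ʰ (uB ⊕ʰ 𝟙 B ≫ nB) := by
          rw [med_natural]; simp only [tc, Category.assoc]
      _ = _ := by rw [hA.ul, hB.ul, med_pL]
  · rw [← reassoc_of% med_pσ, tc, hA.cm, hB.cm]

theorem med_nabTop : med ⊤ᵒ ⊤ᵒ ⊤ᵒ ⊤ᵒ ≫ nabTop ⊗ʰ nabTop ≫ (tR (⊤ᵒ : C)).inv =
    (tR ⊤ᵒ).inv ⊕ʰ (tR ⊤ᵒ).inv ≫ nabTop := by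
  have h := med_tR (⊤ᵒ : C) ⊤ᵒ
  have h1 := tR_nat (nabTop (C := C))
  have h2 : (tR (⊤ᵒ : C)).inv ⊕ʰ (tR ⊤ᵒ).inv ≫ (tR ⊤ᵒ).hom ⊕ʰ (tR ⊤ᵒ).hom = 𝟙 _ := by
    rw [pc, Iso.inv_hom_id, pid]
  calc _ = med ⊤ᵒ ⊤ᵒ ⊤ᵒ ⊤ᵒ ≫ 𝟙 _ ⊗ʰ nabTop ≫ nabTop ⊗ʰ 𝟙 _ ≫ (tR (⊤ᵒ : C)).inv := by
        simp only [tc', Category.id_comp, Category.comp_id]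
    _ = (tR ⊤ᵒ).inv ⊕ʰ (tR ⊤ᵒ).inv ≫ (tR ⊤ᵒ).hom ⊕ʰ (tR ⊤ᵒ).hom ≫
        med ⊤ᵒ ⊤ᵒ ⊤ᵒ ⊤ᵒ ≫ 𝟙 _ ⊗ʰ nabTop ≫ nabTop ⊗ʰ 𝟙 _ ≫ (tR (⊤ᵒ : C)).inv := by
        rw [reassoc_of% h2]
    _ = _ := by rw [reassoc_of% h, reassoc_of% h1, Iso.hom_inv_id, Category.comp_id]

theorem Δbot_med : (pR (⊥ᵒ : C)).inv ≫ Δbot ⊕ʰ Δbot ≫ med ⊥ᵒ ⊥ᵒ ⊥ᵒ ⊥ᵒ =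
    Δbot ≫ (pR ⊥ᵒ).inv ⊗ʰ (pR ⊥ᵒ).inv := by
  have h := med_pR (⊥ᵒ : C) ⊥ᵒ
  have h1 := pR_nat (Δbot (C := C))
  have h2 : (pR (⊥ᵒ : C)).hom ⊗ʰ (pR ⊥ᵒ).hom ≫ (pR ⊥ᵒ).inv ⊗ʰ (pR ⊥ᵒ).inv = 𝟙 _ := by
    rw [tc, Iso.hom_inv_id, tid]
  calc _ = (pR (⊥ᵒ : C)).inv ≫ Δbot ⊕ʰ 𝟙 _ ≫ (𝟙 _ ⊕ʰ Δbot ≫ med ⊥ᵒ ⊥ᵒ ⊥ᵒ ⊥ᵒ ≫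
        (pR (⊥ᵒ : C)).hom ⊗ʰ (pR ⊥ᵒ).hom) ≫ (pR ⊥ᵒ).inv ⊗ʰ (pR ⊥ᵒ).inv := by
        simp only [Category.assoc]
        rw [h2]; simp only [pc', Category.id_comp, Category.comp_id]
    _ = _ := by rw [h, reassoc_of% h1, Iso.inv_hom_id_assoc]

namespace IsBicommMedialBimonoid

theorem top : IsBicommMedialBimonoid (⊤ᵒ : C) (tR ⊤ᵒ).hom (𝟙 _) nabTop mix where
  comon := TComon.top
  mon := pMon_top
  nab_Δ := by
    have h := med_nabTop (C := C)
    rw [← Category.assoc, Iso.comp_inv_eq] at h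
    rw [h, ← Category.assoc, ← Category.assoc, pc, Iso.hom_inv_id, pid, Category.id_comp]
  u_e := by simp
  nab_e := by simp [pid]
  u_Δ := by
    rw [← tR_nat, ← Δbot_mix_right, Category.assoc, tc]
    simp

theorem bot : IsBicommMedialBimonoid (⊥ᵒ : C) Δbot mix (pR ⊥ᵒ).hom (𝟙 _) where
  comon := tComon_bot
  mon := PMon.bot
  nab_Δ := by
    have h := Δbot_med (C := C)
    rw [Iso.inv_comp_eq] at h
    rw [reassoc_of% h, tc, Iso.inv_hom_id, tid, Category.comp_id]
  u_e := by simp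
  nab_e := by
    rw [← pR_nat, ← mix_nabTop_right, pc']
    simp
  u_Δ := by simp [tid]

theorem ten (hA : IsBicommMedialBimonoid A dA eA nA uA)
    (hB : IsBicommMedialBimonoid B dB eB nB uB) :
    IsBicommMedialBimonoid (A ⊗ᵒ B) (dA ⊗ʰ dB ≫ tτ A A B B) (eA ⊗ʰ eB ≫ (tR ⊤ᵒ).inv)
      (med A B A B ≫ nA ⊗ʰ nB) (Δbot ≫ uA ⊗ʰ uB) where
  comon := hA.comon.ten hB.comon
  mon := hA.mon.ten hB.mon
  nab_Δ := by
    calc _ = med A B A B ≫ (dA ⊕ʰ dA) ⊗ʰ (dB ⊕ʰ dB) ≫ med A A A A ⊗ʰ med B B B B ≫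
          (nA ⊗ʰ nA) ⊗ʰ (nB ⊗ʰ nB) ≫ tτ A A B B := by
          rw [Category.assoc, tc', hA.nab_Δ, hB.nab_Δ]; simp only [tc', Category.assoc]
      _ = (dA ⊗ʰ dB) ⊕ʰ (dA ⊗ʰ dB) ≫ (med _ _ _ _ ≫ med A A A A ⊗ʰ med B B B B ≫
          tτ _ _ _ _) ≫ (nA ⊗ʰ nB) ⊗ʰ (nA ⊗ʰ nB) := by
          rw [tτ_nat, ← med_nat']; simp only [Category.assoc]
      _ = _ := by
          rw [med_tτ]; simp only [tc, pc', Category.assoc]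
  u_e := by
    rw [Category.assoc, tc', hA.u_e, hB.u_e]
    exact tComon_bot.ee
  nab_e := by
    rw [Category.assoc, tc', hA.nab_e, hB.nab_e, ← tc, Category.assoc, ← med_nat',
      med_nabTop, pc']
  u_Δ := by
    rw [Category.assoc, tc', hA.u_Δ, hB.u_Δ, ← tc, Category.assoc, tτ_nat,
      reassoc_of% tComon_bot.flip, tc]

theorem par (hA : IsBicommMedialBimonoid A dA eA nA uA)
    (hB : IsBicommMedialBimonoid B dB eB nB uB) :
    IsBicommMedialBimonoid (A ⊕ᵒ B) (dA ⊕ʰ dB ≫ med A A B B) (eA ⊕ʰ eB ≫ nabTop)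
      (pτ A B A B ≫ nA ⊕ʰ nB) ((pR ⊥ᵒ).inv ≫ uA ⊕ʰ uB) where
  comon := hA.comon.par hB.comon
  mon := hA.mon.par hB.mon
  nab_Δ := by
    calc _ = pτ A B A B ≫ (dA ⊕ʰ dA) ⊕ʰ (dB ⊕ʰ dB) ≫ med A A A A ⊕ʰ med B B B B ≫
          (nA ⊗ʰ nA) ⊕ʰ (nB ⊗ʰ nB) ≫ med A A B B := by
          rw [Category.assoc, pc', hA.nab_Δ, hB.nab_Δ]; simp only [pc', Category.assoc]
      _ = (dA ⊕ʰ dB) ⊕ʰ (dA ⊕ʰ dB) ≫ (pτ _ _ _ _ ≫ med A A A A ⊕ʰ med B B B B ≫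
          med _ _ _ _) ≫ (nA ⊕ʰ nB) ⊗ʰ (nA ⊕ʰ nB) := by
          rw [med_natural, ← reassoc_of% pτ_nat]; simp only [Category.assoc]
      _ = _ := by
          rw [med_pτ]; simp only [tc, pc', Category.assoc]
  u_e := by
    rw [Category.assoc, pc', hA.u_e, hB.u_e]
    exact pMon_top.uu
  nab_e := by
    rw [Category.assoc, pc', hA.nab_e, hB.nab_e, ← pc, Category.assoc, ← reassoc_of% pτ_nat,
      pMon_top.flip, pc']
  u_Δ := by
    rw [Category.assoc, pc', hA.u_Δ, hB.u_Δ, ← pc, Category.assoc, med_natural,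
      reassoc_of% Δbot_med, tc]

end IsBicommMedialBimonoid

end Medial

end LD
namespace LD

section MedialMaps

set_option linter.unusedSimpArgs false

open SLDC SMLDC

section

variable {C : Type u} [Category.{v} C] [BiSymMonoidal C]

variable {A B D E : C}
  {dA : A ⟶ A ⊗ᵒ A} {eA : A ⟶ ⊤ᵒ} {nA : A ⊕ᵒ A ⟶ A} {uA : ⊥ᵒ ⟶ A}
  {dB : B ⟶ B ⊗ᵒ B} {eB : B ⟶ ⊤ᵒ} {nB : B ⊕ᵒ B ⟶ B} {uB : ⊥ᵒ ⟶ B}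

theorem TComonMap.intro {f : A ⟶ B} (h₁ : f ≫ dB = dA ≫ f ⊗ʰ f) (h₂ : f ≫ eB = eA) :
    TComonMap dA eA dB eB f :=
  @IsComonMap.mk C _ BiSymMonoidal.ten _ _ _ _ _ _ _ h₁ h₂

theorem PMonMap.intro {f : A ⟶ B} (h₁ : nA ≫ f = f ⊕ʰ f ≫ nB) (h₂ : uA ≫ f = uB) :
    PMonMap nA uA nB uB f :=
  @IsMonMap.mk C _ BiSymMonoidal.par _ _ _ _ _ _ _ h₁ h₂

theorem TComonMap.d {f : A ⟶ B} (h : TComonMap dA eA dB eB f) : f ≫ dB = dA ≫ f ⊗ʰ f :=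
  @IsComonMap.comul C _ BiSymMonoidal.ten _ _ _ _ _ _ _ h

theorem TComonMap.e {f : A ⟶ B} (h : TComonMap dA eA dB eB f) : f ≫ eB = eA :=
  @IsComonMap.counit C _ BiSymMonoidal.ten _ _ _ _ _ _ _ h

theorem PMonMap.n {f : A ⟶ B} (h : PMonMap nA uA nB uB f) : nA ≫ f = f ⊕ʰ f ≫ nB :=
  @IsMonMap.mul C _ BiSymMonoidal.par _ _ _ _ _ _ _ h

theorem PMonMap.u {f : A ⟶ B} (h : PMonMap nA uA nB uB f) : uA ≫ f = uB :=
  @IsMonMap.unit C _ BiSymMonoidal.par _ _ _ _ _ _ _ h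

theorem tσσ (A B : C) : (tσ A B).hom ≫ (tσ B A).hom = 𝟙 _ :=
  @SymmetricCategory.symmetry C _ BiSymMonoidal.ten BiSymMonoidal.tenSymm A B

theorem pσσ (A B : C) : (pσ A B).hom ≫ (pσ B A).hom = 𝟙 _ :=
  @SymmetricCategory.symmetry C _ BiSymMonoidal.par BiSymMonoidal.parSymm A B

/-- The exchange of the last two factors of a triple par product. -/
def pK (A B D : C) : (A ⊕ᵒ B) ⊕ᵒ D ⟶ (A ⊕ᵒ D) ⊕ᵒ B :=
  (pσ (A ⊕ᵒ B) D).hom ≫ (pα D A B).hom ≫ (pσ D A).hom ⊕ʰ 𝟙 B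

theorem pτ_def' (A B D E : C) : pτ A B D E = (pα (A ⊕ᵒ B) D E).hom ≫ pK A B D ⊕ʰ 𝟙 E ≫
    (pα (A ⊕ᵒ D) B E).inv :=
  @tensorμ_eq' C _ BiSymMonoidal.par BiSymMonoidal.parSymm A B D E

theorem tJ_eq (A B D : C) : tJ A B D =
    𝟙 A ⊗ʰ (tσ B D).hom ≫ (tα A D B).inv ≫ (tσ (A ⊗ᵒ D) B).hom :=
  @exchange_eq C _ BiSymMonoidal.ten BiSymMonoidal.tenSymm A B D

end

variable {C : Type u} [Category.{v} C] [SMLDC C]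

theorem δL_tJ_med (B D E F G : C) :
    δL B (D ⊗ᵒ E) (F ⊗ᵒ G) ≫ tJ B D E ⊕ʰ 𝟙 (F ⊗ᵒ G) ≫ med D (B ⊗ᵒ E) F G =
    𝟙 B ⊗ʰ med D E F G ≫ tJ B (D ⊕ᵒ F) (E ⊕ᵒ G) ≫ 𝟙 (D ⊕ᵒ F) ⊗ʰ δL B E G := by
  have h0 : med D (B ⊗ᵒ E) F G = (tσ D (B ⊗ᵒ E)).hom ⊕ʰ (tσ F G).hom ≫ med (B ⊗ᵒ E) D G F ≫
      (tσ ((B ⊗ᵒ E) ⊕ᵒ G) (D ⊕ᵒ F)).hom := by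
    rw [med_tσ, pc', tσσ, tσσ, pid, Category.id_comp]
  calc _ = δL B (D ⊗ᵒ E) (F ⊗ᵒ G) ≫ (𝟙 B ⊗ʰ (tσ D E).hom) ⊕ʰ (tσ F G).hom ≫
        (tα B E D).inv ⊕ʰ 𝟙 _ ≫ med (B ⊗ᵒ E) D G F ≫ (tσ ((B ⊗ᵒ E) ⊕ᵒ G) (D ⊕ᵒ F)).hom := by
        rw [h0, tJ_eq]
        simp only [pc', Category.assoc, Category.id_comp, Category.comp_id, tσσ]
    _ = 𝟙 B ⊗ʰ ((tσ D E).hom ⊕ʰ (tσ F G).hom ≫ med E D G F) ≫ (tα _ _ _).inv ≫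
        δL B E G ⊗ʰ 𝟙 _ ≫ (tσ _ _).hom := by
        rw [← reassoc_of% (δL_natural (𝟙 B) (tσ D E).hom (tσ F G).hom),
          ← reassoc_of% (med_δL_tα E D G F B)]
        simp only [tc', Category.assoc, Category.comp_id]
    _ = _ := by
        rw [← med_tσ, tσ_nat, tJ_eq]
        simp only [tc', Category.assoc, Category.comp_id]

theorem δL_tτ_med (A B D E F G : C) :
    δL (A ⊗ᵒ B) (D ⊗ᵒ E) (F ⊗ᵒ G) ≫ tτ A B D E ⊕ʰ 𝟙 (F ⊗ᵒ G) ≫ med (A ⊗ᵒ D) (B ⊗ᵒ E) F G =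
    𝟙 (A ⊗ᵒ B) ⊗ʰ med D E F G ≫ tτ A B (D ⊕ᵒ F) (E ⊕ᵒ G) ≫ δL A D F ⊗ʰ δL B E G := by
  calc _ = (δL (A ⊗ᵒ B) (D ⊗ᵒ E) (F ⊗ᵒ G) ≫ (tα _ _ _).hom ⊕ʰ 𝟙 _) ≫
        (𝟙 A ⊗ʰ tJ B D E) ⊕ʰ 𝟙 _ ≫ (tα _ _ _).inv ⊕ʰ 𝟙 _ ≫ med (A ⊗ᵒ D) (B ⊗ᵒ E) F G := by
        rw [tτ_def]; simp only [pc', Category.assoc, Category.comp_id]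
    _ = (tα _ _ _).hom ≫ 𝟙 A ⊗ʰ δL B (D ⊗ᵒ E) (F ⊗ᵒ G) ≫ 𝟙 A ⊗ʰ (tJ B D E ⊕ʰ 𝟙 _) ≫
        δL A (D ⊗ᵒ (B ⊗ᵒ E)) (F ⊗ᵒ G) ≫ (tα _ _ _).inv ⊕ʰ 𝟙 _ ≫ med (A ⊗ᵒ D) (B ⊗ᵒ E) F G := by
        rw [δL_tα, reassoc_of% (δL_natural (𝟙 A) (tJ B D E) (𝟙 (F ⊗ᵒ G)))]
        simp only [Category.assoc]
    _ = (tα _ _ _).hom ≫ 𝟙 A ⊗ʰ (δL B (D ⊗ᵒ E) (F ⊗ᵒ G) ≫ tJ B D E ⊕ʰ 𝟙 _ ≫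
        med D (B ⊗ᵒ E) F G) ≫ (tα _ _ _).inv ≫ δL A D F ⊗ʰ 𝟙 _ := by
        rw [← med_δL_tα]; simp only [tc', Category.assoc, Category.comp_id]
    _ = ((tα _ _ _).hom ≫ 𝟙 A ⊗ʰ (𝟙 B ⊗ʰ med D E F G)) ≫ 𝟙 A ⊗ʰ tJ _ _ _ ≫
        (𝟙 A ⊗ʰ (𝟙 _ ⊗ʰ δL B E G) ≫ (tα _ _ _).inv) ≫ δL A D F ⊗ʰ 𝟙 _ := by
        rw [δL_tJ_med]; simp only [tc', Category.assoc, Category.comp_id]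
    _ = _ := by
        rw [tα_inv_nat, ← tα_nat, tτ_def]
        simp only [tc, Category.assoc, Category.comp_id, Category.id_comp, tid]

theorem med_pK_δL (A B D E F : C) :
    med A (B ⊕ᵒ D) E F ≫ 𝟙 (A ⊕ᵒ E) ⊗ʰ pK B D F ≫ δL (A ⊕ᵒ E) (B ⊕ᵒ F) D =
    δL A B D ⊕ʰ 𝟙 (E ⊗ᵒ F) ≫ pK (A ⊗ᵒ B) D (E ⊗ᵒ F) ≫ med A B E F ⊕ʰ 𝟙 D := by
  have h1 : 𝟙 (A ⊕ᵒ E) ⊗ʰ pK B D F = (pσ A E).hom ⊗ʰ (pσ (B ⊕ᵒ D) F).hom ≫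
      𝟙 _ ⊗ʰ (pα F B D).hom ≫ (pσ E A).hom ⊗ʰ ((pσ F B).hom ⊕ʰ 𝟙 D) := by
    rw [tc, tc, pK, Category.id_comp, pσσ]
  calc _ = (med A (B ⊕ᵒ D) E F ≫ (pσ A E).hom ⊗ʰ (pσ (B ⊕ᵒ D) F).hom) ≫
        𝟙 _ ⊗ʰ (pα F B D).hom ≫ δL _ _ _ ≫ ((pσ E A).hom ⊗ʰ (pσ F B).hom) ⊕ʰ 𝟙 D := by
        rw [h1, ← δL_natural]; simp only [Category.assoc]
    _ = (pσ _ _).hom ≫ 𝟙 _ ⊕ʰ δL A B D ≫ (pα (E ⊗ᵒ F) (A ⊗ᵒ B) D).hom ≫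
        (med E F A B ≫ (pσ E A).hom ⊗ʰ (pσ F B).hom) ⊕ʰ 𝟙 D := by
        rw [med_pσ, Category.assoc, ← reassoc_of% (med_δL_pα E F A B D), pc, Category.comp_id]
    _ = _ := by
        rw [← reassoc_of% (pσ_nat (δL A B D) (𝟙 (E ⊗ᵒ F))), med_pσ, pK]
        simp only [Category.assoc, pc, Category.comp_id]

theorem med_pτ_δL (A B D E F G : C) :
    med A (B ⊕ᵒ D) E (F ⊕ᵒ G) ≫ 𝟙 (A ⊕ᵒ E) ⊗ʰ pτ B D F G ≫ δL (A ⊕ᵒ E) (B ⊕ᵒ F) (D ⊕ᵒ G) =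
    δL A B D ⊕ʰ δL E F G ≫ pτ (A ⊗ᵒ B) D (E ⊗ᵒ F) G ≫ med A B E F ⊕ʰ 𝟙 (D ⊕ᵒ G) := by
  have h1 : 𝟙 (A ⊕ᵒ E) ⊗ʰ (pα (B ⊕ᵒ F) D G).inv ≫ δL (A ⊕ᵒ E) (B ⊕ᵒ F) (D ⊕ᵒ G) =
      δL (A ⊕ᵒ E) ((B ⊕ᵒ F) ⊕ᵒ D) G ≫ δL (A ⊕ᵒ E) (B ⊕ᵒ F) D ⊕ʰ 𝟙 G ≫ (pα _ _ _).inv := by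
    have h := δL_pα (A ⊕ᵒ E) (B ⊕ᵒ F) D G
    rw [← Iso.eq_comp_inv] at h
    rw [h]
    simp only [tc', Category.assoc, Category.comp_id, Iso.inv_hom_id, tid, Category.id_comp]
  calc _ = med A (B ⊕ᵒ D) E (F ⊕ᵒ G) ≫ 𝟙 _ ⊗ʰ (pα (B ⊕ᵒ D) F G).hom ≫
        (𝟙 (A ⊕ᵒ E) ⊗ʰ (pK B D F ⊕ʰ 𝟙 G) ≫ δL (A ⊕ᵒ E) ((B ⊕ᵒ F) ⊕ᵒ D) G) ≫
          δL (A ⊕ᵒ E) (B ⊕ᵒ F) D ⊕ʰ 𝟙 G ≫ (pα _ _ _).inv := by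
        rw [Category.assoc, ← h1, pτ_def']
        simp only [tc', Category.comp_id]
    _ = 𝟙 _ ⊕ʰ δL E F G ≫ (pα _ _ _).hom ≫
        (med A (B ⊕ᵒ D) E F ≫ 𝟙 (A ⊕ᵒ E) ⊗ʰ pK B D F ≫ δL (A ⊕ᵒ E) (B ⊕ᵒ F) D) ⊕ʰ 𝟙 G ≫
          (pα _ _ _).inv := by
        rw [δL_natural, Category.assoc, ← reassoc_of% (med_δL_pα A (B ⊕ᵒ D) E F G)]
        simp only [pc', Category.comp_id]
    _ = 𝟙 _ ⊕ʰ δL E F G ≫ ((pα _ _ _).hom ≫ (δL A B D ⊕ʰ 𝟙 (E ⊗ᵒ F)) ⊕ʰ 𝟙 G) ≫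
        pK (A ⊗ᵒ B) D (E ⊗ᵒ F) ⊕ʰ 𝟙 G ≫ ((med A B E F ⊕ʰ 𝟙 D) ⊕ʰ 𝟙 G ≫ (pα _ _ _).inv) := by
        rw [med_pK_δL]
        simp only [pc', Category.assoc, Category.comp_id]
    _ = _ := by
        rw [← pα_nat, pα_inv_nat, pτ_def', pid, pid]
        simp only [pc', Category.assoc, Category.comp_id, Category.id_comp]

variable {A B D : C}
  {dA : A ⟶ A ⊗ᵒ A} {eA : A ⟶ ⊤ᵒ} {nA : A ⊕ᵒ A ⟶ A} {uA : ⊥ᵒ ⟶ A}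
  {dB : B ⟶ B ⊗ᵒ B} {eB : B ⟶ ⊤ᵒ} {nB : B ⊕ᵒ B ⟶ B} {uB : ⊥ᵒ ⟶ B}
  {dD : D ⟶ D ⊗ᵒ D} {eD : D ⟶ ⊤ᵒ} {nD : D ⊕ᵒ D ⟶ D} {uD : ⊥ᵒ ⟶ D}

theorem tComonMap_pα :
    TComonMap (dA ⊕ʰ (dB ⊕ʰ dD ≫ med B B D D) ≫ med A A (B ⊕ᵒ D) (B ⊕ᵒ D))
      (eA ⊕ʰ (eB ⊕ʰ eD ≫ nabTop) ≫ nabTop)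
      ((dA ⊕ʰ dB ≫ med A A B B) ⊕ʰ dD ≫ med (A ⊕ᵒ B) (A ⊕ᵒ B) D D)
      ((eA ⊕ʰ eB ≫ nabTop) ⊕ʰ eD ≫ nabTop) (pα A B D).hom := by
  apply TComonMap.intro
  · calc _ = ((pα A B D).hom ≫ (dA ⊕ʰ dB) ⊕ʰ dD) ≫ med A A B B ⊕ʰ 𝟙 _ ≫
          med (A ⊕ᵒ B) (A ⊕ᵒ B) D D := by simp only [pc', Category.assoc, Category.comp_id]
      _ = _ := by
          rw [← pα_nat, Category.assoc, med_pα]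
          simp only [pc', Category.assoc, Category.comp_id]
  · calc _ = ((pα A B D).hom ≫ (eA ⊕ʰ eB) ⊕ʰ eD) ≫ nabTop ⊕ʰ 𝟙 _ ≫ nabTop := by
          simp only [pc', Category.assoc, Category.comp_id]
      _ = _ := by
          rw [← pα_nat, Category.assoc, ← nabTop_assoc]
          simp only [pc', Category.assoc, Category.comp_id]

theorem tComonMap_pL : TComonMap (Δbot ⊕ʰ dA ≫ med ⊥ᵒ ⊥ᵒ A A) (mix ⊕ʰ eA ≫ nabTop) dA eA
    (pL A).hom := by
  apply TComonMap.intro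
  · rw [← pL_nat, ← med_pL]; simp only [pc', Category.assoc, Category.comp_id, Category.id_comp]
  · rw [← pL_nat, ← mix_nabTop_left]; simp only [pc', Category.comp_id, Category.id_comp]

theorem tComonMap_pR : TComonMap (dA ⊕ʰ Δbot ≫ med A A ⊥ᵒ ⊥ᵒ) (eA ⊕ʰ mix ≫ nabTop) dA eA
    (pR A).hom := by
  apply TComonMap.intro
  · rw [← pR_nat, ← med_pR]; simp only [pc', Category.assoc, Category.comp_id, Category.id_comp]
  · rw [← pR_nat, ← mix_nabTop_right]; simp only [pc', Category.comp_id, Category.id_comp]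

theorem tComonMap_pσ : TComonMap (dA ⊕ʰ dB ≫ med A A B B) (eA ⊕ʰ eB ≫ nabTop)
    (dB ⊕ʰ dA ≫ med B B A A) (eB ⊕ʰ eA ≫ nabTop) (pσ A B).hom := by
  apply TComonMap.intro
  · rw [← reassoc_of% pσ_nat, Category.assoc, med_pσ]
  · rw [← reassoc_of% pσ_nat, nabTop_comm]

theorem pMonMap_tα :
    PMonMap (med (A ⊗ᵒ B) D (A ⊗ᵒ B) D ≫ (med A B A B ≫ nA ⊗ʰ nB) ⊗ʰ nD)
      (Δbot ≫ (Δbot ≫ uA ⊗ʰ uB) ⊗ʰ uD)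
      (med A (B ⊗ᵒ D) A (B ⊗ᵒ D) ≫ nA ⊗ʰ (med B D B D ≫ nB ⊗ʰ nD))
      (Δbot ≫ uA ⊗ʰ (Δbot ≫ uB ⊗ʰ uD)) (tα A B D).hom := by
  apply PMonMap.intro
  · calc _ = med (A ⊗ᵒ B) D (A ⊗ᵒ B) D ≫ med A B A B ⊗ʰ 𝟙 _ ≫
          ((nA ⊗ʰ nB) ⊗ʰ nD ≫ (tα A B D).hom) := by
          simp only [tc', Category.assoc, Category.id_comp]
      _ = _ := by
          rw [tα_nat, reassoc_of% med_tα]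
          simp only [tc, Category.assoc, Category.id_comp]
  · calc _ = Δbot ≫ Δbot ⊗ʰ 𝟙 _ ≫ ((uA ⊗ʰ uB) ⊗ʰ uD ≫ (tα A B D).hom) := by
          simp only [tc', Category.assoc, Category.id_comp]
      _ = _ := by
          rw [tα_nat, ← reassoc_of% (Δbot_coassoc (C := C))]
          simp only [tc, Category.assoc, Category.id_comp]

theorem pMonMap_tL : PMonMap nA uA (med ⊤ᵒ A ⊤ᵒ A ≫ nabTop ⊗ʰ nA) (Δbot ≫ mix ⊗ʰ uA)
    (tL A).hom := by
  apply PMonMap.intro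
  · rw [← tL_nat, ← med_tL]; simp only [tc, Category.assoc, Category.comp_id, Category.id_comp]
  · rw [← tL_nat, ← Δbot_mix_left, Category.assoc]
    simp only [tc, Category.comp_id, Category.id_comp]

theorem pMonMap_tR : PMonMap nA uA (med A ⊤ᵒ A ⊤ᵒ ≫ nA ⊗ʰ nabTop) (Δbot ≫ uA ⊗ʰ mix)
    (tR A).hom := by
  apply PMonMap.intro
  · rw [← tR_nat, ← med_tR]; simp only [tc, Category.assoc, Category.comp_id, Category.id_comp]
  · rw [← tR_nat, ← Δbot_mix_right, Category.assoc]
    simp only [tc, Category.comp_id, Category.id_comp]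

theorem pMonMap_tσ : PMonMap (med A B A B ≫ nA ⊗ʰ nB) (Δbot ≫ uA ⊗ʰ uB)
    (med B A B A ≫ nB ⊗ʰ nA) (Δbot ≫ uB ⊗ʰ uA) (tσ A B).hom := by
  apply PMonMap.intro
  · rw [Category.assoc, tσ_nat, reassoc_of% med_tσ]
  · rw [Category.assoc, tσ_nat, reassoc_of% (Δbot_cocomm (C := C))]

variable {A' B' : C}
  {dA' : A' ⟶ A' ⊗ᵒ A'} {eA' : A' ⟶ ⊤ᵒ} {nA' : A' ⊕ᵒ A' ⟶ A'} {uA' : ⊥ᵒ ⟶ A'}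
  {dB' : B' ⟶ B' ⊗ᵒ B'} {eB' : B' ⟶ ⊤ᵒ} {nB' : B' ⊕ᵒ B' ⟶ B'} {uB' : ⊥ᵒ ⟶ B'}

theorem TComonMap.par {f : A ⟶ A'} {g : B ⟶ B'} (hf : TComonMap dA eA dA' eA' f)
    (hg : TComonMap dB eB dB' eB' g) : TComonMap (dA ⊕ʰ dB ≫ med A A B B) (eA ⊕ʰ eB ≫ nabTop)
      (dA' ⊕ʰ dB' ≫ med A' A' B' B') (eA' ⊕ʰ eB' ≫ nabTop) (f ⊕ʰ g) := by
  apply TComonMap.intro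
  · rw [pc', hf.d, hg.d, ← pc, Category.assoc, med_natural, Category.assoc]
  · rw [pc', hf.e, hg.e]

theorem PMonMap.ten {f : A ⟶ A'} {g : B ⟶ B'} (hf : PMonMap nA uA nA' uA' f)
    (hg : PMonMap nB uB nB' uB' g) : PMonMap (med A B A B ≫ nA ⊗ʰ nB) (Δbot ≫ uA ⊗ʰ uB)
      (med A' B' A' B' ≫ nA' ⊗ʰ nB') (Δbot ≫ uA' ⊗ʰ uB') (f ⊗ʰ g) := by
  apply PMonMap.intro
  · rw [Category.assoc, tc, hf.n, hg.n, ← tc, med_nat']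
  · rw [Category.assoc, tc, hf.u, hg.u]

theorem tComonMap_δL :
    TComonMap (dA ⊗ʰ (dB ⊕ʰ dD ≫ med B B D D) ≫ tτ A A (B ⊕ᵒ D) (B ⊕ᵒ D))
      (eA ⊗ʰ (eB ⊕ʰ eD ≫ nabTop) ≫ (tR ⊤ᵒ).inv)
      ((dA ⊗ʰ dB ≫ tτ A A B B) ⊕ʰ dD ≫ med (A ⊗ᵒ B) (A ⊗ᵒ B) D D)
      ((eA ⊗ʰ eB ≫ (tR ⊤ᵒ).inv) ⊕ʰ eD ≫ nabTop) (δL A B D) := by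
  apply TComonMap.intro
  · calc _ = (δL A B D ≫ (dA ⊗ʰ dB) ⊕ʰ dD) ≫ tτ A A B B ⊕ʰ 𝟙 _ ≫
          med (A ⊗ᵒ B) (A ⊗ᵒ B) D D := by simp only [pc', Category.assoc, Category.comp_id]
      _ = _ := by
          rw [← δL_natural, Category.assoc, δL_tτ_med]
          simp only [tc', Category.assoc, Category.comp_id]
  · have h := tL_δL (⊤ᵒ : C) ⊤ᵒ
    rw [← Iso.eq_inv_comp, tL_tOne] at h
    calc _ = (δL A B D ≫ (eA ⊗ʰ eB) ⊕ʰ eD) ≫ (tR ⊤ᵒ).inv ⊕ʰ 𝟙 _ ≫ nabTop := by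
          simp only [pc', Category.assoc, Category.comp_id]
      _ = eA ⊗ʰ (eB ⊕ʰ eD) ≫ (tL _).inv ≫ nabTop := by
          rw [← δL_natural, Category.assoc, h, Category.assoc, pc', Iso.hom_inv_id,
            Category.comp_id, pid, Category.id_comp]
      _ = _ := by
          have h2 := tL_nat (nabTop (C := C))
          rw [← Iso.eq_inv_comp, ← Category.assoc, ← Iso.comp_inv_eq] at h2
          rw [← h2, tL_tOne]
          simp only [tc', Category.comp_id]

theorem pMonMap_δL :
    PMonMap (med A (B ⊕ᵒ D) A (B ⊕ᵒ D) ≫ nA ⊗ʰ (pτ B D B D ≫ nB ⊕ʰ nD))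
      (Δbot ≫ uA ⊗ʰ ((pR ⊥ᵒ).inv ≫ uB ⊕ʰ uD))
      (pτ (A ⊗ᵒ B) D (A ⊗ᵒ B) D ≫ (med A B A B ≫ nA ⊗ʰ nB) ⊕ʰ nD)
      ((pR ⊥ᵒ).inv ≫ (Δbot ≫ uA ⊗ʰ uB) ⊕ʰ uD) (δL A B D) := by
  apply PMonMap.intro
  · calc _ = med A (B ⊕ᵒ D) A (B ⊕ᵒ D) ≫ 𝟙 _ ⊗ʰ pτ B D B D ≫ (nA ⊗ʰ (nB ⊕ʰ nD) ≫ δL A B D) := by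
          simp only [tc', Category.assoc, Category.id_comp]
      _ = _ := by
          rw [δL_natural, reassoc_of% med_pτ_δL]
          simp only [pc, Category.assoc, Category.id_comp]
  · have h := δL_pR (⊥ᵒ : C) ⊥ᵒ
    rw [← Iso.eq_comp_inv] at h
    have h1 := pR_nat (Δbot (C := C))
    rw [← Iso.eq_comp_inv, Category.assoc, ← Iso.inv_comp_eq] at h1
    calc _ = Δbot ≫ 𝟙 _ ⊗ʰ (pR ⊥ᵒ).inv ≫ (uA ⊗ʰ (uB ⊕ʰ uD) ≫ δL A B D) := by
          simp only [tc', Category.assoc, Category.id_comp]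
      _ = Δbot ≫ (pR _).inv ≫ (uA ⊗ʰ uB) ⊕ʰ uD := by
          rw [δL_natural, h]
          simp only [tc', Category.assoc, Category.comp_id, Iso.inv_hom_id, tid, Category.id_comp]
      _ = _ := by
          rw [← reassoc_of% h1]
          simp only [pc, Category.id_comp]

end MedialMaps

end LD
namespace LD

section Cartesian

open MonoidalCategory

/-- The monoidal structure is cartesian: the unit is terminal, and `A ⊗ B` together with the
projections `A ⊗ B ⟶ A ⊗ 𝟙 ≅ A` and `A ⊗ B ⟶ 𝟙 ⊗ B ≅ B` is a product of `A` and `B`. -/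
structure IsCartesianMon (C : Type u) [Category.{v} C] [MonoidalCategory C] : Prop where
  terminal : Nonempty (IsTerminal (𝟙_ C))
  product : ∀ {A B : C} (a : A ⟶ 𝟙_ C) (b : B ⟶ 𝟙_ C),
    Nonempty (IsLimit (BinaryFan.mk ((𝟙 A ⊗ₘ b) ≫ (ρ_ A).hom) ((a ⊗ₘ 𝟙 B) ≫ (λ_ B).hom)))

/-- The monoidal structure is cocartesian: the unit is initial, and `A ⊗ B` together with the
injections `A ≅ A ⊗ 𝟙 ⟶ A ⊗ B` and `B ≅ 𝟙 ⊗ B ⟶ A ⊗ B` is a coproduct of `A` and `B`. -/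
structure IsCocartesianMon (C : Type u) [Category.{v} C] [MonoidalCategory C] : Prop where
  initial : Nonempty (IsInitial (𝟙_ C))
  coproduct : ∀ {A B : C} (a : 𝟙_ C ⟶ A) (b : 𝟙_ C ⟶ B),
    Nonempty (IsColimit (BinaryCofan.mk ((ρ_ A).inv ≫ (𝟙 A ⊗ₘ b)) ((λ_ B).inv ≫ (a ⊗ₘ 𝟙 B))))

end Cartesian

/-- A cartesian linearly distributive category: a symmetric linearly distributive category whose
tensor structure is cartesian and whose par structure is cocartesian. -/
class CLDC (C : Type u) [Category.{v} C] extends SLDC C where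
  cartesian : @IsCartesianMon C _ ten
  cocartesian : @IsCocartesianMon C _ par

/-- A symmetric medial linearly distributive category is cartesian if its tensor structure is
cartesian and its par structure is cocartesian, that is, if the underlying symmetric linearly
distributive category is a cartesian linearly distributive category. -/
def IsCartesian (C : Type u) [Category.{v} C] [SMLDC C] : Prop :=
  @IsCartesianMon C _ BiSymMonoidal.ten ∧ @IsCocartesianMon C _ BiSymMonoidal.par

section Bimonoids

open SLDC SMLDC

/-- A bicommutative medial bimonoid. -/
structure Bim (C : Type u) [Category.{v} C] [SMLDC C] where
  X : C
  Δ : X ⟶ X ⊗ᵒ X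
  e : X ⟶ ⊤ᵒ
  nab : X ⊕ᵒ X ⟶ X
  u : ⊥ᵒ ⟶ X
  isBim : IsBicommMedialBimonoid X Δ e nab u

variable {C : Type u} [Category.{v} C] [SMLDC C]

namespace Bim

/-- A bimonoid morphism: a morphism of `⊗`-comonoids which is a morphism of `⊕`-monoids. -/
@[ext]
structure Hom (A B : Bim C) where
  f : A.X ⟶ B.X
  comon : TComonMap A.Δ A.e B.Δ B.e f
  mon : PMonMap A.nab A.u B.nab B.u f

instance : Category (Bim C) where
  Hom := Hom
  id A := ⟨𝟙 A.X, @IsComonMap.id C _ BiSymMonoidal.ten BiSymMonoidal.tenSymm _ _ _,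
    @IsMonMap.id C _ BiSymMonoidal.par BiSymMonoidal.parSymm _ _ _⟩
  comp f g := ⟨f.f ≫ g.f,
    @IsComonMap.comp C _ BiSymMonoidal.ten BiSymMonoidal.tenSymm _ _ _ _ _ _ _ _ _ _ _
      f.comon g.comon,
    @IsMonMap.comp C _ BiSymMonoidal.par BiSymMonoidal.parSymm _ _ _ _ _ _ _ _ _ _ _
      f.mon g.mon⟩
  id_comp _ := Hom.ext (Category.id_comp _)
  comp_id _ := Hom.ext (Category.comp_id _)
  assoc _ _ _ := Hom.ext (Category.assoc _ _ _)

theorem hom_ext {A B : Bim C} {f g : A ⟶ B} (h : f.f = g.f) : f = g := Hom.ext h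

/-- An isomorphism of objects underlying a bimonoid morphism is an isomorphism of bimonoids. -/
def isoMk {A B : Bim C} (i : A.X ≅ B.X) (h₁ : TComonMap A.Δ A.e B.Δ B.e i.hom)
    (h₂ : PMonMap A.nab A.u B.nab B.u i.hom) : A ≅ B where
  hom := ⟨i.hom, h₁, h₂⟩
  inv := ⟨i.inv, @IsComonMap.inv C _ BiSymMonoidal.ten BiSymMonoidal.tenSymm _ _ _ _ _ _ i h₁,
    @IsMonMap.inv C _ BiSymMonoidal.par BiSymMonoidal.parSymm _ _ _ _ _ _ i h₂⟩
  hom_inv_id := hom_ext i.hom_inv_id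
  inv_hom_id := hom_ext i.inv_hom_id

/-- The tensor product of bimonoids. -/
def tenObj (A B : Bim C) : Bim C where
  X := A.X ⊗ᵒ B.X
  Δ := A.Δ ⊗ʰ B.Δ ≫ tτ A.X A.X B.X B.X
  e := A.e ⊗ʰ B.e ≫ (tR ⊤ᵒ).inv
  nab := med A.X B.X A.X B.X ≫ A.nab ⊗ʰ B.nab
  u := Δbot ≫ A.u ⊗ʰ B.u
  isBim := A.isBim.ten B.isBim

/-- The par product of bimonoids. -/
def parObj (A B : Bim C) : Bim C where
  X := A.X ⊕ᵒ B.X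
  Δ := A.Δ ⊕ʰ B.Δ ≫ med A.X A.X B.X B.X
  e := A.e ⊕ʰ B.e ≫ nabTop
  nab := pτ A.X B.X A.X B.X ≫ A.nab ⊕ʰ B.nab
  u := (pR ⊥ᵒ).inv ≫ A.u ⊕ʰ B.u
  isBim := A.isBim.par B.isBim

variable (C) in
/-- The tensor unit as a bimonoid. -/
def topObj : Bim C where
  X := ⊤ᵒ
  Δ := (tR ⊤ᵒ).hom
  e := 𝟙 _
  nab := nabTop
  u := mix
  isBim := .top

variable (C) in
/-- The par unit as a bimonoid. -/
def botObj : Bim C where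
  X := ⊥ᵒ
  Δ := Δbot
  e := mix
  nab := (pR ⊥ᵒ).hom
  u := 𝟙 _
  isBim := .bot

/-- The tensor product of bimonoid morphisms. -/
def tenHom {A A' B B' : Bim C} (f : A ⟶ A') (g : B ⟶ B') : tenObj A B ⟶ tenObj A' B' where
  f := f.f ⊗ʰ g.f
  comon := @IsComonMap.tensor C _ BiSymMonoidal.ten BiSymMonoidal.tenSymm _ _ _ _ _ _ _ _ _ _ _ _
    _ _ f.comon g.comon
  mon := PMonMap.ten f.mon g.mon

/-- The par product of bimonoid morphisms. -/
def parHom {A A' B B' : Bim C} (f : A ⟶ A') (g : B ⟶ B') : parObj A B ⟶ parObj A' B' where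
  f := f.f ⊕ʰ g.f
  comon := TComonMap.par f.comon g.comon
  mon := @IsMonMap.tensor C _ BiSymMonoidal.par BiSymMonoidal.parSymm _ _ _ _ _ _ _ _ _ _ _ _
    _ _ f.mon g.mon

variable (A B D : Bim C)

/-- The tensor associator of bimonoids. -/
def tαIso : tenObj (tenObj A B) D ≅ tenObj A (tenObj B D) :=
  isoMk (tα A.X B.X D.X)
    (@isComonMap_associator C _ BiSymMonoidal.ten BiSymMonoidal.tenSymm _ _ _ _ _ _ _ _ _)
    pMonMap_tα

/-- The left tensor unitor of bimonoids. -/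
def tLIso : A ≅ tenObj (topObj C) A :=
  isoMk (tL A.X)
    (@IsComonMap.inv C _ BiSymMonoidal.ten BiSymMonoidal.tenSymm _ _ _ _ _ _ (tL A.X).symm
      (@isComonMap_leftUnitor C _ BiSymMonoidal.ten BiSymMonoidal.tenSymm _ _ _))
    pMonMap_tL

/-- The right tensor unitor of bimonoids. -/
def tRIso : A ≅ tenObj A (topObj C) :=
  isoMk (tR A.X)
    (@IsComonMap.inv C _ BiSymMonoidal.ten BiSymMonoidal.tenSymm _ _ _ _ _ _ (tR A.X).symm
      (@isComonMap_rightUnitor C _ BiSymMonoidal.ten BiSymMonoidal.tenSymm _ _ _))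
    pMonMap_tR

/-- The tensor braiding of bimonoids. -/
def tσIso : tenObj A B ≅ tenObj B A :=
  isoMk (tσ A.X B.X)
    (@isComonMap_braiding C _ BiSymMonoidal.ten BiSymMonoidal.tenSymm _ _ _ _ _ _) pMonMap_tσ

/-- The par associator of bimonoids. -/
def pαIso : parObj A (parObj B D) ≅ parObj (parObj A B) D :=
  isoMk (pα A.X B.X D.X) tComonMap_pα
    (@IsMonMap.inv C _ BiSymMonoidal.par BiSymMonoidal.parSymm _ _ _ _ _ _ (pα A.X B.X D.X).symm
      (@isMonMap_associator C _ BiSymMonoidal.par BiSymMonoidal.parSymm _ _ _ _ _ _ _ _ _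
        A.isBim.mon B.isBim.mon D.isBim.mon))

/-- The left par unitor of bimonoids. -/
def pLIso : parObj (botObj C) A ≅ A :=
  isoMk (pL A.X) tComonMap_pL
    (@isMonMap_leftUnitor C _ BiSymMonoidal.par BiSymMonoidal.parSymm _ _ _ A.isBim.mon)

/-- The right par unitor of bimonoids. -/
def pRIso : parObj A (botObj C) ≅ A :=
  isoMk (pR A.X) tComonMap_pR
    (@isMonMap_rightUnitor C _ BiSymMonoidal.par BiSymMonoidal.parSymm _ _ _ A.isBim.mon)

/-- The par braiding of bimonoids. -/
def pσIso : parObj A B ≅ parObj B A :=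
  isoMk (pσ A.X B.X) tComonMap_pσ
    (@isMonMap_braiding C _ BiSymMonoidal.par BiSymMonoidal.parSymm _ _ _ _ _ _
      A.isBim.mon B.isBim.mon)

/-- The left linear distributivity of bimonoids. -/
def δLHom : tenObj A (parObj B D) ⟶ parObj (tenObj A B) D where
  f := δL A.X B.X D.X
  comon := tComonMap_δL
  mon := pMonMap_δL

/-- The right linear distributivity of bimonoids. -/
def δRHom : tenObj (parObj A B) D ⟶ parObj A (tenObj B D) where
  f := δR A.X B.X D.X
  comon := by
    rw [δ_σ]
    exact ((tσIso (parObj A B) D).hom ≫ tenHom (𝟙 D) (pσIso A B).hom ≫ δLHom D B A ≫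
      parHom (tσIso D B).hom (𝟙 A) ≫ (pσIso (tenObj B D) A).hom).comon
  mon := by
    rw [δ_σ]
    exact ((tσIso (parObj A B) D).hom ≫ tenHom (𝟙 D) (pσIso A B).hom ≫ δLHom D B A ≫
      parHom (tσIso D B).hom (𝟙 A) ≫ (pσIso (tenObj B D) A).hom).mon

/-- The operations of the tensor structure on bimonoids. -/
abbrev tenStruct : MonoidalCategoryStruct (Bim C) where
  tensorObj := tenObj
  tensorHom := tenHom
  whiskerLeft A _ _ f := tenHom (𝟙 A) f
  whiskerRight f A := tenHom f (𝟙 A)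
  tensorUnit := topObj C
  associator := tαIso
  leftUnitor A := (tLIso A).symm
  rightUnitor A := (tRIso A).symm

/-- The operations of the par structure on bimonoids. -/
abbrev parStruct : MonoidalCategoryStruct (Bim C) where
  tensorObj := parObj
  tensorHom := parHom
  whiskerLeft A _ _ f := parHom (𝟙 A) f
  whiskerRight f A := parHom f (𝟙 A)
  tensorUnit := botObj C
  associator A B D := (pαIso A B D).symm
  leftUnitor := pLIso
  rightUnitor := pRIso

/-- The tensor structure on bimonoids. -/
abbrev tenMonoidal : MonoidalCategory (Bim C) :=
  letI : MonoidalCategoryStruct (Bim C) := tenStruct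
  MonoidalCategory.ofTensorHom
    (fun A B => hom_ext (tid A.X B.X)) (fun _ _ _ _ => rfl) (fun _ _ => rfl)
    (fun f₁ f₂ g₁ g₂ => hom_ext (tc f₁.f g₁.f f₂.f g₂.f))
    (fun f g h => hom_ext (tα_nat f.f g.f h.f))
    (fun f => hom_ext (by
      have h := tL_nat f.f
      rw [← Iso.eq_inv_comp, ← Category.assoc, ← Iso.comp_inv_eq] at h
      exact h))
    (fun f => hom_ext (by
      have h := tR_nat f.f
      rw [← Iso.eq_inv_comp, ← Category.assoc, ← Iso.comp_inv_eq] at h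
      exact h))
    (fun A B D E => hom_ext
      (@pentagon_h C _ BiSymMonoidal.ten BiSymMonoidal.tenSymm A.X B.X D.X E.X))
    (fun A B => hom_ext (@triangle_h C _ BiSymMonoidal.ten BiSymMonoidal.tenSymm A.X B.X))

/-- The par structure on bimonoids. -/
abbrev parMonoidal : MonoidalCategory (Bim C) :=
  letI : MonoidalCategoryStruct (Bim C) := parStruct
  MonoidalCategory.ofTensorHom
    (fun A B => hom_ext (pid A.X B.X)) (fun _ _ _ _ => rfl) (fun _ _ => rfl)
    (fun f₁ f₂ g₁ g₂ => hom_ext (pc f₁.f g₁.f f₂.f g₂.f))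
    (fun f g h => hom_ext (pα_inv_nat f.f g.f h.f))
    (fun f => hom_ext (pL_nat f.f))
    (fun f => hom_ext (pR_nat f.f))
    (fun A B D E => hom_ext
      (@pentagon_h C _ BiSymMonoidal.par BiSymMonoidal.parSymm A.X B.X D.X E.X))
    (fun A B => hom_ext (@triangle_h C _ BiSymMonoidal.par BiSymMonoidal.parSymm A.X B.X))

instance : BiSymMonoidal (Bim C) where
  ten := tenMonoidal
  tenSymm := @SymmetricCategory.mk (Bim C) _ tenMonoidal
    (@BraidedCategory.mk (Bim C) _ tenMonoidal tσIso
      (fun A _ _ f => hom_ext (tσ_nat (𝟙 A.X) f.f))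
      (fun f A => hom_ext (tσ_nat f.f (𝟙 A.X)))
      (fun A B D => hom_ext
        (@hexagon_forward_h C _ BiSymMonoidal.ten BiSymMonoidal.tenSymm A.X B.X D.X))
      (fun A B D => hom_ext
        (@hexagon_reverse_h C _ BiSymMonoidal.ten BiSymMonoidal.tenSymm A.X B.X D.X)))
    (fun A B => hom_ext (tσσ A.X B.X))
  par := parMonoidal
  parSymm := @SymmetricCategory.mk (Bim C) _ parMonoidal
    (@BraidedCategory.mk (Bim C) _ parMonoidal pσIso
      (fun A _ _ f => hom_ext (pσ_nat (𝟙 A.X) f.f))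
      (fun f A => hom_ext (pσ_nat f.f (𝟙 A.X)))
      (fun A B D => hom_ext
        (@hexagon_forward_h C _ BiSymMonoidal.par BiSymMonoidal.parSymm A.X B.X D.X))
      (fun A B D => hom_ext
        (@hexagon_reverse_h C _ BiSymMonoidal.par BiSymMonoidal.parSymm A.X B.X D.X)))
    (fun A B => hom_ext (pσσ A.X B.X))

instance : SLDC (Bim C) where
  δL := δLHom
  δR := δRHom
  δL_natural f g h := hom_ext (δL_natural f.f g.f h.f)
  δR_natural f g h := hom_ext (δR_natural f.f g.f h.f)
  tL_δL A B := hom_ext (tL_δL A.X B.X)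
  tR_δR A B := hom_ext (tR_δR A.X B.X)
  δR_pL A B := hom_ext (δR_pL A.X B.X)
  δL_pR A B := hom_ext (δL_pR A.X B.X)
  δL_tα A B D E := hom_ext (δL_tα A.X B.X D.X E.X)
  δR_tα A B D E := hom_ext (δR_tα A.X B.X D.X E.X)
  δL_pα A B D E := hom_ext (δL_pα A.X B.X D.X E.X)
  δR_pα A B D E := hom_ext (δR_pα A.X B.X D.X E.X)
  δL_δR A B D E := hom_ext (δL_δR A.X B.X D.X E.X)
  δR_δL A B D E := hom_ext (δR_δL A.X B.X D.X E.X)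
  δ_σ A B D := hom_ext (δ_σ A.X B.X D.X)

/-- The counit is a bimonoid morphism. -/
def del (A : Bim C) : A ⟶ topObj C where
  f := A.e
  comon := TComonMap.intro (by
    have h := A.isBim.comon.ee
    rw [← Category.assoc, Iso.comp_inv_eq] at h
    exact h.symm) (Category.comp_id _)
  mon := PMonMap.intro A.isBim.nab_e A.isBim.u_e

/-- The unit is a bimonoid morphism. -/
def gen (A : Bim C) : botObj C ⟶ A where
  f := A.u
  comon := TComonMap.intro A.isBim.u_Δ A.isBim.u_e
  mon := PMonMap.intro (by
    have h := A.isBim.mon.uu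
    rw [Iso.inv_comp_eq] at h
    exact h.symm) (Category.id_comp _)

/-- The comultiplication is a bimonoid morphism. -/
def copy (A : Bim C) : A ⟶ tenObj A A where
  f := A.Δ
  comon := @IsCocommComon.isComonMap_comul C _ BiSymMonoidal.ten BiSymMonoidal.tenSymm _ _ _
    A.isBim.comon
  mon := PMonMap.intro A.isBim.nab_Δ A.isBim.u_Δ

/-- The multiplication is a bimonoid morphism. -/
def cocopy (A : Bim C) : parObj A A ⟶ A where
  f := A.nab
  comon := TComonMap.intro (A.isBim.nab_Δ.trans (Category.assoc _ _ _).symm)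
    A.isBim.nab_e
  mon := @IsCommMon.isMonMap_mul C _ BiSymMonoidal.par BiSymMonoidal.parSymm _ _ _
    A.isBim.mon

theorem eq_del {A : Bim C} (f : A ⟶ topObj C) : f = del A :=
  hom_ext ((Category.comp_id f.f).symm.trans (TComonMap.e f.comon))

theorem eq_gen {A : Bim C} (f : botObj C ⟶ A) : f = gen A :=
  hom_ext ((Category.id_comp f.f).symm.trans (PMonMap.u f.mon))

theorem cartesian : @IsCartesianMon (Bim C) _ tenMonoidal :=
  @IsCartesianMon.mk (Bim C) _ tenMonoidal
    ⟨IsTerminal.ofUniqueHom del fun _ f => eq_del f⟩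
    (fun {A B} a b => ⟨by
      obtain rfl := eq_del a
      obtain rfl := eq_del b
      refine BinaryFan.isLimitMk (fun s => copy s.pt ≫ tenHom s.fst s.snd) ?_ ?_ ?_
      · exact fun s => hom_ext (@lift_fst C _ BiSymMonoidal.ten BiSymMonoidal.tenSymm _ _ _ _ _ _
          s.pt.isBim.comon _ _ (TComonMap.e s.snd.comon))
      · exact fun s => hom_ext (@lift_snd C _ BiSymMonoidal.ten BiSymMonoidal.tenSymm _ _ _ _ _ _
          s.pt.isBim.comon _ _ (TComonMap.e s.fst.comon))
      · intro s m h₁ h₂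
        rw [← h₁, ← h₂]
        exact hom_ext (@lift_eta C _ BiSymMonoidal.ten BiSymMonoidal.tenSymm _ _ _ _ _ _ _ _ _
          A.isBim.comon B.isBim.comon m.f m.comon)⟩)

theorem cocartesian : @IsCocartesianMon (Bim C) _ parMonoidal :=
  @IsCocartesianMon.mk (Bim C) _ parMonoidal
    ⟨IsInitial.ofUniqueHom gen fun _ f => eq_gen f⟩
    (fun {A B} a b => ⟨by
      obtain rfl := eq_gen a
      obtain rfl := eq_gen b
      refine BinaryCofan.isColimitMk (fun s => parHom s.inl s.inr ≫ cocopy s.pt) ?_ ?_ ?_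
      · exact fun s => hom_ext (@inl_desc C _ BiSymMonoidal.par BiSymMonoidal.parSymm _ _ _ _ _ _
          s.pt.isBim.mon _ _ (PMonMap.u s.inr.mon))
      · exact fun s => hom_ext (@inr_desc C _ BiSymMonoidal.par BiSymMonoidal.parSymm _ _ _ _ _ _
          s.pt.isBim.mon _ _ (PMonMap.u s.inl.mon))
      · intro s m h₁ h₂
        rw [← h₁, ← h₂]
        exact hom_ext (@desc_eta C _ BiSymMonoidal.par BiSymMonoidal.parSymm _ _ _ _ _ _ _ _ _
          A.isBim.mon B.isBim.mon m.f m.mon)⟩)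

/-- The cartesian linearly distributive category of bicommutative medial bimonoids. -/
instance : CLDC (Bim C) where
  cartesian := cartesian
  cocartesian := cocartesian

end Bim

end Bimonoids

end LD
namespace LD

noncomputable section CartesianGeneric

open MonoidalCategory

set_option linter.unusedSectionVars false

variable {C : Type u} [Category.{v} C] [MonoidalCategory C] [SymmetricCategory C]

namespace IsCartesianMon

variable (h : IsCartesianMon C) {A A' B B' D Z : C}

theorem hom_ext_one {C : Type u} [Category.{v} C] [MonoidalCategory C] (h : IsCartesianMon C)
    {A : C} (f g : A ⟶ 𝟙_ C) : f = g := h.terminal.some.hom_ext f g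

/-- The morphism to the terminal object. -/
def t (A : C) : A ⟶ 𝟙_ C := h.terminal.some.from A

/-- The first projection. -/
def fst (A B : C) : A ⊗ B ⟶ A := (𝟙 A ⊗ₘ h.t B) ≫ (ρ_ A).hom

/-- The second projection. -/
def snd (A B : C) : A ⊗ B ⟶ B := (h.t A ⊗ₘ 𝟙 B) ≫ (λ_ B).hom

/-- The pairing of two morphisms. -/
def pair (f : Z ⟶ A) (g : Z ⟶ B) : Z ⟶ A ⊗ B :=
  (h.product (h.t A) (h.t B)).some.lift (BinaryFan.mk f g)

theorem pair_fst (f : Z ⟶ A) (g : Z ⟶ B) : h.pair f g ≫ h.fst A B = f :=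
  (h.product (h.t A) (h.t B)).some.fac (BinaryFan.mk f g) ⟨.left⟩

theorem pair_snd (f : Z ⟶ A) (g : Z ⟶ B) : h.pair f g ≫ h.snd A B = g :=
  (h.product (h.t A) (h.t B)).some.fac (BinaryFan.mk f g) ⟨.right⟩

theorem ext {f g : Z ⟶ A ⊗ B} (h₁ : f ≫ h.fst A B = g ≫ h.fst A B)
    (h₂ : f ≫ h.snd A B = g ≫ h.snd A B) : f = g :=
  BinaryFan.IsLimit.hom_ext (h.product (h.t A) (h.t B)).some h₁ h₂

theorem map_fst (f : A ⟶ A') (g : B ⟶ B') : (f ⊗ₘ g) ≫ h.fst A' B' = h.fst A B ≫ f := by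
  rw [fst, tensorHom_comp_tensorHom_assoc, h.hom_ext_one (g ≫ h.t B') (h.t B), Category.comp_id,
    fst, Category.assoc, ← rightUnitor_naturality, ← tensorHom_id, tensorHom_comp_tensorHom_assoc,
    Category.id_comp, Category.comp_id]

theorem map_snd (f : A ⟶ A') (g : B ⟶ B') : (f ⊗ₘ g) ≫ h.snd A' B' = h.snd A B ≫ g := by
  rw [snd, tensorHom_comp_tensorHom_assoc, h.hom_ext_one (f ≫ h.t A') (h.t A), Category.comp_id,
    snd, Category.assoc, ← leftUnitor_naturality, ← id_tensorHom, tensorHom_comp_tensorHom_assoc,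
    Category.id_comp, Category.comp_id]

theorem rho_fst : (ρ_ A).inv ≫ h.fst A (𝟙_ C) = 𝟙 A := by
  rw [fst, h.hom_ext_one (h.t (𝟙_ C)) (𝟙 _)]; simp

theorem lam_snd : (λ_ A).inv ≫ h.snd (𝟙_ C) A = 𝟙 A := by
  rw [snd, h.hom_ext_one (h.t (𝟙_ C)) (𝟙 _)]; simp

theorem braid_fst : (β_ A B).hom ≫ h.fst B A = h.snd A B := by
  rw [fst, ← BraidedCategory.braiding_naturality_assoc, snd]; simp

theorem braid_snd : (β_ A B).hom ≫ h.snd B A = h.fst A B := by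
  rw [snd, ← BraidedCategory.braiding_naturality_assoc, fst]; simp

theorem assoc_snd : (α_ A B D).hom ≫ h.snd A (B ⊗ D) = h.snd A B ⊗ₘ 𝟙 D := by
  rw [snd, snd, ← id_tensorHom_id, ← associator_naturality_assoc]; simp

theorem inv_fst : (α_ A B D).inv ≫ h.fst (A ⊗ B) D = 𝟙 A ⊗ₘ h.fst B D := by
  rw [fst, fst, ← id_tensorHom_id, ← associator_inv_naturality_assoc]; simp

theorem assoc_fst : (α_ A B D).hom ≫ h.fst A (B ⊗ D) = h.fst (A ⊗ B) D ≫ h.fst A B := by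
  rw [← Iso.eq_inv_comp, ← Category.assoc, inv_fst, map_fst, Category.comp_id]

theorem inv_snd : (α_ A B D).inv ≫ h.snd (A ⊗ B) D = h.snd A (B ⊗ D) ≫ h.snd B D := by
  rw [Iso.inv_comp_eq, ← Category.assoc, assoc_snd, map_snd, Category.comp_id]

end IsCartesianMon

namespace IsCocartesianMon

variable (h : IsCocartesianMon C) {A A' B B' D Z : C}

theorem hom_ext_one {C : Type u} [Category.{v} C] [MonoidalCategory C] (h : IsCocartesianMon C)
    {A : C} (f g : 𝟙_ C ⟶ A) : f = g := h.initial.some.hom_ext f g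

/-- The morphism from the initial object. -/
def b (A : C) : 𝟙_ C ⟶ A := h.initial.some.to A

/-- The first injection. -/
def inl (A B : C) : A ⟶ A ⊗ B := (ρ_ A).inv ≫ (𝟙 A ⊗ₘ h.b B)

/-- The second injection. -/
def inr (A B : C) : B ⟶ A ⊗ B := (λ_ B).inv ≫ (h.b A ⊗ₘ 𝟙 B)

theorem ext {f g : A ⊗ B ⟶ Z} (h₁ : h.inl A B ≫ f = h.inl A B ≫ g)
    (h₂ : h.inr A B ≫ f = h.inr A B ≫ g) : f = g :=
  BinaryCofan.IsColimit.hom_ext (h.coproduct (h.b A) (h.b B)).some h₁ h₂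

theorem inl_map (f : A ⟶ A') (g : B ⟶ B') : h.inl A B ≫ (f ⊗ₘ g) = f ≫ h.inl A' B' := by
  rw [inl, inl, Category.assoc, tensorHom_comp_tensorHom, h.hom_ext_one (h.b B ≫ g) (h.b B'),
    rightUnitor_inv_naturality_assoc, ← tensorHom_id, tensorHom_comp_tensorHom]
  simp only [Category.id_comp, Category.comp_id]

theorem inr_map (f : A ⟶ A') (g : B ⟶ B') : h.inr A B ≫ (f ⊗ₘ g) = g ≫ h.inr A' B' := by
  rw [inr, inr, Category.assoc, tensorHom_comp_tensorHom, h.hom_ext_one (h.b A ≫ f) (h.b A'),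
    leftUnitor_inv_naturality_assoc, ← id_tensorHom, tensorHom_comp_tensorHom]
  simp only [Category.id_comp, Category.comp_id]

theorem inl_rho : h.inl A (𝟙_ C) ≫ (ρ_ A).hom = 𝟙 A := by
  rw [inl, h.hom_ext_one (h.b (𝟙_ C)) (𝟙 _)]; simp

theorem inr_lam : h.inr (𝟙_ C) A ≫ (λ_ A).hom = 𝟙 A := by
  rw [inr, h.hom_ext_one (h.b (𝟙_ C)) (𝟙 _)]; simp

theorem inl_braid : h.inl A B ≫ (β_ A B).hom = h.inr B A := by
  rw [inl, Category.assoc, BraidedCategory.braiding_naturality, inr]; simp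

theorem inr_braid : h.inr A B ≫ (β_ A B).hom = h.inl B A := by
  rw [inr, Category.assoc, BraidedCategory.braiding_naturality, inl]; simp

theorem inl_assoc : h.inl (A ⊗ B) D ≫ (α_ A B D).hom = 𝟙 A ⊗ₘ h.inl B D := by
  rw [inl, inl, ← id_tensorHom_id, Category.assoc, associator_naturality]; simp

theorem inr_inv : h.inr A (B ⊗ D) ≫ (α_ A B D).inv = h.inr A B ⊗ₘ 𝟙 D := by
  rw [inr, inr, ← id_tensorHom_id, Category.assoc, associator_inv_naturality]; simp

theorem inl_inv : h.inl A (B ⊗ D) ≫ (α_ A B D).inv = h.inl A B ≫ h.inl (A ⊗ B) D := by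
  rw [Iso.comp_inv_eq, Category.assoc, inl_assoc, inl_map, Category.id_comp]

theorem inr_assoc : h.inr (A ⊗ B) D ≫ (α_ A B D).hom = h.inr B D ≫ h.inr A (B ⊗ D) := by
  rw [← Iso.eq_comp_inv, Category.assoc, inr_inv, inr_map, Category.id_comp]

end IsCocartesianMon

end CartesianGeneric

noncomputable section Inc

set_option linter.unusedSimpArgs false

open SLDC

variable {C : Type u} [Category.{v} C] [CLDC C]

theorem top_ext {A : C} (f g : A ⟶ ⊤ᵒ) : f = g :=
  @IsCartesianMon.hom_ext_one C _ BiSymMonoidal.ten CLDC.cartesian _ f g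

theorem bot_ext {A : C} (f g : ⊥ᵒ ⟶ A) : f = g :=
  @IsCocartesianMon.hom_ext_one C _ BiSymMonoidal.par CLDC.cocartesian _ f g

/-- The morphism to the terminal object. -/
def toTop (A : C) : A ⟶ ⊤ᵒ :=
  @IsCartesianMon.t C _ BiSymMonoidal.ten CLDC.cartesian A

/-- The morphism from the initial object. -/
def ofBot (A : C) : ⊥ᵒ ⟶ A :=
  @IsCocartesianMon.b C _ BiSymMonoidal.par CLDC.cocartesian A

/-- The first projection `A ⊗ B ⟶ A`. -/
def π₀ (A B : C) : A ⊗ᵒ B ⟶ A :=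
  @IsCartesianMon.fst C _ BiSymMonoidal.ten CLDC.cartesian A B

/-- The second projection `A ⊗ B ⟶ B`. -/
def π₁ (A B : C) : A ⊗ᵒ B ⟶ B :=
  @IsCartesianMon.snd C _ BiSymMonoidal.ten CLDC.cartesian A B

/-- The first injection `A ⟶ A ⊕ B`. -/
def ι₀ (A B : C) : A ⟶ A ⊕ᵒ B :=
  @IsCocartesianMon.inl C _ BiSymMonoidal.par CLDC.cocartesian A B

/-- The second injection `B ⟶ A ⊕ B`. -/
def ι₁ (A B : C) : B ⟶ A ⊕ᵒ B :=
  @IsCocartesianMon.inr C _ BiSymMonoidal.par CLDC.cocartesian A B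

/-- The pairing of two morphisms. -/
def pairing {A B Z : C} (f : Z ⟶ A) (g : Z ⟶ B) : Z ⟶ A ⊗ᵒ B :=
  @IsCartesianMon.pair C _ BiSymMonoidal.ten CLDC.cartesian _ _ _ f g

variable {A A' B B' D E Z : C}

theorem π_ext {f g : Z ⟶ A ⊗ᵒ B} (h₁ : f ≫ π₀ A B = g ≫ π₀ A B) (h₂ : f ≫ π₁ A B = g ≫ π₁ A B) :
    f = g :=
  @IsCartesianMon.ext C _ BiSymMonoidal.ten BiSymMonoidal.tenSymm CLDC.cartesian _ _ _ _ _ h₁ h₂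

theorem ι_ext {f g : A ⊕ᵒ B ⟶ Z} (h₁ : ι₀ A B ≫ f = ι₀ A B ≫ g) (h₂ : ι₁ A B ≫ f = ι₁ A B ≫ g) :
    f = g :=
  @IsCocartesianMon.ext C _ BiSymMonoidal.par BiSymMonoidal.parSymm CLDC.cocartesian _ _ _ _ _ h₁ h₂

theorem pairing_π₀ (f : Z ⟶ A) (g : Z ⟶ B) : pairing f g ≫ π₀ A B = f :=
  @IsCartesianMon.pair_fst C _ BiSymMonoidal.ten BiSymMonoidal.tenSymm CLDC.cartesian _ _ _ f g

theorem pairing_π₁ (f : Z ⟶ A) (g : Z ⟶ B) : pairing f g ≫ π₁ A B = g :=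
  @IsCartesianMon.pair_snd C _ BiSymMonoidal.ten BiSymMonoidal.tenSymm CLDC.cartesian _ _ _ f g

theorem map_π₀ (f : A ⟶ A') (g : B ⟶ B') : f ⊗ʰ g ≫ π₀ A' B' = π₀ A B ≫ f :=
  @IsCartesianMon.map_fst C _ BiSymMonoidal.ten BiSymMonoidal.tenSymm CLDC.cartesian _ _ _ _ f g

theorem map_π₁ (f : A ⟶ A') (g : B ⟶ B') : f ⊗ʰ g ≫ π₁ A' B' = π₁ A B ≫ g :=
  @IsCartesianMon.map_snd C _ BiSymMonoidal.ten BiSymMonoidal.tenSymm CLDC.cartesian _ _ _ _ f g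

theorem ι₀_map (f : A ⟶ A') (g : B ⟶ B') : ι₀ A B ≫ f ⊕ʰ g = f ≫ ι₀ A' B' :=
  @IsCocartesianMon.inl_map C _ BiSymMonoidal.par BiSymMonoidal.parSymm CLDC.cocartesian
    _ _ _ _ f g

theorem ι₁_map (f : A ⟶ A') (g : B ⟶ B') : ι₁ A B ≫ f ⊕ʰ g = g ≫ ι₁ A' B' :=
  @IsCocartesianMon.inr_map C _ BiSymMonoidal.par BiSymMonoidal.parSymm CLDC.cocartesian
    _ _ _ _ f g

variable (A B D) in
theorem proj_rules : (tR A).hom ≫ π₀ A ⊤ᵒ = 𝟙 A ∧ (tL A).hom ≫ π₁ ⊤ᵒ A = 𝟙 A ∧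
    (tσ A B).hom ≫ π₀ B A = π₁ A B ∧ (tσ A B).hom ≫ π₁ B A = π₀ A B ∧
    (tα A B D).hom ≫ π₀ A (B ⊗ᵒ D) = π₀ (A ⊗ᵒ B) D ≫ π₀ A B ∧
    (tα A B D).hom ≫ π₁ A (B ⊗ᵒ D) = π₁ A B ⊗ʰ 𝟙 D ∧
    (tα A B D).inv ≫ π₀ (A ⊗ᵒ B) D = 𝟙 A ⊗ʰ π₀ B D ∧
    (tα A B D).inv ≫ π₁ (A ⊗ᵒ B) D = π₁ A (B ⊗ᵒ D) ≫ π₁ B D := by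
  let _ : MonoidalCategory C := BiSymMonoidal.ten
  let _ : SymmetricCategory C := BiSymMonoidal.tenSymm
  have h : IsCartesianMon C := CLDC.cartesian
  exact ⟨h.rho_fst, h.lam_snd, h.braid_fst, h.braid_snd, h.assoc_fst, h.assoc_snd, h.inv_fst,
    h.inv_snd⟩

variable (A B D) in
theorem inj_rules : ι₀ A ⊥ᵒ ≫ (pR A).hom = 𝟙 A ∧ ι₁ ⊥ᵒ A ≫ (pL A).hom = 𝟙 A ∧
    ι₀ A B ≫ (pσ A B).hom = ι₁ B A ∧ ι₁ A B ≫ (pσ A B).hom = ι₀ B A ∧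
    ι₀ A (B ⊕ᵒ D) ≫ (pα A B D).hom = ι₀ A B ≫ ι₀ (A ⊕ᵒ B) D ∧
    ι₁ A (B ⊕ᵒ D) ≫ (pα A B D).hom = ι₁ A B ⊕ʰ 𝟙 D ∧
    ι₀ (A ⊕ᵒ B) D ≫ (pα A B D).inv = 𝟙 A ⊕ʰ ι₀ B D ∧
    ι₁ (A ⊕ᵒ B) D ≫ (pα A B D).inv = ι₁ B D ≫ ι₁ A (B ⊕ᵒ D) := by
  let _ : MonoidalCategory C := BiSymMonoidal.par
  let _ : SymmetricCategory C := BiSymMonoidal.parSymm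
  have h : IsCocartesianMon C := CLDC.cocartesian
  exact ⟨h.inl_rho, h.inr_lam, h.inl_braid, h.inr_braid, h.inl_inv, h.inr_inv, h.inl_assoc,
    h.inr_assoc⟩

theorem tR_π₀ (A : C) : (tR A).hom ≫ π₀ A ⊤ᵒ = 𝟙 A := (proj_rules A A A).1
theorem tL_π₁ (A : C) : (tL A).hom ≫ π₁ ⊤ᵒ A = 𝟙 A := (proj_rules A A A).2.1
theorem tσ_π₀ (A B : C) : (tσ A B).hom ≫ π₀ B A = π₁ A B := (proj_rules A B A).2.2.1
theorem tσ_π₁ (A B : C) : (tσ A B).hom ≫ π₁ B A = π₀ A B := (proj_rules A B A).2.2.2.1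
theorem tα_π₀ (A B D : C) : (tα A B D).hom ≫ π₀ A (B ⊗ᵒ D) = π₀ (A ⊗ᵒ B) D ≫ π₀ A B :=
  (proj_rules A B D).2.2.2.2.1
theorem tα_π₁ (A B D : C) : (tα A B D).hom ≫ π₁ A (B ⊗ᵒ D) = π₁ A B ⊗ʰ 𝟙 D :=
  (proj_rules A B D).2.2.2.2.2.1
theorem tα_inv_π₀ (A B D : C) : (tα A B D).inv ≫ π₀ (A ⊗ᵒ B) D = 𝟙 A ⊗ʰ π₀ B D :=
  (proj_rules A B D).2.2.2.2.2.2.1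
theorem tα_inv_π₁ (A B D : C) : (tα A B D).inv ≫ π₁ (A ⊗ᵒ B) D = π₁ A (B ⊗ᵒ D) ≫ π₁ B D :=
  (proj_rules A B D).2.2.2.2.2.2.2

theorem ι₀_pα (A B D : C) : ι₀ A (B ⊕ᵒ D) ≫ (pα A B D).hom = ι₀ A B ≫ ι₀ (A ⊕ᵒ B) D :=
  (inj_rules A B D).2.2.2.2.1
theorem ι₁_pα (A B D : C) : ι₁ A (B ⊕ᵒ D) ≫ (pα A B D).hom = ι₁ A B ⊕ʰ 𝟙 D :=
  (inj_rules A B D).2.2.2.2.2.1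
theorem ι₀_pα_inv (A B D : C) : ι₀ (A ⊕ᵒ B) D ≫ (pα A B D).inv = 𝟙 A ⊕ʰ ι₀ B D :=
  (inj_rules A B D).2.2.2.2.2.2.1
theorem ι₁_pα_inv (A B D : C) : ι₁ (A ⊕ᵒ B) D ≫ (pα A B D).inv = ι₁ B D ≫ ι₁ A (B ⊕ᵒ D) :=
  (inj_rules A B D).2.2.2.2.2.2.2

theorem π₀_def (A B : C) : π₀ A B = 𝟙 A ⊗ʰ toTop B ≫ (tR A).inv := rfl
theorem π₁_def (A B : C) : π₁ A B = toTop A ⊗ʰ 𝟙 B ≫ (tL B).inv := rfl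
theorem ι₀_def (A B : C) : ι₀ A B = (pR A).inv ≫ 𝟙 A ⊕ʰ ofBot B := rfl
theorem ι₁_def (A B : C) : ι₁ A B = (pL B).inv ≫ ofBot A ⊕ʰ 𝟙 B := rfl

theorem δL_π₁ (A B D : C) : δL A B D ≫ π₁ A B ⊕ʰ 𝟙 D = π₁ A (B ⊕ᵒ D) := by
  have h := tL_δL B D
  rw [← Iso.eq_inv_comp] at h
  calc _ = (δL A B D ≫ (toTop A ⊗ʰ 𝟙 B) ⊕ʰ 𝟙 D) ≫ (tL B).inv ⊕ʰ 𝟙 D := by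
        rw [Category.assoc, pc, π₁_def, Category.id_comp]
    _ = _ := by
        rw [← δL_natural, Category.assoc, h, Category.assoc, pc, Iso.hom_inv_id, π₁_def]
        simp [pid]

theorem δR_π₀ (A B D : C) : δR A B D ≫ 𝟙 A ⊕ʰ π₀ B D = π₀ (A ⊕ᵒ B) D := by
  have h := tR_δR A B
  rw [← Iso.eq_inv_comp] at h
  calc _ = (δR A B D ≫ 𝟙 A ⊕ʰ (𝟙 B ⊗ʰ toTop D)) ≫ 𝟙 A ⊕ʰ (tR B).inv := by
        rw [Category.assoc, pc, π₀_def, Category.id_comp]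
    _ = _ := by
        rw [← δR_natural, Category.assoc, h, Category.assoc, pc, Iso.hom_inv_id, π₀_def]
        simp [pid]

theorem ι₀_δL (A B D : C) : 𝟙 A ⊗ʰ ι₀ B D ≫ δL A B D = ι₀ (A ⊗ᵒ B) D := by
  have h := δL_pR A B
  rw [← Iso.eq_comp_inv] at h
  calc _ = 𝟙 A ⊗ʰ (pR B).inv ≫ (𝟙 A ⊗ʰ (𝟙 B ⊕ʰ ofBot D) ≫ δL A B D) := by
        rw [tc', ι₀_def, Category.id_comp]
    _ = _ := by
        rw [δL_natural, h, ι₀_def, Category.assoc, tc', Iso.inv_hom_id]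
        simp [tid]

theorem ι₁_δR (A B D : C) : ι₁ A B ⊗ʰ 𝟙 D ≫ δR A B D = ι₁ A (B ⊗ᵒ D) := by
  have h := δR_pL B D
  rw [← Iso.eq_comp_inv] at h
  calc _ = (pL B).inv ⊗ʰ 𝟙 D ≫ ((ofBot A ⊕ʰ 𝟙 B) ⊗ʰ 𝟙 D ≫ δR A B D) := by
        rw [tc', ι₁_def, Category.id_comp]
    _ = _ := by
        rw [δR_natural, h, ι₁_def, Category.assoc, tc', Iso.inv_hom_id]
        simp [tid]

/-- The medial map of a cartesian linearly distributive category, determined by its projections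
`π₀ ⊕ π₀` and `π₁ ⊕ π₁`. -/
def cmed (A B D E : C) : (A ⊗ᵒ B) ⊕ᵒ (D ⊗ᵒ E) ⟶ (A ⊕ᵒ D) ⊗ᵒ (B ⊕ᵒ E) :=
  pairing (π₀ A B ⊕ʰ π₀ D E) (π₁ A B ⊕ʰ π₁ D E)

theorem cmed_π₀ (A B D E : C) : cmed A B D E ≫ π₀ _ _ = π₀ A B ⊕ʰ π₀ D E := pairing_π₀ _ _
theorem cmed_π₁ (A B D E : C) : cmed A B D E ≫ π₁ _ _ = π₁ A B ⊕ʰ π₁ D E := pairing_π₁ _ _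

theorem ι₀_cmed (A B D E : C) : ι₀ _ _ ≫ cmed A B D E = ι₀ A D ⊗ʰ ι₀ B E :=
  π_ext (by rw [Category.assoc, cmed_π₀, ι₀_map, map_π₀])
    (by rw [Category.assoc, cmed_π₁, ι₀_map, map_π₁])

theorem ι₁_cmed (A B D E : C) : ι₁ _ _ ≫ cmed A B D E = ι₁ A D ⊗ʰ ι₁ B E :=
  π_ext (by rw [Category.assoc, cmed_π₀, ι₁_map, map_π₀])
    (by rw [Category.assoc, cmed_π₁, ι₁_map, map_π₁])

/-- The canonical morphism `⊥ ⊗ D ⟶ D` built from the left linear distributivity. -/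
def θ (D : C) : ⊥ᵒ ⊗ᵒ D ⟶ D :=
  𝟙 ⊥ᵒ ⊗ʰ (pL D).inv ≫ δL ⊥ᵒ ⊥ᵒ D ≫ π₀ ⊥ᵒ ⊥ᵒ ⊕ʰ 𝟙 D ≫ (pL D).hom

theorem θ_bot : θ (⊥ᵒ : C) = π₀ ⊥ᵒ ⊥ᵒ := by
  have h := δL_pR (⊥ᵒ : C) ⊥ᵒ
  rw [θ, pL_pOne, pR_nat, reassoc_of% h, tc', Iso.inv_hom_id]
  simp [tid]

theorem θ_ten (A D : C) : θ (A ⊗ᵒ D) = (tα _ _ _).inv ≫ θ A ⊗ʰ 𝟙 D := by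
  have h := δR_pL A D
  have h1 : (pL (A ⊗ᵒ D)).inv = (pL A).inv ⊗ʰ 𝟙 D ≫ δR ⊥ᵒ A D := by
    rw [← Iso.eq_comp_inv] at h
    rw [h, tc', Iso.inv_hom_id, Category.comp_id, tid, Category.id_comp]
  have h2 := δR_δL (⊥ᵒ : C) ⊥ᵒ A D
  rw [← Iso.inv_comp_eq] at h2
  have h3 := tα_inv_nat (𝟙 (⊥ᵒ : C)) (pL A).inv (𝟙 D)
  have h4 := δR_natural (π₀ (⊥ᵒ : C) ⊥ᵒ) (𝟙 A) (𝟙 D)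
  rw [tid] at h4
  calc _ = 𝟙 ⊥ᵒ ⊗ʰ ((pL A).inv ⊗ʰ 𝟙 D) ≫ (𝟙 ⊥ᵒ ⊗ʰ δR ⊥ᵒ A D ≫ δL ⊥ᵒ ⊥ᵒ (A ⊗ᵒ D)) ≫
        π₀ ⊥ᵒ ⊥ᵒ ⊕ʰ 𝟙 _ ≫ (pL _).hom := by
        rw [θ, h1]; simp only [tc', Category.assoc, Category.id_comp]
    _ = _ := by
        rw [← h2, θ]
        simp only [Category.assoc]
        rw [reassoc_of% h3, ← reassoc_of% h4, h]
        simp only [tc, tc', Category.assoc, Category.id_comp]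

theorem θ_nat (f : A ⟶ B) : 𝟙 ⊥ᵒ ⊗ʰ f ≫ θ B = θ A ≫ f := by
  have h1 : f ≫ (pL B).inv = (pL A).inv ≫ 𝟙 ⊥ᵒ ⊕ʰ f := by
    rw [Iso.comp_inv_eq, Category.assoc, pL_nat, Iso.inv_hom_id_assoc]
  have h2 := δL_natural (𝟙 (⊥ᵒ : C)) (𝟙 (⊥ᵒ : C)) f
  rw [tid] at h2
  calc _ = 𝟙 ⊥ᵒ ⊗ʰ (pL A).inv ≫ (𝟙 ⊥ᵒ ⊗ʰ (𝟙 ⊥ᵒ ⊕ʰ f) ≫ δL ⊥ᵒ ⊥ᵒ B) ≫ π₀ ⊥ᵒ ⊥ᵒ ⊕ʰ 𝟙 B ≫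
        (pL B).hom := by
        rw [θ, tc', h1]; simp only [tc', Category.assoc, Category.id_comp]
    _ = _ := by
        rw [h2, θ]
        simp only [Category.assoc]
        rw [← pL_nat]
        simp only [pc', Category.id_comp, Category.comp_id]

theorem θ_eq (D : C) : θ D = π₁ ⊥ᵒ D := by
  have h1 : 𝟙 ⊥ᵒ ⊗ʰ π₁ ⊥ᵒ D ≫ θ D = 𝟙 ⊥ᵒ ⊗ʰ π₁ ⊥ᵒ D ≫ π₁ ⊥ᵒ D := by
    rw [θ_nat, θ_ten, θ_bot, Category.assoc, map_π₁, Category.comp_id, tα_inv_π₁, map_π₁]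
  have h2 : pairing (π₀ ⊥ᵒ D) (𝟙 _) ≫ 𝟙 ⊥ᵒ ⊗ʰ π₁ ⊥ᵒ D = 𝟙 _ := by
    apply π_ext
    · rw [Category.assoc, map_π₀, Category.comp_id, pairing_π₀, Category.id_comp]
    · rw [Category.assoc, map_π₁, reassoc_of% pairing_π₁]
  rw [← Category.id_comp (θ D), ← h2, Category.assoc, h1, reassoc_of% h2]

theorem π_bot : π₀ (⊥ᵒ : C) ⊥ᵒ = π₁ ⊥ᵒ ⊥ᵒ := by rw [← θ_bot, θ_eq]

theorem cmix_law (A B : C) :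
    𝟙 A ⊗ʰ (pL B).inv ≫ 𝟙 A ⊗ʰ (toTop ⊥ᵒ ⊕ʰ 𝟙 B) ≫ δL A ⊤ᵒ B ≫ (tR A).inv ⊕ʰ 𝟙 B =
    (pR A).inv ⊗ʰ 𝟙 B ≫ (𝟙 A ⊕ʰ toTop ⊥ᵒ) ⊗ʰ 𝟙 B ≫ δR A ⊤ᵒ B ≫ 𝟙 A ⊕ʰ (tL B).inv := by
  have hq : ∀ q : (⊥ᵒ : C) ⊗ᵒ ⊥ᵒ ⟶ ⊥ᵒ,
      (pα A (⊥ᵒ ⊗ᵒ ⊥ᵒ) B).hom ≫ (𝟙 A ⊕ʰ q) ⊕ʰ 𝟙 B ≫ (pR A).hom ⊕ʰ 𝟙 B =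
        𝟙 A ⊕ʰ (q ⊕ʰ 𝟙 B) ≫ 𝟙 A ⊕ʰ (pL B).hom := by
    intro q
    have h : (pα A ⊥ᵒ B).inv ≫ 𝟙 A ⊕ʰ (pL B).hom = (pR A).hom ⊕ʰ 𝟙 B :=
      @triangle_h C _ BiSymMonoidal.par BiSymMonoidal.parSymm A B
    rw [← reassoc_of% pα_nat, ← h, Iso.hom_inv_id_assoc]
  have h0 : (pR A).inv ⊗ʰ 𝟙 ⊥ᵒ ≫ δR A ⊥ᵒ ⊥ᵒ ≫ 𝟙 A ⊕ʰ π₀ ⊥ᵒ ⊥ᵒ ≫ (pR A).hom = π₀ A ⊥ᵒ := by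
    rw [reassoc_of% δR_π₀, reassoc_of% map_π₀, Iso.inv_hom_id, Category.comp_id]
  have h1 : 𝟙 ⊥ᵒ ⊗ʰ (pL B).inv ≫ δL ⊥ᵒ ⊥ᵒ B ≫ π₁ ⊥ᵒ ⊥ᵒ ⊕ʰ 𝟙 B ≫ (pL B).hom = π₁ ⊥ᵒ B := by
    rw [reassoc_of% δL_π₁, reassoc_of% map_π₁, Iso.inv_hom_id, Category.comp_id]
  have h2 := δL_natural (pR A).inv (𝟙 (⊥ᵒ : C)) (𝟙 B)
  rw [pid] at h2
  have h3 := δR_natural (𝟙 A) (𝟙 (⊥ᵒ : C)) (pL B).inv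
  rw [pid] at h3
  calc _ = 𝟙 A ⊗ʰ (pL B).inv ≫ δL A ⊥ᵒ B ≫ π₀ A ⊥ᵒ ⊕ʰ 𝟙 B := by
        rw [reassoc_of% δL_natural, pc, Category.comp_id]; rfl
    _ = 𝟙 A ⊗ʰ (pL B).inv ≫ (δL A ⊥ᵒ B ≫ ((pR A).inv ⊗ʰ 𝟙 ⊥ᵒ) ⊕ʰ 𝟙 B) ≫
        δR A ⊥ᵒ ⊥ᵒ ⊕ʰ 𝟙 B ≫ (𝟙 A ⊕ʰ π₀ ⊥ᵒ ⊥ᵒ) ⊕ʰ 𝟙 B ≫ (pR A).hom ⊕ʰ 𝟙 B := by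
        rw [← h0]; simp only [pc, pc', Category.assoc, Category.id_comp]
    _ = (pR A).inv ⊗ʰ (pL B).inv ≫ δR A ⊥ᵒ (⊥ᵒ ⊕ᵒ B) ≫ 𝟙 A ⊕ʰ δL ⊥ᵒ ⊥ᵒ B ≫
        𝟙 A ⊕ʰ (π₀ ⊥ᵒ ⊥ᵒ ⊕ʰ 𝟙 B) ≫ 𝟙 A ⊕ʰ (pL B).hom := by
        rw [← h2, Category.assoc, reassoc_of% (δL_δR A ⊥ᵒ ⊥ᵒ B), hq]
        simp only [tc', Category.comp_id, Category.id_comp]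
    _ = (pR A).inv ⊗ʰ 𝟙 B ≫ (δR A ⊥ᵒ B ≫ 𝟙 A ⊕ʰ (𝟙 ⊥ᵒ ⊗ʰ (pL B).inv)) ≫ 𝟙 A ⊕ʰ δL ⊥ᵒ ⊥ᵒ B ≫
        𝟙 A ⊕ʰ (π₁ ⊥ᵒ ⊥ᵒ ⊕ʰ 𝟙 B) ≫ 𝟙 A ⊕ʰ (pL B).hom := by
        rw [← h3, π_bot]; simp only [tc', Category.assoc, Category.comp_id, Category.id_comp]
    _ = (pR A).inv ⊗ʰ 𝟙 B ≫ δR A ⊥ᵒ B ≫ 𝟙 A ⊕ʰ π₁ ⊥ᵒ B := by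
        rw [← h1]; simp only [pc, pc', Category.assoc, Category.id_comp]
    _ = _ := by
        rw [reassoc_of% δR_natural, pc, Category.comp_id]; rfl

variable (C) in
/-- The symmetric medial linearly distributive category underlying a cartesian linearly
distributive category: `Δ_⊥`, `∇_⊤` and `m` are the unique morphisms out of the initial object
or into the terminal object, and the medial maps are the canonical ones. -/
abbrev inc : SMLDC C where
  Δbot := ofBot _
  nabTop := toTop _
  mix := toTop _
  med := cmed
  med_natural f g h k := by
    apply π_ext
    · simp only [Category.assoc, cmed_π₀, map_π₀, reassoc_of% cmed_π₀, pc]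
    · simp only [Category.assoc, cmed_π₁, map_π₁, reassoc_of% cmed_π₁, pc]
  mix_law := cmix_law
  Δbot_coassoc := bot_ext _ _
  Δbot_mix_right := bot_ext _ _
  Δbot_mix_left := bot_ext _ _
  Δbot_cocomm := bot_ext _ _
  nabTop_assoc := top_ext _ _
  mix_nabTop_right := top_ext _ _
  mix_nabTop_left := top_ext _ _
  nabTop_comm := top_ext _ _
  med_tα A B D A' B' D' := by
    apply π_ext
    · simp only [Category.assoc, tα_π₀, cmed_π₀, map_π₀, reassoc_of% map_π₀, reassoc_of% cmed_π₀,
        pc, Category.comp_id]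
    · apply π_ext
      · simp only [Category.assoc, tα_π₁, cmed_π₀, cmed_π₁, map_π₀, map_π₁, reassoc_of% tα_π₁,
          reassoc_of% map_π₀, reassoc_of% map_π₁, reassoc_of% cmed_π₀, reassoc_of% cmed_π₁,
          pc, pc', Category.comp_id, tc, tc']
      · simp only [Category.assoc, tα_π₁, cmed_π₀, cmed_π₁, map_π₀, map_π₁, reassoc_of% tα_π₁,
          reassoc_of% map_π₀, reassoc_of% map_π₁, reassoc_of% cmed_π₀, reassoc_of% cmed_π₁,
          pc, pc', Category.comp_id, tc, tc']
  med_pα A B D E F G := by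
    apply π_ext
    · simp only [Category.assoc, cmed_π₀, map_π₀, reassoc_of% cmed_π₀, pc, pc', Category.id_comp,
        ← pα_nat]
    · simp only [Category.assoc, cmed_π₁, map_π₁, reassoc_of% cmed_π₁, pc, pc', Category.id_comp,
        ← pα_nat]
  med_pL A B := by
    apply π_ext
    · simp only [Category.assoc, map_π₀, reassoc_of% cmed_π₀, pc', Category.id_comp, ← pL_nat]
      rw [bot_ext (ofBot _ ≫ π₀ (⊥ᵒ : C) ⊥ᵒ) (𝟙 _)]
    · simp only [Category.assoc, map_π₁, reassoc_of% cmed_π₁, pc', Category.id_comp, ← pL_nat]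
      rw [bot_ext (ofBot _ ≫ π₁ (⊥ᵒ : C) ⊥ᵒ) (𝟙 _)]
  med_pR A B := by
    apply π_ext
    · simp only [Category.assoc, map_π₀, reassoc_of% cmed_π₀, pc', Category.id_comp, ← pR_nat]
      rw [bot_ext (ofBot _ ≫ π₀ (⊥ᵒ : C) ⊥ᵒ) (𝟙 _)]
    · simp only [Category.assoc, map_π₁, reassoc_of% cmed_π₁, pc', Category.id_comp, ← pR_nat]
      rw [bot_ext (ofBot _ ≫ π₁ (⊥ᵒ : C) ⊥ᵒ) (𝟙 _)]
  med_tL A B := by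
    apply π_ext
    · exact top_ext _ _
    · simp only [Category.assoc, map_π₁, cmed_π₁, pc, tL_π₁, Category.comp_id, pid]
  med_tR A B := by
    apply π_ext
    · simp only [Category.assoc, map_π₀, cmed_π₀, pc, tR_π₀, Category.comp_id, pid]
    · exact top_ext _ _
  med_tσ A B D E := by
    apply π_ext
    · simp only [Category.assoc, tσ_π₀, cmed_π₁, cmed_π₀, pc]
    · simp only [Category.assoc, tσ_π₁, cmed_π₁, cmed_π₀, pc]
  med_pσ A B D E := by
    apply π_ext
    · simp only [Category.assoc, map_π₀, cmed_π₀, reassoc_of% cmed_π₀, pσ_nat]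
    · simp only [Category.assoc, map_π₁, cmed_π₁, reassoc_of% cmed_π₁, pσ_nat]
  med_δR_tα A B D E X := by
    apply π_ext
    · have h := δR_π₀ (A ⊗ᵒ B) (D ⊗ᵒ E) X
      simp only [Category.assoc, map_π₀, tα_π₀, cmed_π₀, reassoc_of% map_π₀, pc, pc',
        Category.comp_id, Category.id_comp, ← h]
    · have h := δR_natural (π₁ A B) (π₁ D E) (𝟙 X)
      simp only [Category.assoc, map_π₁, tα_π₁, cmed_π₁, reassoc_of% tα_π₁, pc, pc', tc',
        Category.comp_id, Category.id_comp, h]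
  med_δL_tα A B D E X := by
    apply π_ext
    · have h := δL_natural (𝟙 X) (π₀ A B) (π₀ D E)
      simp only [Category.assoc, map_π₀, tα_inv_π₀, cmed_π₀, reassoc_of% tα_inv_π₀, pc, pc', tc',
        Category.comp_id, Category.id_comp, h]
    · have h := δL_π₁ X (A ⊗ᵒ B) (D ⊗ᵒ E)
      simp only [Category.assoc, map_π₁, tα_inv_π₁, cmed_π₁, reassoc_of% map_π₁, pc, pc',
        Category.comp_id, Category.id_comp, ← h]
  med_δR_pα A B D E X := by
    apply ι_ext
    · have h := δR_natural (𝟙 X) (ι₀ A D) (ι₀ B E)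
      simp only [reassoc_of% ι₀_map, reassoc_of% ι₀_pα_inv, reassoc_of% ι₀_cmed, ι₀_pα_inv,
        ι₀_cmed, pc, tc', Category.comp_id, Category.id_comp, h]
    · have h := ι₁_δR X (A ⊕ᵒ D) (B ⊕ᵒ E)
      simp only [reassoc_of% ι₁_map, reassoc_of% ι₁_pα_inv, reassoc_of% ι₁_cmed, ι₁_pα_inv,
        ι₁_map, reassoc_of% ι₁_cmed, ι₁_cmed, tc', Category.comp_id, Category.id_comp, ← h]
  med_δL_pα A B D E X := by
    apply ι_ext
    · have h := ι₀_δL (A ⊕ᵒ D) (B ⊕ᵒ E) X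
      simp only [reassoc_of% ι₀_map, reassoc_of% ι₀_pα, reassoc_of% ι₀_cmed, ι₀_pα,
        ι₀_map, ι₀_cmed, tc', Category.comp_id, Category.id_comp, ← h]
    · have h := δL_natural (ι₁ A D) (ι₁ B E) (𝟙 X)
      simp only [reassoc_of% ι₁_map, reassoc_of% ι₁_pα, reassoc_of% ι₁_cmed, ι₁_pα,
        ι₁_cmed, pc, tc', Category.comp_id, Category.id_comp, h]

end Inc

end LD
namespace LD

section Functors

/-- `(F, η, μ)` is a symmetric (lax) monoidal functor. -/
structure IsSymmMonoidal {C : Type u₁} [Category.{v₁} C] [MonoidalCategory C] [SymmetricCategory C]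
    {D : Type u₂} [Category.{v₂} D] [MonoidalCategory D] [SymmetricCategory D] (F : C ⥤ D)
    (η : MonoidalCategoryStruct.tensorUnit D ⟶ F.obj (MonoidalCategoryStruct.tensorUnit C))
    (μ : ∀ A B : C, MonoidalCategoryStruct.tensorObj (F.obj A) (F.obj B) ⟶
      F.obj (MonoidalCategoryStruct.tensorObj A B)) : Prop where
  natural : ∀ {A A' B B' : C} (f : A ⟶ A') (g : B ⟶ B'),
    MonoidalCategoryStruct.tensorHom (F.map f) (F.map g) ≫ μ A' B' =
      μ A B ≫ F.map (MonoidalCategoryStruct.tensorHom f g)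
  assoc : ∀ A B E : C,
    MonoidalCategoryStruct.tensorHom (μ A B) (𝟙 (F.obj E)) ≫ μ _ E ≫
      F.map (MonoidalCategoryStruct.associator A B E).hom =
    (MonoidalCategoryStruct.associator (F.obj A) (F.obj B) (F.obj E)).hom ≫
      MonoidalCategoryStruct.tensorHom (𝟙 (F.obj A)) (μ B E) ≫ μ A _
  unit_left : ∀ A : C,
    MonoidalCategoryStruct.tensorHom η (𝟙 (F.obj A)) ≫ μ _ A ≫
      F.map (MonoidalCategoryStruct.leftUnitor A).hom =
    (MonoidalCategoryStruct.leftUnitor (F.obj A)).hom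
  unit_right : ∀ A : C,
    MonoidalCategoryStruct.tensorHom (𝟙 (F.obj A)) η ≫ μ A _ ≫
      F.map (MonoidalCategoryStruct.rightUnitor A).hom =
    (MonoidalCategoryStruct.rightUnitor (F.obj A)).hom
  symm : ∀ A B : C, μ A B ≫ F.map (BraidedCategory.braiding A B).hom =
    (BraidedCategory.braiding (F.obj A) (F.obj B)).hom ≫ μ B A

/-- `(F, η, μ)` is a symmetric (colax) comonoidal functor. -/
structure IsSymmComonoidal {C : Type u₁} [Category.{v₁} C] [MonoidalCategory C]
    [SymmetricCategory C] {D : Type u₂} [Category.{v₂} D] [MonoidalCategory D]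
    [SymmetricCategory D] (F : C ⥤ D)
    (η : F.obj (MonoidalCategoryStruct.tensorUnit C) ⟶ MonoidalCategoryStruct.tensorUnit D)
    (μ : ∀ A B : C, F.obj (MonoidalCategoryStruct.tensorObj A B) ⟶
      MonoidalCategoryStruct.tensorObj (F.obj A) (F.obj B)) : Prop where
  natural : ∀ {A A' B B' : C} (f : A ⟶ A') (g : B ⟶ B'),
    F.map (MonoidalCategoryStruct.tensorHom f g) ≫ μ A' B' =
      μ A B ≫ MonoidalCategoryStruct.tensorHom (F.map f) (F.map g)
  assoc : ∀ A B E : C,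
    μ _ E ≫ MonoidalCategoryStruct.tensorHom (μ A B) (𝟙 (F.obj E)) ≫
      (MonoidalCategoryStruct.associator (F.obj A) (F.obj B) (F.obj E)).hom =
    F.map (MonoidalCategoryStruct.associator A B E).hom ≫ μ A _ ≫
      MonoidalCategoryStruct.tensorHom (𝟙 (F.obj A)) (μ B E)
  unit_left : ∀ A : C,
    μ _ A ≫ MonoidalCategoryStruct.tensorHom η (𝟙 (F.obj A)) ≫
      (MonoidalCategoryStruct.leftUnitor (F.obj A)).hom =
    F.map (MonoidalCategoryStruct.leftUnitor A).hom
  unit_right : ∀ A : C,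
    μ A _ ≫ MonoidalCategoryStruct.tensorHom (𝟙 (F.obj A)) η ≫
      (MonoidalCategoryStruct.rightUnitor (F.obj A)).hom =
    F.map (MonoidalCategoryStruct.rightUnitor A).hom
  symm : ∀ A B : C, F.map (BraidedCategory.braiding A B).hom ≫ μ B A =
    μ A B ≫ (BraidedCategory.braiding (F.obj A) (F.obj B)).hom

/-- The data of a strong symmetric medial linear functor: a pair of functors with structure maps
and (right) linear strengths. -/
structure MedialData (C : Type u₁) [Category.{v₁} C] [SMLDC C]
    (D : Type u₂) [Category.{v₂} D] [SMLDC D] where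
  /-- the tensor component -/
  Ft : C ⥤ D
  /-- the par component -/
  Fp : C ⥤ D
  mTop : (⊤ᵒ : D) ≅ Ft.obj ⊤ᵒ
  mTen : ∀ A B : C, Ft.obj A ⊗ᵒ Ft.obj B ≅ Ft.obj (A ⊗ᵒ B)
  mBot : (⊥ᵒ : D) ⟶ Ft.obj ⊥ᵒ
  mPar : ∀ A B : C, Ft.obj A ⊕ᵒ Ft.obj B ⟶ Ft.obj (A ⊕ᵒ B)
  nBot : Fp.obj ⊥ᵒ ≅ (⊥ᵒ : D)
  nPar : ∀ A B : C, Fp.obj (A ⊕ᵒ B) ≅ Fp.obj A ⊕ᵒ Fp.obj B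
  nTop : Fp.obj ⊤ᵒ ⟶ (⊤ᵒ : D)
  nTen : ∀ A B : C, Fp.obj (A ⊗ᵒ B) ⟶ Fp.obj A ⊗ᵒ Fp.obj B
  /-- the right tensor strength -/
  νRt : ∀ A B : C, Ft.obj (A ⊕ᵒ B) ⟶ Fp.obj A ⊕ᵒ Ft.obj B
  /-- the right par strength -/
  νRp : ∀ A B : C, Ft.obj A ⊗ᵒ Fp.obj B ⟶ Fp.obj (A ⊗ᵒ B)

namespace MedialData

variable {C : Type u₁} [Category.{v₁} C] [SMLDC C] {D : Type u₂} [Category.{v₂} D] [SMLDC D]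
  {E : Type u₃} [Category.{v₃} E] [SMLDC E]

/-- The left tensor strength, determined by the right one through the braidings. -/
def νLt (F : MedialData C D) (A B : C) : F.Ft.obj (A ⊕ᵒ B) ⟶ F.Ft.obj A ⊕ᵒ F.Fp.obj B :=
  F.Ft.map (pσ A B).hom ≫ F.νRt B A ≫ (pσ (F.Fp.obj B) (F.Ft.obj A)).hom

/-- The left par strength, determined by the right one through the braidings. -/
def νLp (F : MedialData C D) (A B : C) : F.Fp.obj A ⊗ᵒ F.Ft.obj B ⟶ F.Fp.obj (A ⊗ᵒ B) :=
  (tσ (F.Fp.obj A) (F.Ft.obj B)).hom ≫ F.νRp B A ≫ F.Fp.map (tσ B A).hom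

variable (C) in
/-- The identity functor with identity structure maps. -/
def id : MedialData C C where
  Ft := 𝟭 C
  Fp := 𝟭 C
  mTop := Iso.refl _
  mTen _ _ := Iso.refl _
  mBot := 𝟙 _
  mPar _ _ := 𝟙 _
  nBot := Iso.refl _
  nPar _ _ := Iso.refl _
  nTop := 𝟙 _
  nTen _ _ := 𝟙 _
  νRt _ _ := 𝟙 _
  νRp _ _ := 𝟙 _

/-- Composition, in diagrammatic order. -/
def comp (F : MedialData C D) (G : MedialData D E) : MedialData C E where
  Ft := F.Ft ⋙ G.Ft
  Fp := F.Fp ⋙ G.Fp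
  mTop := G.mTop ≪≫ G.Ft.mapIso F.mTop
  mTen A B := G.mTen (F.Ft.obj A) (F.Ft.obj B) ≪≫ G.Ft.mapIso (F.mTen A B)
  mBot := G.mBot ≫ G.Ft.map F.mBot
  mPar A B := G.mPar (F.Ft.obj A) (F.Ft.obj B) ≫ G.Ft.map (F.mPar A B)
  nBot := G.Fp.mapIso F.nBot ≪≫ G.nBot
  nPar A B := G.Fp.mapIso (F.nPar A B) ≪≫ G.nPar (F.Fp.obj A) (F.Fp.obj B)
  nTop := G.Fp.map F.nTop ≫ G.nTop
  nTen A B := G.Fp.map (F.nTen A B) ≫ G.nTen (F.Fp.obj A) (F.Fp.obj B)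
  νRt A B := G.Ft.map (F.νRt A B) ≫ G.νRt (F.Fp.obj A) (F.Ft.obj B)
  νRp A B := G.νRp (F.Ft.obj A) (F.Fp.obj B) ≫ G.Fp.map (F.νRp A B)

end MedialData

/-- The laws of a symmetric linear functor, apart from the (co)monoidality of its components. The
left strengths are obtained from the right ones through the braidings. -/
structure IsSymmLinear {C : Type u₁} [Category.{v₁} C] [SMLDC C] {D : Type u₂} [Category.{v₂} D]
    [SMLDC D] (F : MedialData C D) : Prop where
  νRt_natural : ∀ {A A' B B' : C} (f : A ⟶ A') (g : B ⟶ B'),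
    F.Ft.map (f ⊕ʰ g) ≫ F.νRt A' B' = F.νRt A B ≫ F.Fp.map f ⊕ʰ F.Ft.map g
  νRp_natural : ∀ {A A' B B' : C} (f : A ⟶ A') (g : B ⟶ B'),
    F.Ft.map f ⊗ʰ F.Fp.map g ≫ F.νRp A' B' = F.νRp A B ≫ F.Fp.map (f ⊗ʰ g)
  -- strengths and units
  νRt_unit : ∀ A : C, F.νRt ⊥ᵒ A ≫ F.nBot.hom ⊕ʰ 𝟙 (F.Ft.obj A) ≫ (pL (F.Ft.obj A)).hom =
    F.Ft.map (pL A).hom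
  νLt_unit : ∀ A : C, F.νLt A ⊥ᵒ ≫ 𝟙 (F.Ft.obj A) ⊕ʰ F.nBot.hom ≫ (pR (F.Ft.obj A)).hom =
    F.Ft.map (pR A).hom
  νRp_unit : ∀ A : C, (tL (F.Fp.obj A)).hom ≫ F.mTop.hom ⊗ʰ 𝟙 (F.Fp.obj A) ≫ F.νRp ⊤ᵒ A =
    F.Fp.map (tL A).hom
  νLp_unit : ∀ A : C, (tR (F.Fp.obj A)).hom ≫ 𝟙 (F.Fp.obj A) ⊗ʰ F.mTop.hom ≫ F.νLp A ⊤ᵒ =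
    F.Fp.map (tR A).hom
  -- strengths and associators
  νRt_assoc : ∀ A B E : C,
    F.νRt A (B ⊕ᵒ E) ≫ 𝟙 (F.Fp.obj A) ⊕ʰ F.νRt B E ≫
      (pα (F.Fp.obj A) (F.Fp.obj B) (F.Ft.obj E)).hom =
    F.Ft.map (pα A B E).hom ≫ F.νRt (A ⊕ᵒ B) E ≫ (F.nPar A B).hom ⊕ʰ 𝟙 (F.Ft.obj E)
  νLt_assoc : ∀ A B E : C,
    F.νLt A (B ⊕ᵒ E) ≫ 𝟙 (F.Ft.obj A) ⊕ʰ (F.nPar B E).hom ≫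
      (pα (F.Ft.obj A) (F.Fp.obj B) (F.Fp.obj E)).hom =
    F.Ft.map (pα A B E).hom ≫ F.νLt (A ⊕ᵒ B) E ≫ F.νLt A B ⊕ʰ 𝟙 (F.Fp.obj E)
  νRp_assoc : ∀ A B E : C,
    (tα (F.Ft.obj A) (F.Ft.obj B) (F.Fp.obj E)).hom ≫ 𝟙 (F.Ft.obj A) ⊗ʰ F.νRp B E ≫
      F.νRp A (B ⊗ᵒ E) =
    (F.mTen A B).hom ⊗ʰ 𝟙 (F.Fp.obj E) ≫ F.νRp (A ⊗ᵒ B) E ≫ F.Fp.map (tα A B E).hom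
  νLp_assoc : ∀ A B E : C,
    (tα (F.Fp.obj A) (F.Ft.obj B) (F.Ft.obj E)).hom ≫ 𝟙 (F.Fp.obj A) ⊗ʰ (F.mTen B E).hom ≫
      F.νLp A (B ⊗ᵒ E) =
    F.νLp A B ⊗ʰ 𝟙 (F.Ft.obj E) ≫ F.νLp (A ⊗ᵒ B) E ≫ F.Fp.map (tα A B E).hom
  -- strengths and linear distributivities
  νRt_δR : ∀ A B E : C,
    (F.mTen (A ⊕ᵒ B) E).hom ≫ F.Ft.map (SLDC.δR A B E) ≫ F.νRt A (B ⊗ᵒ E) =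
    F.νRt A B ⊗ʰ 𝟙 (F.Ft.obj E) ≫ SLDC.δR (F.Fp.obj A) (F.Ft.obj B) (F.Ft.obj E) ≫
      𝟙 (F.Fp.obj A) ⊕ʰ (F.mTen B E).hom
  νLt_δL : ∀ A B E : C,
    (F.mTen A (B ⊕ᵒ E)).hom ≫ F.Ft.map (SLDC.δL A B E) ≫ F.νLt (A ⊗ᵒ B) E =
    𝟙 (F.Ft.obj A) ⊗ʰ F.νLt B E ≫ SLDC.δL (F.Ft.obj A) (F.Ft.obj B) (F.Fp.obj E) ≫
      (F.mTen A B).hom ⊕ʰ 𝟙 (F.Fp.obj E)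
  νRp_δL : ∀ A B E : C,
    F.νRp A (B ⊕ᵒ E) ≫ F.Fp.map (SLDC.δL A B E) ≫ (F.nPar (A ⊗ᵒ B) E).hom =
    𝟙 (F.Ft.obj A) ⊗ʰ (F.nPar B E).hom ≫ SLDC.δL (F.Ft.obj A) (F.Fp.obj B) (F.Fp.obj E) ≫
      F.νRp A B ⊕ʰ 𝟙 (F.Fp.obj E)
  νLp_δR : ∀ A B E : C,
    F.νLp (A ⊕ᵒ B) E ≫ F.Fp.map (SLDC.δR A B E) ≫ (F.nPar A (B ⊗ᵒ E)).hom =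
    (F.nPar A B).hom ⊗ʰ 𝟙 (F.Ft.obj E) ≫ SLDC.δR (F.Fp.obj A) (F.Fp.obj B) (F.Ft.obj E) ≫
      𝟙 (F.Fp.obj A) ⊕ʰ F.νLp B E
  -- left and right strengths, and associators
  νRt_νLt : ∀ A B E : C,
    F.νRt A (B ⊕ᵒ E) ≫ 𝟙 (F.Fp.obj A) ⊕ʰ F.νLt B E ≫
      (pα (F.Fp.obj A) (F.Ft.obj B) (F.Fp.obj E)).hom =
    F.Ft.map (pα A B E).hom ≫ F.νLt (A ⊕ᵒ B) E ≫ F.νRt A B ⊕ʰ 𝟙 (F.Fp.obj E)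
  νRp_νLp : ∀ A B E : C,
    (tα (F.Ft.obj A) (F.Fp.obj B) (F.Ft.obj E)).hom ≫ 𝟙 (F.Ft.obj A) ⊗ʰ F.νLp B E ≫
      F.νRp A (B ⊗ᵒ E) =
    F.νRp A B ⊗ʰ 𝟙 (F.Ft.obj E) ≫ F.νLp (A ⊗ᵒ B) E ≫ F.Fp.map (tα A B E).hom
  -- tensor and par strengths, and linear distributivities
  νRt_νRp : ∀ A B E : C,
    (F.mTen A (B ⊕ᵒ E)).hom ≫ F.Ft.map (SLDC.δL A B E) ≫ F.νRt (A ⊗ᵒ B) E =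
    𝟙 (F.Ft.obj A) ⊗ʰ F.νRt B E ≫ SLDC.δL (F.Ft.obj A) (F.Fp.obj B) (F.Ft.obj E) ≫
      F.νRp A B ⊕ʰ 𝟙 (F.Ft.obj E)
  νLt_νLp : ∀ A B E : C,
    (F.mTen (A ⊕ᵒ B) E).hom ≫ F.Ft.map (SLDC.δR A B E) ≫ F.νLt A (B ⊗ᵒ E) =
    F.νLt A B ⊗ʰ 𝟙 (F.Ft.obj E) ≫ SLDC.δR (F.Ft.obj A) (F.Fp.obj B) (F.Ft.obj E) ≫
      𝟙 (F.Ft.obj A) ⊕ʰ F.νLp B E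
  νRp_νRt : ∀ A B E : C,
    F.νRp (A ⊕ᵒ B) E ≫ F.Fp.map (SLDC.δR A B E) ≫ (F.nPar A (B ⊗ᵒ E)).hom =
    F.νRt A B ⊗ʰ 𝟙 (F.Fp.obj E) ≫ SLDC.δR (F.Fp.obj A) (F.Ft.obj B) (F.Fp.obj E) ≫
      𝟙 (F.Fp.obj A) ⊕ʰ F.νRp B E
  νLp_νLt : ∀ A B E : C,
    F.νLp A (B ⊕ᵒ E) ≫ F.Fp.map (SLDC.δL A B E) ≫ (F.nPar (A ⊗ᵒ B) E).hom =
    𝟙 (F.Fp.obj A) ⊗ʰ F.νLt B E ≫ SLDC.δL (F.Fp.obj A) (F.Ft.obj B) (F.Fp.obj E) ≫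
      F.νLp A B ⊕ʰ 𝟙 (F.Fp.obj E)

/-- The laws of a strong symmetric medial linear functor. -/
structure IsMedialLinear {C : Type u₁} [Category.{v₁} C] [SMLDC C] {D : Type u₂}
    [Category.{v₂} D] [SMLDC D] (F : MedialData C D) : Prop extends IsSymmLinear F where
  tensor_monoidal : @IsSymmMonoidal C _ BiSymMonoidal.ten BiSymMonoidal.tenSymm
    D _ BiSymMonoidal.ten BiSymMonoidal.tenSymm F.Ft F.mTop.hom (fun A B => (F.mTen A B).hom)
  par_monoidal : @IsSymmMonoidal C _ BiSymMonoidal.par BiSymMonoidal.parSymm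
    D _ BiSymMonoidal.par BiSymMonoidal.parSymm F.Ft F.mBot F.mPar
  par_comonoidal : @IsSymmComonoidal C _ BiSymMonoidal.par BiSymMonoidal.parSymm
    D _ BiSymMonoidal.par BiSymMonoidal.parSymm F.Fp F.nBot.hom (fun A B => (F.nPar A B).hom)
  tensor_comonoidal : @IsSymmComonoidal C _ BiSymMonoidal.ten BiSymMonoidal.tenSymm
    D _ BiSymMonoidal.ten BiSymMonoidal.tenSymm F.Fp F.nTop F.nTen
  -- the tensor component is a bilax duoidal functor
  t_Δbot : SMLDC.Δbot ≫ F.mBot ⊗ʰ F.mBot ≫ (F.mTen ⊥ᵒ ⊥ᵒ).hom = F.mBot ≫ F.Ft.map SMLDC.Δbot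
  t_nabTop : F.mTop.hom ⊕ʰ F.mTop.hom ≫ F.mPar ⊤ᵒ ⊤ᵒ ≫ F.Ft.map SMLDC.nabTop =
    SMLDC.nabTop ≫ F.mTop.hom
  t_mix : SMLDC.mix ≫ F.mTop.hom = F.mBot ≫ F.Ft.map SMLDC.mix
  t_med : ∀ A B A' B' : C,
    (F.mTen A B).hom ⊕ʰ (F.mTen A' B').hom ≫ F.mPar (A ⊗ᵒ B) (A' ⊗ᵒ B') ≫
      F.Ft.map (SMLDC.med A B A' B') =
    SMLDC.med (F.Ft.obj A) (F.Ft.obj B) (F.Ft.obj A') (F.Ft.obj B') ≫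
      F.mPar A A' ⊗ʰ F.mPar B B' ≫ (F.mTen (A ⊕ᵒ A') (B ⊕ᵒ B')).hom
  -- the par component is a bilax duoidal functor
  p_Δbot : F.Fp.map SMLDC.Δbot ≫ F.nTen ⊥ᵒ ⊥ᵒ ≫ F.nBot.hom ⊗ʰ F.nBot.hom =
    F.nBot.hom ≫ SMLDC.Δbot
  p_nabTop : (F.nPar ⊤ᵒ ⊤ᵒ).hom ≫ F.nTop ⊕ʰ F.nTop ≫ SMLDC.nabTop =
    F.Fp.map SMLDC.nabTop ≫ F.nTop
  p_mix : F.nBot.hom ≫ SMLDC.mix = F.Fp.map SMLDC.mix ≫ F.nTop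
  p_med : ∀ A B A' B' : C,
    F.Fp.map (SMLDC.med A B A' B') ≫ F.nTen (A ⊕ᵒ A') (B ⊕ᵒ B') ≫
      (F.nPar A A').hom ⊗ʰ (F.nPar B B').hom =
    (F.nPar (A ⊗ᵒ B) (A' ⊗ᵒ B')).hom ≫ F.nTen A B ⊕ʰ F.nTen A' B' ≫
      SMLDC.med (F.Fp.obj A) (F.Fp.obj B) (F.Fp.obj A') (F.Fp.obj B')
  -- strengths, contraction and cocontraction
  ν_Δbot : F.nBot.hom ≫ SMLDC.Δbot ≫ F.mBot ⊗ʰ F.nBot.inv ≫ F.νRp ⊥ᵒ ⊥ᵒ = F.Fp.map SMLDC.Δbot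
  ν_nabTop : F.νRt ⊤ᵒ ⊤ᵒ ≫ F.nTop ⊕ʰ F.mTop.inv ≫ SMLDC.nabTop ≫ F.mTop.hom =
    F.Ft.map SMLDC.nabTop
  -- strengths and medial maps
  νRt_med : ∀ A B A' B' : C,
    F.Ft.map (SMLDC.med A B A' B') ≫ (F.mTen (A ⊕ᵒ A') (B ⊕ᵒ B')).inv ≫
      F.νRt A A' ⊗ʰ F.νRt B B' =
    F.νRt (A ⊗ᵒ B) (A' ⊗ᵒ B') ≫ F.nTen A B ⊕ʰ (F.mTen A' B').inv ≫
      SMLDC.med (F.Fp.obj A) (F.Fp.obj B) (F.Ft.obj A') (F.Ft.obj B')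
  νRp_med : ∀ A B A' B' : C,
    F.νRp A B ⊕ʰ F.νRp A' B' ≫ (F.nPar (A ⊗ᵒ B) (A' ⊗ᵒ B')).inv ≫
      F.Fp.map (SMLDC.med A B A' B') =
    SMLDC.med (F.Ft.obj A) (F.Fp.obj B) (F.Ft.obj A') (F.Fp.obj B') ≫
      F.mPar A A' ⊗ʰ (F.nPar B B').inv ≫ F.νRp (A ⊕ᵒ A') (B ⊕ᵒ B')
  -- strengths and the remaining structure maps
  νRt_mPar : ∀ A B E : C,
    F.νRt A B ⊕ʰ 𝟙 (F.Ft.obj E) ≫ (pα (F.Fp.obj A) (F.Ft.obj B) (F.Ft.obj E)).inv ≫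
      𝟙 (F.Fp.obj A) ⊕ʰ F.mPar B E =
    F.mPar (A ⊕ᵒ B) E ≫ F.Ft.map (pα A B E).inv ≫ F.νRt A (B ⊕ᵒ E)
  νRp_nTen : ∀ A B E : C,
    F.νRp A (B ⊗ᵒ E) ≫ F.Fp.map (tα A B E).inv ≫ F.nTen (A ⊗ᵒ B) E =
    𝟙 (F.Ft.obj A) ⊗ʰ F.nTen B E ≫ (tα (F.Ft.obj A) (F.Fp.obj B) (F.Fp.obj E)).inv ≫
      F.νRp A B ⊗ʰ 𝟙 (F.Fp.obj E)

/-- Two symmetric medial linearly distributive categories are isomorphic if there are mutually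
inverse strong symmetric medial linear functors between them. -/
def MedialIso (C : Type u₁) [Category.{v₁} C] (_ : SMLDC C) (D : Type u₂) [Category.{v₂} D]
    (_ : SMLDC D) : Prop :=
  ∃ (F : MedialData C D) (G : MedialData D C), IsMedialLinear F ∧ IsMedialLinear G ∧
    F.comp G = MedialData.id C ∧ G.comp F = MedialData.id D

end Functors

end LD

/-! Once a symmetric medial linearly distributive category is cartesian, none of its further
structure is a choice. This uniqueness drives all the equivalences.

A natural family of cocommutative comonoids, compatible with ⊗ and with its unit, forces ⊗ to be a
product (Fox's theorem). Naturality of e together with e_⊤ = 1 makes ⊤ terminal. The pairing of f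
and g is Δ;(f ⊗ g), and the counit laws compute its components. It is unique because naturality and
the formulas for Δ and e at A ⊗ B make every map into A ⊗ B a comonoid map, to which `lift_eta`
applies. This is `IsCartesianMon.of_comon`; its dual for ⊕ is `IsCocartesianMon.of_mon`. Together
they give the passage in (1) from bimonoids to a cartesian structure.

Conversely, let X be cartesian. Initiality of ⊥ and terminality of ⊤ leave no freedom in Δ_⊥, ∇_⊤
and m. The medial maps are determined by their projections: the terminal map out of B ⊕ E can be
written as (! ⊕ !);∇_⊤, after which naturality of μ and its right unit law turn the first projection
of μ into π₀ ⊕ π₀; the second projection is treated with the left unit law. Hence X is equal, as a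
structure, to `inc` of its underlying cartesian linearly distributive category
(`IsCartesian.eq_inc`). There the diagonals and codiagonals are available, and every bimonoid
identity can be tested on projections or injections.

For (2), a cartesian X is its own Y. In the other direction, the tensor component of an isomorphism
is fully faithful and strong ⊗-monoidal, and its par component is fully faithful and strong
⊕-comonoidal. Such functors carry canonical projections, respectively injections, to canonical ones,
so they reflect the universal properties (`MedialIso.isCartesian`). This applies in particular to Y
= B[X], which is a cartesian linearly distributive category for every X.

What remains is an isomorphism X ≅ B[X] when X = inc(Y). The unit and counit laws force every
bimonoid on A to consist of the diagonal, the codiagonal and the unique maps to ⊤ and from ⊥; every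
morphism respects these by naturality. The forgetful functor is therefore bijective on objects and
on morphisms. Its structure maps and those of its inverse are carried by identities, so most laws of
a medial linear functor are those of the identity functor (`isMedialLinear_id`). Laws with source ⊥
or target ⊤ are automatic, and laws about medial maps also need that the medial maps of B[X], built
from products of bimonoids, lie over those of X (`Bim.cmed_f`). -/

namespace LD

/-! ### Recognising products and coproducts: Fox's theorem and reflection along fully faithful
functors. -/

section Recognition

open MonoidalCategory

variable {C : Type u₁} [Category.{v₁} C] [MonoidalCategory C]
  {D : Type u₂} [Category.{v₂} D] [MonoidalCategory D]

/-- A symmetric monoidal category with natural, coherent cocommutative comonoid structures on its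
objects is cartesian. -/
theorem IsCartesianMon.of_comon [SymmetricCategory C] (Δ : ∀ A : C, A ⟶ A ⊗ A)
    (e : ∀ A : C, A ⟶ 𝟙_ C) (hΔ : ∀ {A B : C} (f : A ⟶ B), f ≫ Δ B = Δ A ≫ (f ⊗ₘ f))
    (he : ∀ {A B : C} (f : A ⟶ B), f ≫ e B = e A) (h : ∀ A, IsCocommComon A (Δ A) (e A))
    (hten : ∀ A B : C, Δ (A ⊗ B) = (Δ A ⊗ₘ Δ B) ≫ tensorμ A A B B)
    (heten : ∀ A B : C, e (A ⊗ B) = (e A ⊗ₘ e B) ≫ (ρ_ _).hom) (hone : e (𝟙_ C) = 𝟙 _) :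
    IsCartesianMon C := by
  -- Naturality of the counit along f itself, combined with the identity counit at the unit, makes
  -- the unit terminal.
  have huniq : ∀ {A : C} (f : A ⟶ 𝟙_ C), f = e A := fun f => by rw [← he f, hone, Category.comp_id]
  refine ⟨⟨IsTerminal.ofUniqueHom e fun _ f => huniq f⟩, fun {A B} a b => ⟨?_⟩⟩
  obtain rfl := huniq a
  obtain rfl := huniq b
  refine BinaryFan.isLimitMk (fun s => Δ s.pt ≫ (s.fst ⊗ₘ s.snd)) ?_ ?_ ?_
  · exact fun s => lift_fst (h s.pt) (he s.snd)
  · exact fun s => lift_snd (h s.pt) (he s.fst)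
  · intro s m h₁ h₂
    rw [← h₁, ← h₂]
    -- A mediating map m is a comonoid map: naturality of Δ and e at m, with their values at A ⊗ B
    -- rewritten by coherence. A comonoid map into A ⊗ B is the pairing of its two components.
    exact lift_eta (h A) (h B) ⟨by rw [← hten]; exact hΔ m, by rw [← heten, he m]⟩

/-- A symmetric monoidal category with natural, coherent commutative monoid structures on its
objects is cocartesian. -/
theorem IsCocartesianMon.of_mon [SymmetricCategory C] (nab : ∀ A : C, A ⊗ A ⟶ A)
    (u : ∀ A : C, 𝟙_ C ⟶ A) (hnab : ∀ {A B : C} (f : A ⟶ B), nab A ≫ f = (f ⊗ₘ f) ≫ nab B)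
    (hu : ∀ {A B : C} (f : A ⟶ B), u A ≫ f = u B) (h : ∀ A, IsCommMon A (nab A) (u A))
    (hten : ∀ A B : C, nab (A ⊗ B) = tensorμ A B A B ≫ (nab A ⊗ₘ nab B))
    (huten : ∀ A B : C, u (A ⊗ B) = (ρ_ _).inv ≫ (u A ⊗ₘ u B)) (hone : u (𝟙_ C) = 𝟙 _) :
    IsCocartesianMon C := by
  have huniq : ∀ {A : C} (f : 𝟙_ C ⟶ A), f = u A := fun f => by rw [← hu f, hone, Category.id_comp]
  refine ⟨⟨IsInitial.ofUniqueHom u fun _ f => huniq f⟩, fun {A B} a b => ⟨?_⟩⟩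
  obtain rfl := huniq a
  obtain rfl := huniq b
  refine BinaryCofan.isColimitMk (fun s => (s.inl ⊗ₘ s.inr) ≫ nab s.pt) ?_ ?_ ?_
  · exact fun s => inl_desc (h s.pt) (hu s.inr)
  · exact fun s => inr_desc (h s.pt) (hu s.inl)
  · intro s m h₁ h₂
    rw [← h₁, ← h₂]
    -- Dually, m is a monoid map out of the tensor product, hence the copairing of its two
    -- restrictions.
    exact desc_eta (h A) (h B) ⟨by rw [← hten]; exact hnab m, by rw [← huten, hu m]⟩

/-- Fully faithful strong monoidal functors reflect cartesian monoidal structures. -/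
theorem IsCartesianMon.of_fullyFaithful [SymmetricCategory C] [SymmetricCategory D] {F : C ⥤ D}
    (hF : F.FullyFaithful) (η : 𝟙_ D ≅ F.obj (𝟙_ C)) (μ : ∀ A B, F.obj A ⊗ F.obj B ≅ F.obj (A ⊗ B))
    (h : IsSymmMonoidal F η.hom (fun A B => (μ A B).hom)) (hD : IsCartesianMon D) :
    IsCartesianMon C := by
  -- The image of the unit is isomorphic to a terminal object, and F is faithful.
  have huniq : ∀ {A : C} (f g : A ⟶ 𝟙_ C), f = g := fun f g => hF.map_injective (by
    rw [← cancel_mono η.inv]; exact hD.hom_ext_one _ _)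
  -- F preserves the canonical projection up to μ: naturality of μ and the right unit law reduce the
  -- claim to equating two maps from F B to the terminal unit of D.
  have hfst : ∀ {A B : C} (b : B ⟶ 𝟙_ C), F.map ((𝟙 A ⊗ₘ b) ≫ (ρ_ A).hom) =
      (μ A B).inv ≫ hD.fst _ _ := fun {A B} b => by
    rw [Iso.eq_inv_comp, F.map_comp, ← Category.assoc, ← h.natural, Category.assoc, fst,
      ← h.unit_right, tensorHom_comp_tensorHom_assoc, F.map_id, Category.id_comp,
      hD.hom_ext_one (hD.t (F.obj B)) (F.map b ≫ η.inv), Category.assoc, Iso.inv_hom_id,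
      Category.comp_id]
  have hsnd : ∀ {A B : C} (a : A ⟶ 𝟙_ C), F.map ((a ⊗ₘ 𝟙 B) ≫ (λ_ B).hom) =
      (μ A B).inv ≫ hD.snd _ _ := fun {A B} a => by
    rw [Iso.eq_inv_comp, F.map_comp, ← Category.assoc, ← h.natural, Category.assoc, snd,
      ← h.unit_left, tensorHom_comp_tensorHom_assoc, F.map_id, Category.id_comp,
      hD.hom_ext_one (hD.t (F.obj A)) (F.map a ≫ η.inv), Category.assoc, Iso.inv_hom_id,
      Category.comp_id]
  refine ⟨⟨IsTerminal.ofUniqueHom (fun A => hF.preimage (hD.t (F.obj A) ≫ η.hom))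
    fun _ f => huniq _ _⟩, fun {A B} a b => ⟨?_⟩⟩
  -- Pair the images in D, move the result into the image of A ⊗ B along μ, and lift it through F by
  -- fullness; faithfulness then transports the equations back.
  refine BinaryFan.isLimitMk
    (fun s => hF.preimage (hD.pair (A := F.obj A) (B := F.obj B) (F.map s.fst) (F.map s.snd) ≫
      (μ A B).hom)) ?_ ?_ ?_
  · intro s
    apply hF.map_injective
    rw [F.map_comp, hF.map_preimage, hfst, Category.assoc, Iso.hom_inv_id_assoc, pair_fst]
  · intro s
    apply hF.map_injective
    rw [F.map_comp, hF.map_preimage, hsnd, Category.assoc, Iso.hom_inv_id_assoc, pair_snd]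
  · intro s m h₁ h₂
    apply hF.map_injective
    rw [hF.map_preimage, ← Iso.comp_inv_eq]
    apply hD.ext
    · rw [pair_fst, Category.assoc, ← hfst b, ← F.map_comp, h₁]
    · rw [pair_snd, Category.assoc, ← hsnd a, ← F.map_comp, h₂]

/-- The copairing of two morphisms. -/
noncomputable def IsCocartesianMon.copair (h : IsCocartesianMon C) {A B Z : C} (f : A ⟶ Z)
    (g : B ⟶ Z) : A ⊗ B ⟶ Z :=
  (h.coproduct (h.b A) (h.b B)).some.desc (BinaryCofan.mk f g)

theorem IsCocartesianMon.inl_copair (h : IsCocartesianMon C) {A B Z : C} (f : A ⟶ Z)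
    (g : B ⟶ Z) : h.inl A B ≫ h.copair f g = f :=
  (h.coproduct (h.b A) (h.b B)).some.fac (BinaryCofan.mk f g) ⟨.left⟩

theorem IsCocartesianMon.inr_copair (h : IsCocartesianMon C) {A B Z : C} (f : A ⟶ Z)
    (g : B ⟶ Z) : h.inr A B ≫ h.copair f g = g :=
  (h.coproduct (h.b A) (h.b B)).some.fac (BinaryCofan.mk f g) ⟨.right⟩

/-- Fully faithful strong comonoidal functors reflect cocartesian monoidal structures. -/
theorem IsCocartesianMon.of_fullyFaithful [SymmetricCategory C] [SymmetricCategory D] {F : C ⥤ D}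
    (hF : F.FullyFaithful) (η : F.obj (𝟙_ C) ≅ 𝟙_ D) (μ : ∀ A B, F.obj (A ⊗ B) ≅ F.obj A ⊗ F.obj B)
    (h : IsSymmComonoidal F η.hom (fun A B => (μ A B).hom)) (hD : IsCocartesianMon D) :
    IsCocartesianMon C := by
  have huniq : ∀ {A : C} (f g : 𝟙_ C ⟶ A), f = g := fun f g => hF.map_injective (by
    rw [← cancel_epi η.inv]; exact hD.hom_ext_one _ _)
  have hinl : ∀ {A B : C} (b : 𝟙_ C ⟶ B), F.map ((ρ_ A).inv ≫ (𝟙 A ⊗ₘ b)) =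
      hD.inl _ _ ≫ (μ A B).inv := fun {A B} b => by
    -- The comonoidal unit law solved for the inverse unitor, the form in which the unitor enters
    -- the canonical injection.
    have h₁ : F.map (ρ_ A).inv ≫ (μ A (𝟙_ C)).hom ≫ (𝟙 (F.obj A) ⊗ₘ η.hom) =
        (ρ_ (F.obj A)).inv := by
      rw [← cancel_mono (ρ_ (F.obj A)).hom, Category.assoc, Category.assoc, h.unit_right]; simp
    rw [Iso.eq_comp_inv, F.map_comp, Category.assoc, h.natural, inl, ← h₁, Category.assoc,
      Category.assoc, tensorHom_comp_tensorHom, F.map_id, Category.id_comp,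
      hD.hom_ext_one (hD.b (F.obj B)) (η.inv ≫ F.map b), Iso.hom_inv_id_assoc]
  have hinr : ∀ {A B : C} (a : 𝟙_ C ⟶ A), F.map ((λ_ B).inv ≫ (a ⊗ₘ 𝟙 B)) =
      hD.inr _ _ ≫ (μ A B).inv := fun {A B} a => by
    have h₁ : F.map (λ_ B).inv ≫ (μ (𝟙_ C) B).hom ≫ (η.hom ⊗ₘ 𝟙 (F.obj B)) =
        (λ_ (F.obj B)).inv := by
      rw [← cancel_mono (λ_ (F.obj B)).hom, Category.assoc, Category.assoc, h.unit_left]; simp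
    rw [Iso.eq_comp_inv, F.map_comp, Category.assoc, h.natural, inr, ← h₁, Category.assoc,
      Category.assoc, tensorHom_comp_tensorHom, F.map_id, Category.id_comp,
      hD.hom_ext_one (hD.b (F.obj A)) (η.inv ≫ F.map a), Iso.hom_inv_id_assoc]
  refine ⟨⟨IsInitial.ofUniqueHom (fun A => hF.preimage (η.hom ≫ hD.b (F.obj A)))
    fun _ f => huniq _ _⟩, fun {A B} a b => ⟨?_⟩⟩
  refine BinaryCofan.isColimitMk
    (fun s => hF.preimage ((μ A B).hom ≫ hD.copair (F.map s.inl) (F.map s.inr))) ?_ ?_ ?_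
  · intro s
    apply hF.map_injective
    rw [F.map_comp, hF.map_preimage, hinl, Category.assoc, Iso.inv_hom_id_assoc, inl_copair]
  · intro s
    apply hF.map_injective
    rw [F.map_comp, hF.map_preimage, hinr, Category.assoc, Iso.inv_hom_id_assoc, inr_copair]
  · intro s m h₁ h₂
    apply hF.map_injective
    rw [hF.map_preimage, ← Iso.inv_comp_eq]
    apply hD.ext
    · rw [inl_copair, ← Category.assoc, ← hinl b, ← F.map_comp, h₁]
    · rw [inr_copair, ← Category.assoc, ← hinr a, ← F.map_comp, h₂]

end Recognition

/-! ### Invariance of being cartesian, and uniqueness of the medial structure. -/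

/-- A symmetric medial linearly distributive category isomorphic to a cartesian one is
cartesian. -/
theorem MedialIso.isCartesian {C : Type u₁} [Category.{v₁} C] {S : SMLDC C} {D : Type u₂}
    [Category.{v₂} D] {T : SMLDC D} (h : MedialIso C S D T) (hD : IsCartesian D) :
    IsCartesian C := by
  obtain ⟨F, G, hF, -, h₁, h₂⟩ := h
  refine ⟨?_, ?_⟩
  -- The tensor component is the one that is strong for ⊗. Equality of the composites with the
  -- identities provides the unit and counit of an equivalence, and an equivalence is fully
  -- faithful.
  · exact @IsCartesianMon.of_fullyFaithful C _ BiSymMonoidal.ten D _ BiSymMonoidal.ten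
      BiSymMonoidal.tenSymm BiSymMonoidal.tenSymm F.Ft
      (CategoryTheory.Equivalence.mk F.Ft G.Ft (eqToIso (congrArg MedialData.Ft h₁).symm)
        (eqToIso (congrArg MedialData.Ft h₂))).fullyFaithfulFunctor
      F.mTop F.mTen hF.tensor_monoidal hD.1
  -- For ⊕ the strong structure sits on the par component.
  · exact @IsCocartesianMon.of_fullyFaithful C _ BiSymMonoidal.par D _ BiSymMonoidal.par
      BiSymMonoidal.parSymm BiSymMonoidal.parSymm F.Fp
      (CategoryTheory.Equivalence.mk F.Fp G.Fp (eqToIso (congrArg MedialData.Fp h₁).symm)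
        (eqToIso (congrArg MedialData.Fp h₂))).fullyFaithfulFunctor
      F.nBot F.nPar hF.par_comonoidal hD.2

/-- The cartesian linearly distributive category underlying a cartesian symmetric medial linearly
distributive category. -/
abbrev IsCartesian.toCLDC {C : Type u} [Category.{v} C] [SMLDC C] (h : IsCartesian C) : CLDC C where
  cartesian := h.1
  cocartesian := h.2

theorem isCartesian_inc (C : Type u) [Category.{v} C] [CLDC C] : @IsCartesian C _ (inc C) :=
  ⟨CLDC.cartesian, CLDC.cocartesian⟩

/-- All data beyond the medial maps are maps out of ⊥ or into ⊤, hence forced, and the laws are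
propositions. Since T is kept independent of S, the linearly distributive part of S can be replaced
by that of T; until then the two families of medial maps have different types, whence the
heterogeneous equality. -/
theorem eq_inc_of_med {C : Type u} [Category.{v} C] [T : CLDC C] (S : SMLDC C)
    (hS : S.toSLDC = T.toSLDC) (hmed : S.med ≍ @cmed C _ T) : S = inc C := by
  obtain @⟨L, d, n, m, med⟩ := S
  dsimp only at hS
  subst hS
  obtain rfl := eq_of_heq hmed
  obtain rfl : d = ofBot _ := bot_ext _ _
  obtain rfl : n = toTop _ := top_ext _ _
  obtain rfl : m = toTop _ := top_ext _ _
  rfl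

/-- A cartesian symmetric medial linearly distributive category has the canonical medial
structure. -/
theorem IsCartesian.eq_inc {C : Type u} [Category.{v} C] [S : SMLDC C] (h : IsCartesian C) :
    S = @inc C _ h.toCLDC := by
  let _ := h.toCLDC
  have hmed : (S.med : ∀ A B D E : C, (A ⊗ᵒ B) ⊕ᵒ (D ⊗ᵒ E) ⟶ (A ⊕ᵒ D) ⊗ᵒ (B ⊕ᵒ E)) = cmed := by
    funext A B D E
    apply π_ext
    · have h₁ := S.med_natural (𝟙 A) (toTop B) (𝟙 D) (toTop E)
      have h₂ := S.med_tR A D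
      -- The decisive choice: the map from B ⊕ E to ⊤ is factored as (! ⊕ !);∇_⊤. The first factor
      -- passes through μ by naturality, and the second is absorbed by the right unit law for μ,
      -- leaving π₀ ⊕ π₀.
      rw [cmed_π₀, π₀_def, top_ext (toTop (B ⊕ᵒ E)) (toTop B ⊕ʰ toTop E ≫ S.nabTop),
        π₀_def, π₀_def, ← cancel_mono (tR (A ⊕ᵒ D)).hom]
      simp only [Category.assoc, Iso.inv_hom_id, Category.comp_id]
      rw [← h₂, pc']
      simp only [Category.assoc, Iso.inv_hom_id, Category.comp_id]
      rw [reassoc_of% h₁, pid, tc, Category.comp_id]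
    · have h₁ := S.med_natural (toTop A) (𝟙 B) (toTop D) (𝟙 E)
      have h₂ := S.med_tL B E
      -- The mirror image: the terminal map on A ⊕ D is factored instead, and the left unit law
      -- absorbs ∇_⊤.
      rw [cmed_π₁, π₁_def, top_ext (toTop (A ⊕ᵒ D)) (toTop A ⊕ʰ toTop D ≫ S.nabTop),
        π₁_def, π₁_def, ← cancel_mono (tL (B ⊕ᵒ E)).hom]
      simp only [Category.assoc, Iso.inv_hom_id, Category.comp_id]
      rw [← h₂, pc']
      simp only [Category.assoc, Iso.inv_hom_id, Category.comp_id]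
      rw [reassoc_of% h₁, pid, tc, Category.comp_id]
  exact eq_inc_of_med S rfl (heq_of_eq hmed)

/-! ### Diagonals and codiagonals in a cartesian linearly distributive category. -/

noncomputable section Canonical

open SLDC SMLDC

set_option linter.unusedSimpArgs false

attribute [local instance] inc

variable {C : Type u} [Category.{v} C] [CLDC C] {A B D Z : C}

/-- The copairing of two morphisms. -/
def copairing (f : A ⟶ Z) (g : B ⟶ Z) : A ⊕ᵒ B ⟶ Z :=
  @IsCocartesianMon.copair C _ BiSymMonoidal.par CLDC.cocartesian _ _ _ f g

theorem ι₀_copairing (f : A ⟶ Z) (g : B ⟶ Z) : ι₀ A B ≫ copairing f g = f :=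
  @IsCocartesianMon.inl_copair C _ BiSymMonoidal.par CLDC.cocartesian _ _ _ f g

theorem ι₁_copairing (f : A ⟶ Z) (g : B ⟶ Z) : ι₁ A B ≫ copairing f g = g :=
  @IsCocartesianMon.inr_copair C _ BiSymMonoidal.par CLDC.cocartesian _ _ _ f g

theorem ι₀_pσ (A B : C) : ι₀ A B ≫ (pσ A B).hom = ι₁ B A := (inj_rules A B A).2.2.1
theorem ι₁_pσ (A B : C) : ι₁ A B ≫ (pσ A B).hom = ι₀ B A := (inj_rules A B A).2.2.2.1
theorem ι₀_pR (A : C) : ι₀ A ⊥ᵒ ≫ (pR A).hom = 𝟙 A := (inj_rules A A A).1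
theorem ι₁_pL (A : C) : ι₁ ⊥ᵒ A ≫ (pL A).hom = 𝟙 A := (inj_rules A A A).2.1

/-- The flip exchanges the two middle factors, so its first half collects the first factor of each
source pair. With `tτ_π₁` this describes the flip entirely by projections, which is what `diag_ten`
needs. -/
theorem tτ_π₀ (A B D E : C) : tτ A B D E ≫ π₀ (A ⊗ᵒ D) (B ⊗ᵒ E) = π₀ A B ⊗ʰ π₀ D E := by
  rw [tτ_def, tJ]
  apply π_ext
  · simp only [Category.assoc, tα_inv_π₀, tc, tα_π₀, reassoc_of% map_π₀, map_π₀, Category.comp_id]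
  · simp only [Category.assoc, tα_inv_π₀, tc, tα_π₀, reassoc_of% map_π₀, map_π₀, Category.comp_id,
      map_π₁, tσ_π₀, reassoc_of% tα_inv_π₀, reassoc_of% tα_π₁, reassoc_of% map_π₁, Category.id_comp]

theorem tτ_π₁ (A B D E : C) : tτ A B D E ≫ π₁ (A ⊗ᵒ D) (B ⊗ᵒ E) = π₁ A B ⊗ʰ π₁ D E := by
  rw [tτ_def, tJ]
  apply π_ext
  · simp only [Category.assoc, tα_inv_π₁, tα_π₁, reassoc_of% map_π₁, map_π₀, tc, tσ_π₁,
      reassoc_of% tα_inv_π₀, Category.comp_id, reassoc_of% tα_π₁]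
  · simp only [Category.assoc, tα_inv_π₁, tα_π₁, reassoc_of% map_π₁, map_π₁,
      Category.comp_id, Category.id_comp, reassoc_of% tα_π₁]

/-- Dual description of the par flip by its restrictions to the two summands, tested on each inner
summand in turn. It feeds `codiag_par`. -/
theorem ι₀_pτ (A B D E : C) : ι₀ (A ⊕ᵒ B) (D ⊕ᵒ E) ≫ pτ A B D E = ι₀ A D ⊕ʰ ι₀ B E := by
  rw [pτ_def, pJ]
  apply ι_ext
  · simp only [reassoc_of% ι₀_pα_inv, pc', reassoc_of% ι₀_map, ι₀_map, ι₀_pα, Category.id_comp]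
  · simp only [reassoc_of% ι₀_pα_inv, pc', reassoc_of% ι₁_map, ι₁_map, ι₁_pα, Category.assoc,
      reassoc_of% ι₀_pα, reassoc_of% ι₀_map, reassoc_of% ι₀_pσ, ι₀_pα_inv, Category.id_comp]

theorem ι₁_pτ (A B D E : C) : ι₁ (A ⊕ᵒ B) (D ⊕ᵒ E) ≫ pτ A B D E = ι₁ A D ⊕ʰ ι₁ B E := by
  rw [pτ_def, pJ]
  apply ι_ext
  · simp only [reassoc_of% ι₁_pα_inv, reassoc_of% ι₁_map, ι₁_pα, Category.assoc, ι₀_map,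
      reassoc_of% ι₁_pα, reassoc_of% ι₀_map, reassoc_of% ι₁_pσ, reassoc_of% ι₀_pα_inv,
      Category.id_comp]
  · simp only [reassoc_of% ι₁_pα_inv, reassoc_of% ι₁_map, ι₁_pα, Category.assoc, ι₁_map,
      reassoc_of% ι₁_pα, Category.id_comp]

/-- The diagonal. -/
def diag (A : C) : A ⟶ A ⊗ᵒ A := pairing (𝟙 A) (𝟙 A)

/-- The codiagonal. -/
def codiag (A : C) : A ⊕ᵒ A ⟶ A := copairing (𝟙 A) (𝟙 A)

theorem diag_π₀ (A : C) : diag A ≫ π₀ A A = 𝟙 A := pairing_π₀ _ _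
theorem diag_π₁ (A : C) : diag A ≫ π₁ A A = 𝟙 A := pairing_π₁ _ _
theorem ι₀_codiag (A : C) : ι₀ A A ≫ codiag A = 𝟙 A := ι₀_copairing _ _
theorem ι₁_codiag (A : C) : ι₁ A A ≫ codiag A = 𝟙 A := ι₁_copairing _ _

theorem diag_natural (f : A ⟶ B) : f ≫ diag B = diag A ≫ f ⊗ʰ f := by
  apply π_ext
  · rw [Category.assoc, Category.assoc, diag_π₀, map_π₀, reassoc_of% diag_π₀, Category.comp_id]
  · rw [Category.assoc, Category.assoc, diag_π₁, map_π₁, reassoc_of% diag_π₁, Category.comp_id]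

theorem codiag_natural (f : A ⟶ B) : codiag A ≫ f = f ⊕ʰ f ≫ codiag B := by
  apply ι_ext
  · rw [reassoc_of% ι₀_codiag, reassoc_of% ι₀_map, ι₀_codiag, Category.comp_id]
  · rw [reassoc_of% ι₁_codiag, reassoc_of% ι₁_map, ι₁_codiag, Category.comp_id]

/-- Every comonoid law equates maps into a product, so it is tested on projections, where the
diagonal disappears. Components landing in ⊤ agree automatically. -/
theorem tComon_diag (A : C) : TComon A (diag A) (toTop A) := by
  apply TComon.intro
  · apply π_ext
    · simp only [Category.assoc, map_π₀, tα_π₀, reassoc_of% map_π₀, diag_π₀,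
        Category.comp_id]
    -- The second component of the coassociativity law lies in A ⊗ A and has to be projected once
    -- more.
    · apply π_ext <;>
      simp only [Category.assoc, map_π₀, map_π₁, tα_π₁, reassoc_of% tα_π₁, reassoc_of% map_π₀,
        reassoc_of% map_π₁, reassoc_of% diag_π₀, reassoc_of% diag_π₁, diag_π₀, diag_π₁,
        Category.comp_id]
  · apply π_ext
    · rw [Category.assoc, map_π₀, reassoc_of% diag_π₀, tR_π₀]
    · exact top_ext _ _
  · apply π_ext
    · exact top_ext _ _
    · rw [Category.assoc, map_π₁, reassoc_of% diag_π₁, tL_π₁]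
  · apply π_ext
    · rw [Category.assoc, tσ_π₀, diag_π₀, diag_π₁]
    · rw [Category.assoc, tσ_π₁, diag_π₀, diag_π₁]

/-- Dual to `tComon_diag`: restriction to summands removes the codiagonal, and components out of ⊥
agree automatically. -/
theorem pMon_codiag (A : C) : PMon A (codiag A) (ofBot A) := by
  apply PMon.intro
  · apply ι_ext
    · simp only [reassoc_of% ι₀_map, reassoc_of% ι₀_pα, ι₀_codiag, reassoc_of% ι₀_codiag,
        Category.comp_id]
    · apply ι_ext <;>
      simp only [reassoc_of% ι₁_map, reassoc_of% ι₁_pα, ι₁_codiag, reassoc_of% ι₀_map, ι₀_codiag,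
        reassoc_of% ι₀_codiag, reassoc_of% ι₁_codiag,
        Category.comp_id, Category.id_comp]
  · apply ι_ext
    · rw [reassoc_of% ι₀_map, ι₀_codiag, ι₀_pR, Category.comp_id]
    · exact bot_ext _ _
  · apply ι_ext
    · exact bot_ext _ _
    · rw [reassoc_of% ι₁_map, ι₁_codiag, ι₁_pL, Category.comp_id]
  · apply ι_ext
    · rw [reassoc_of% ι₀_pσ, ι₀_codiag, ι₁_codiag]
    · rw [reassoc_of% ι₁_pσ, ι₀_codiag, ι₁_codiag]

/-- Of the four compatibility laws only the one relating multiplication and comultiplication has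
content, the others having source ⊥ or target ⊤. For that law both sides have both projections equal
to the codiagonal. -/
theorem isBicommMedialBimonoid_diag (A : C) :
    IsBicommMedialBimonoid A (diag A) (toTop A) (codiag A) (ofBot A) where
  comon := tComon_diag A
  mon := pMon_codiag A
  nab_Δ := by
    -- Unfolds the medial map of `inc` so that its projection rules apply.
    change _ = _ ≫ cmed A A A A ≫ _
    apply π_ext
    · simp only [Category.assoc, diag_π₀, map_π₀, reassoc_of% cmed_π₀, pc', pid, Category.comp_id,
        Category.id_comp]
    · simp only [Category.assoc, diag_π₁, map_π₁, reassoc_of% cmed_π₁, pc', pid, Category.comp_id,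
        Category.id_comp]
  u_e := top_ext _ _
  nab_e := top_ext _ _
  u_Δ := bot_ext _ _

/-- After either projection both sides are the identity: the flip contributes π ⊗ π, which cancels
the two diagonals. The same cancellation, with `cmed` in place of the flip, gives `diag_par`. -/
theorem diag_ten (A B : C) : diag (A ⊗ᵒ B) = diag A ⊗ʰ diag B ≫ tτ A A B B := by
  apply π_ext
  · rw [Category.assoc, tτ_π₀, tc, diag_π₀, diag_π₀, diag_π₀, tid]
  · rw [Category.assoc, tτ_π₁, tc, diag_π₁, diag_π₁, diag_π₁, tid]

theorem diag_par (A B : C) : diag (A ⊕ᵒ B) = diag A ⊕ʰ diag B ≫ cmed A A B B := by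
  apply π_ext
  · rw [Category.assoc, cmed_π₀, pc, diag_π₀, diag_π₀, diag_π₀, pid]
  · rw [Category.assoc, cmed_π₁, pc, diag_π₁, diag_π₁, diag_π₁, pid]

/-- The source is a coproduct, so injections are the right test. On a summand the canonical medial
map is a tensor product of injections, and each of them cancels against a codiagonal. -/
theorem codiag_ten (A B : C) : codiag (A ⊗ᵒ B) = cmed A B A B ≫ codiag A ⊗ʰ codiag B := by
  apply ι_ext
  · rw [reassoc_of% ι₀_cmed, tc, ι₀_codiag, ι₀_codiag, ι₀_codiag, tid]
  · rw [reassoc_of% ι₁_cmed, tc, ι₁_codiag, ι₁_codiag, ι₁_codiag, tid]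

theorem codiag_par (A B : C) : codiag (A ⊕ᵒ B) = pτ A B A B ≫ codiag A ⊕ʰ codiag B := by
  apply ι_ext
  · rw [reassoc_of% ι₀_pτ, pc, ι₀_codiag, ι₀_codiag, ι₀_codiag, pid]
  · rw [reassoc_of% ι₁_pτ, pc, ι₁_codiag, ι₁_codiag, ι₁_codiag, pid]

theorem diag_top : diag (⊤ᵒ : C) = (tR ⊤ᵒ).hom := π_ext (top_ext _ _) (top_ext _ _)

theorem codiag_bot : codiag (⊥ᵒ : C) = (pR ⊥ᵒ).hom := ι_ext (bot_ext _ _) (bot_ext _ _)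

/-- The counit must be the terminal map, so the counit laws say exactly that both projections of Δ
are identities. -/
theorem IsBicommMedialBimonoid.eq_diag {Δ : A ⟶ A ⊗ᵒ A} {e : A ⟶ ⊤ᵒ} {nab : A ⊕ᵒ A ⟶ A}
    {u : ⊥ᵒ ⟶ A} (h : IsBicommMedialBimonoid A Δ e nab u) : Δ = diag A := by
  obtain rfl : e = toTop A := top_ext _ _
  apply π_ext
  · rw [diag_π₀, π₀_def, reassoc_of% h.comon.cr, Iso.hom_inv_id]
  · rw [diag_π₁, π₁_def, reassoc_of% h.comon.cl, Iso.hom_inv_id]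

/-- The unit must be the initial map, so the unit laws say that both restrictions of the
multiplication are identities. -/
theorem IsBicommMedialBimonoid.eq_codiag {Δ : A ⟶ A ⊗ᵒ A} {e : A ⟶ ⊤ᵒ} {nab : A ⊕ᵒ A ⟶ A}
    {u : ⊥ᵒ ⟶ A} (h : IsBicommMedialBimonoid A Δ e nab u) : nab = codiag A := by
  obtain rfl : u = ofBot A := bot_ext _ _
  apply ι_ext
  · rw [ι₀_codiag, ι₀_def, Category.assoc, h.mon.ur, Iso.inv_hom_id]
  · rw [ι₁_codiag, ι₁_def, Category.assoc, h.mon.ul, Iso.inv_hom_id]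

/-! ### Uniqueness of bimonoid structures, and the medial maps of bimonoids. -/

namespace Bim

/-- The canonical bimonoid on an object of a cartesian linearly distributive category. -/
def ofObj (A : C) : Bim C where
  X := A
  Δ := diag A
  e := toTop A
  nab := codiag A
  u := ofBot A
  isBim := isBicommMedialBimonoid_diag A

/-- All four structure maps are forced and the laws are propositions. A genuine equality of
bimonoids is obtained, as `MedialIso` demands composites equal to identities. -/
theorem ofObj_X_eq (A : Bim C) : ofObj A.X = A := by
  obtain ⟨A, Δ, e, nab, u, h⟩ := A
  obtain rfl := h.eq_diag
  obtain rfl := h.eq_codiag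
  obtain rfl : e = toTop A := top_ext _ _
  obtain rfl : u = ofBot A := bot_ext _ _
  rfl

/-- In a cartesian linearly distributive category, every morphism is a bimonoid morphism. -/
def ofHom {A B : Bim C} (f : A.X ⟶ B.X) : A ⟶ B where
  f := f
  comon := TComonMap.intro (by
    rw [A.isBim.eq_diag, B.isBim.eq_diag]; exact diag_natural f) (top_ext _ _)
  mon := PMonMap.intro (by
    rw [A.isBim.eq_codiag, B.isBim.eq_codiag]; exact codiag_natural f) (bot_ext _ _)

/-- In a cartesian linearly distributive category, every isomorphism is a bimonoid isomorphism. -/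
def ofIso {A B : Bim C} (i : A.X ≅ B.X) : A ≅ B where
  hom := ofHom i.hom
  inv := ofHom i.inv
  hom_inv_id := hom_ext i.hom_inv_id
  inv_hom_id := hom_ext i.inv_hom_id

/-- The terminal map of bimonoids is chosen separately from that of the base category, so the two
projections do not agree by computation. They agree because the underlying map of the former also
ends in ⊤. -/
theorem π₀_f (A B : Bim C) : (π₀ A B).f = π₀ A.X B.X := by
  rw [π₀_def, π₀_def, ← top_ext (toTop B).f (toTop B.X)]
  rfl

theorem π₁_f (A B : Bim C) : (π₁ A B).f = π₁ A.X B.X := by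
  rw [π₁_def, π₁_def, ← top_ext (toTop A).f (toTop A.X)]
  rfl

/-- The medial maps of bimonoids are those of the underlying category. -/
theorem cmed_f (A B D E : Bim C) : (cmed A B D E).f = cmed A.X B.X D.X E.X := by
  apply π_ext
  -- The projection in the base is replaced by the one underlying the projection of bimonoids. The
  -- defining equation of `cmed` among bimonoids then applies, and its right-hand side is carried
  -- back to the base.
  · exact (congrArg (_ ≫ ·) (π₀_f (A ⊕ᵒ D) (B ⊕ᵒ E)).symm).trans
      ((congrArg Hom.f (cmed_π₀ A B D E)).trans
      ((congrArg₂ pHom (π₀_f A B) (π₀_f D E)).trans (cmed_π₀ A.X B.X D.X E.X).symm))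
  · exact (congrArg (_ ≫ ·) (π₁_f (A ⊕ᵒ D) (B ⊕ᵒ E)).symm).trans
      ((congrArg Hom.f (cmed_π₁ A B D E)).trans
      ((congrArg₂ pHom (π₁_f A B) (π₁_f D E)).trans (cmed_π₁ A.X B.X D.X E.X).symm))

end Bim

end Canonical

/-! ### The identity as a medial linear functor. -/

section Identity

set_option linter.unusedSimpArgs false

variable (C : Type u) [Category.{v} C] [SMLDC C] (D : Type u) [Category.{v} D]

/-- The left strength is the right one conjugated by braidings, so triviality of the right strength
leaves a braiding followed by its inverse. This is where symmetry enters. -/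
theorem νLt_id (A B : C) : (MedialData.id C).νLt A B = 𝟙 (A ⊕ᵒ B) :=
  (congrArg (_ ≫ ·) (Category.id_comp _)).trans (pσσ A B)

theorem νLp_id (A B : C) : (MedialData.id C).νLp A B = 𝟙 (A ⊗ᵒ B) :=
  (congrArg (_ ≫ ·) (Category.id_comp _)).trans (tσσ A B)

/-- With all strengths and comparison maps trivial, each law has the same structural map on both
sides. Besides proving reflexivity, these laws serve as templates for every functor whose structure
maps are carried by identities. -/
theorem isSymmLinear_id : IsSymmLinear (MedialData.id C) := by
  constructor
  all_goals
    intros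
    -- Left strengths have to be simplified while `MedialData.id` is still folded, since their rules
    -- mention it; laws without them pass through `try`.
    try simp only [νLt_id, νLp_id]
    dsimp only [MedialData.id, Functor.id_obj, Functor.id_map, Iso.refl_hom, Iso.refl_inv]
    simp only [tid, pid, Category.id_comp, Category.comp_id]

/-- Stated for a single monoidal structure so that it serves both ⊗ and ⊕. -/
theorem isSymmMonoidal_id [MonoidalCategory D] [SymmetricCategory D] :
    IsSymmMonoidal (𝟭 D) (𝟙 _) (fun _ _ => 𝟙 _) := by
  constructor <;> intros <;> simp

theorem isSymmComonoidal_id [MonoidalCategory D] [SymmetricCategory D] :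
    IsSymmComonoidal (𝟭 D) (𝟙 _) (fun _ _ => 𝟙 _) := by
  constructor <;> intros <;> simp

theorem isMedialLinear_id : IsMedialLinear (MedialData.id C) := by
  refine @IsMedialLinear.mk C _ _ C _ _ _ (isSymmLinear_id C)
    (@isSymmMonoidal_id C _ BiSymMonoidal.ten BiSymMonoidal.tenSymm)
    (@isSymmMonoidal_id C _ BiSymMonoidal.par BiSymMonoidal.parSymm)
    (@isSymmComonoidal_id C _ BiSymMonoidal.par BiSymMonoidal.parSymm)
    (@isSymmComonoidal_id C _ BiSymMonoidal.ten BiSymMonoidal.tenSymm)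
    ?_ ?_ ?_ ?_ ?_ ?_ ?_ ?_ ?_ ?_ ?_ ?_ ?_ ?_
  all_goals
    intros
    dsimp only [MedialData.id, Functor.id_obj, Functor.id_map, Iso.refl_hom, Iso.refl_inv]
    simp only [tid, pid, Category.id_comp, Category.comp_id]

end Identity

/-! ### The forgetful functor and its inverse as medial linear functors. -/

namespace Bim

noncomputable section

attribute [local instance] inc

variable (C : Type u) [Category.{v} C] [CLDC C]

/-- The forgetful functor from bimonoids. -/
def forgetFunctor : Bim C ⥤ C where
  obj A := A.X
  map f := f.f
  map_id _ := rfl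
  map_comp _ _ := rfl

/-- The functor equipping each object with its canonical bimonoid structure. -/
def canonicalFunctor : C ⥤ Bim C where
  obj := ofObj
  map f := ofHom f
  map_id _ := rfl
  map_comp _ _ := rfl

/-- The forgetful functor from bimonoids as a strict medial linear functor. -/
def forgetData : MedialData (Bim C) C where
  Ft := forgetFunctor C
  Fp := forgetFunctor C
  mTop := Iso.refl (⊤ᵒ : C)
  mTen A B := Iso.refl (A.X ⊗ᵒ B.X)
  mBot := 𝟙 (⊥ᵒ : C)
  mPar A B := 𝟙 (A.X ⊕ᵒ B.X)
  nBot := Iso.refl (⊥ᵒ : C)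
  nPar A B := Iso.refl (A.X ⊕ᵒ B.X)
  nTop := 𝟙 (⊤ᵒ : C)
  nTen A B := 𝟙 (A.X ⊗ᵒ B.X)
  νRt A B := 𝟙 (A.X ⊕ᵒ B.X)
  νRp A B := 𝟙 (A.X ⊗ᵒ B.X)

/-- The canonical bimonoid structures as a medial linear functor whose structure maps are carried
by identities. -/
def canonicalData : MedialData C (Bim C) where
  Ft := canonicalFunctor C
  Fp := canonicalFunctor C
  mTop := ofIso (A := topObj C) (B := ofObj ⊤ᵒ) (Iso.refl (⊤ᵒ : C))
  mTen A B := ofIso (A := tenObj (ofObj A) (ofObj B)) (B := ofObj (A ⊗ᵒ B)) (Iso.refl (A ⊗ᵒ B))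
  mBot := ofHom (A := botObj C) (B := ofObj ⊥ᵒ) (𝟙 (⊥ᵒ : C))
  mPar A B := ofHom (A := parObj (ofObj A) (ofObj B)) (B := ofObj (A ⊕ᵒ B)) (𝟙 (A ⊕ᵒ B))
  nBot := ofIso (A := ofObj ⊥ᵒ) (B := botObj C) (Iso.refl (⊥ᵒ : C))
  nPar A B := ofIso (A := ofObj (A ⊕ᵒ B)) (B := parObj (ofObj A) (ofObj B)) (Iso.refl (A ⊕ᵒ B))
  nTop := ofHom (A := ofObj ⊤ᵒ) (B := topObj C) (𝟙 (⊤ᵒ : C))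
  nTen A B := ofHom (A := ofObj (A ⊗ᵒ B)) (B := tenObj (ofObj A) (ofObj B)) (𝟙 (A ⊗ᵒ B))
  νRt A B := ofHom (A := ofObj (A ⊕ᵒ B)) (B := parObj (ofObj A) (ofObj B)) (𝟙 (A ⊕ᵒ B))
  νRp A B := ofHom (A := tenObj (ofObj A) (ofObj B)) (B := ofObj (A ⊗ᵒ B)) (𝟙 (A ⊗ᵒ B))

/-- Tensor, par, braidings and distributivities of bimonoids are those of the base on underlying
data. Each law therefore unfolds to the law for the identity functor at the underlying objects. -/
theorem isSymmLinear_forget : IsSymmLinear (forgetData C) where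
  νRt_natural f g := (isSymmLinear_id C).νRt_natural f.f g.f
  νRp_natural f g := (isSymmLinear_id C).νRp_natural f.f g.f
  νRt_unit A := (isSymmLinear_id C).νRt_unit A.X
  νLt_unit A := (isSymmLinear_id C).νLt_unit A.X
  νRp_unit A := (isSymmLinear_id C).νRp_unit A.X
  νLp_unit A := (isSymmLinear_id C).νLp_unit A.X
  νRt_assoc A B E := (isSymmLinear_id C).νRt_assoc A.X B.X E.X
  νLt_assoc A B E := (isSymmLinear_id C).νLt_assoc A.X B.X E.X
  νRp_assoc A B E := (isSymmLinear_id C).νRp_assoc A.X B.X E.X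
  νLp_assoc A B E := (isSymmLinear_id C).νLp_assoc A.X B.X E.X
  νRt_δR A B E := (isSymmLinear_id C).νRt_δR A.X B.X E.X
  νLt_δL A B E := (isSymmLinear_id C).νLt_δL A.X B.X E.X
  νRp_δL A B E := (isSymmLinear_id C).νRp_δL A.X B.X E.X
  νLp_δR A B E := (isSymmLinear_id C).νLp_δR A.X B.X E.X
  νRt_νLt A B E := (isSymmLinear_id C).νRt_νLt A.X B.X E.X
  νRp_νLp A B E := (isSymmLinear_id C).νRp_νLp A.X B.X E.X
  νRt_νRp A B E := (isSymmLinear_id C).νRt_νRp A.X B.X E.X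
  νLt_νLp A B E := (isSymmLinear_id C).νLt_νLp A.X B.X E.X
  νRp_νRt A B E := (isSymmLinear_id C).νRp_νRt A.X B.X E.X
  νLp_νLt A B E := (isSymmLinear_id C).νLp_νLt A.X B.X E.X

/-- Equality of bimonoid morphisms is tested on underlying maps, and there each law is again that of
the identity functor. -/
theorem isSymmLinear_canonical : IsSymmLinear (canonicalData C) where
  νRt_natural f g := hom_ext ((isSymmLinear_id C).νRt_natural f g)
  νRp_natural f g := hom_ext ((isSymmLinear_id C).νRp_natural f g)
  νRt_unit A := hom_ext ((isSymmLinear_id C).νRt_unit A)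
  νLt_unit A := hom_ext ((isSymmLinear_id C).νLt_unit A)
  νRp_unit A := hom_ext ((isSymmLinear_id C).νRp_unit A)
  νLp_unit A := hom_ext ((isSymmLinear_id C).νLp_unit A)
  νRt_assoc A B E := hom_ext ((isSymmLinear_id C).νRt_assoc A B E)
  νLt_assoc A B E := hom_ext ((isSymmLinear_id C).νLt_assoc A B E)
  νRp_assoc A B E := hom_ext ((isSymmLinear_id C).νRp_assoc A B E)
  νLp_assoc A B E := hom_ext ((isSymmLinear_id C).νLp_assoc A B E)
  νRt_δR A B E := hom_ext ((isSymmLinear_id C).νRt_δR A B E)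
  νLt_δL A B E := hom_ext ((isSymmLinear_id C).νLt_δL A B E)
  νRp_δL A B E := hom_ext ((isSymmLinear_id C).νRp_δL A B E)
  νLp_δR A B E := hom_ext ((isSymmLinear_id C).νLp_δR A B E)
  νRt_νLt A B E := hom_ext ((isSymmLinear_id C).νRt_νLt A B E)
  νRp_νLp A B E := hom_ext ((isSymmLinear_id C).νRp_νLp A B E)
  νRt_νRp A B E := hom_ext ((isSymmLinear_id C).νRt_νRp A B E)
  νLt_νLp A B E := hom_ext ((isSymmLinear_id C).νLt_νLp A B E)
  νRp_νRt A B E := hom_ext ((isSymmLinear_id C).νRp_νRt A B E)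
  νLp_νLt A B E := hom_ext ((isSymmLinear_id C).νLp_νLt A B E)

theorem isMedialLinear_forget : IsMedialLinear (forgetData C) where
  toIsSymmLinear := isSymmLinear_forget C
  tensor_monoidal :=
    letI : MonoidalCategory C := BiSymMonoidal.ten
    letI : SymmetricCategory C := BiSymMonoidal.tenSymm
    have h := (isMedialLinear_id C).tensor_monoidal
    @IsSymmMonoidal.mk (Bim C) _ BiSymMonoidal.ten BiSymMonoidal.tenSymm C _ BiSymMonoidal.ten
      BiSymMonoidal.tenSymm _ _ _
      (fun f g => h.natural f.f g.f)
      (fun A B E => h.assoc A.X B.X E.X)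
      (fun A => h.unit_left A.X)
      (fun A => h.unit_right A.X)
      (fun A B => h.symm A.X B.X)
  par_monoidal :=
    letI : MonoidalCategory C := BiSymMonoidal.par
    letI : SymmetricCategory C := BiSymMonoidal.parSymm
    have h := (isMedialLinear_id C).par_monoidal
    @IsSymmMonoidal.mk (Bim C) _ BiSymMonoidal.par BiSymMonoidal.parSymm C _ BiSymMonoidal.par
      BiSymMonoidal.parSymm _ _ _
      (fun f g => h.natural f.f g.f)
      (fun A B E => h.assoc A.X B.X E.X)
      (fun A => h.unit_left A.X)
      (fun A => h.unit_right A.X)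
      (fun A B => h.symm A.X B.X)
  par_comonoidal :=
    letI : MonoidalCategory C := BiSymMonoidal.par
    letI : SymmetricCategory C := BiSymMonoidal.parSymm
    have h := (isMedialLinear_id C).par_comonoidal
    @IsSymmComonoidal.mk (Bim C) _ BiSymMonoidal.par BiSymMonoidal.parSymm C _ BiSymMonoidal.par
      BiSymMonoidal.parSymm _ _ _
      (fun f g => h.natural f.f g.f)
      (fun A B E => h.assoc A.X B.X E.X)
      (fun A => h.unit_left A.X)
      (fun A => h.unit_right A.X)
      (fun A B => h.symm A.X B.X)
  tensor_comonoidal :=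
    letI : MonoidalCategory C := BiSymMonoidal.ten
    letI : SymmetricCategory C := BiSymMonoidal.tenSymm
    have h := (isMedialLinear_id C).tensor_comonoidal
    @IsSymmComonoidal.mk (Bim C) _ BiSymMonoidal.ten BiSymMonoidal.tenSymm C _ BiSymMonoidal.ten
      BiSymMonoidal.tenSymm _ _ _
      (fun f g => h.natural f.f g.f)
      (fun A B E => h.assoc A.X B.X E.X)
      (fun A => h.unit_left A.X)
      (fun A => h.unit_right A.X)
      (fun A B => h.symm A.X B.X)
  t_Δbot := bot_ext _ _
  t_nabTop := top_ext _ _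
  t_mix := top_ext _ _
  -- The medial map of bimonoids is itself a chosen pairing, so it must first be replaced by the
  -- medial map of the base through `cmed_f`; what is left is the law for the identity.
  t_med A B A' B' := (congrArg (fun m => _ ≫ _ ≫ m) (cmed_f A B A' B')).trans
    ((isMedialLinear_id C).t_med A.X B.X A'.X B'.X)
  p_Δbot := bot_ext _ _
  p_nabTop := top_ext _ _
  p_mix := top_ext _ _
  p_med A B A' B' := (congrArg (fun m => m ≫ _) (cmed_f A B A' B')).trans
    ((isMedialLinear_id C).p_med A.X B.X A'.X B'.X)
  ν_Δbot := bot_ext _ _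
  ν_nabTop := top_ext _ _
  νRt_med A B A' B' := (congrArg (fun m => m ≫ _) (cmed_f A B A' B')).trans
    ((isMedialLinear_id C).νRt_med A.X B.X A'.X B'.X)
  νRp_med A B A' B' := (congrArg (fun m => _ ≫ _ ≫ m) (cmed_f A B A' B')).trans
    ((isMedialLinear_id C).νRp_med A.X B.X A'.X B'.X)
  νRt_mPar A B E := (isMedialLinear_id C).νRt_mPar A.X B.X E.X
  νRp_nTen A B E := (isMedialLinear_id C).νRp_nTen A.X B.X E.X

/-- The template laws hold on underlying maps. Here the medial maps of bimonoids occur on the other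
side of each equation, so `cmed_f` enters reversed. -/
theorem isMedialLinear_canonical : IsMedialLinear (canonicalData C) where
  toIsSymmLinear := isSymmLinear_canonical C
  tensor_monoidal :=
    letI : MonoidalCategory C := BiSymMonoidal.ten
    letI : SymmetricCategory C := BiSymMonoidal.tenSymm
    have h := (isMedialLinear_id C).tensor_monoidal
    @IsSymmMonoidal.mk C _ BiSymMonoidal.ten BiSymMonoidal.tenSymm (Bim C) _ BiSymMonoidal.ten
      BiSymMonoidal.tenSymm _ _ _
      (fun f g => hom_ext (h.natural f g))
      (fun A B E => hom_ext (h.assoc A B E))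
      (fun A => hom_ext (h.unit_left A))
      (fun A => hom_ext (h.unit_right A))
      (fun A B => hom_ext (h.symm A B))
  par_monoidal :=
    letI : MonoidalCategory C := BiSymMonoidal.par
    letI : SymmetricCategory C := BiSymMonoidal.parSymm
    have h := (isMedialLinear_id C).par_monoidal
    @IsSymmMonoidal.mk C _ BiSymMonoidal.par BiSymMonoidal.parSymm (Bim C) _ BiSymMonoidal.par
      BiSymMonoidal.parSymm _ _ _
      (fun f g => hom_ext (h.natural f g))
      (fun A B E => hom_ext (h.assoc A B E))
      (fun A => hom_ext (h.unit_left A))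
      (fun A => hom_ext (h.unit_right A))
      (fun A B => hom_ext (h.symm A B))
  par_comonoidal :=
    letI : MonoidalCategory C := BiSymMonoidal.par
    letI : SymmetricCategory C := BiSymMonoidal.parSymm
    have h := (isMedialLinear_id C).par_comonoidal
    @IsSymmComonoidal.mk C _ BiSymMonoidal.par BiSymMonoidal.parSymm (Bim C) _ BiSymMonoidal.par
      BiSymMonoidal.parSymm _ _ _
      (fun f g => hom_ext (h.natural f g))
      (fun A B E => hom_ext (h.assoc A B E))
      (fun A => hom_ext (h.unit_left A))
      (fun A => hom_ext (h.unit_right A))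
      (fun A B => hom_ext (h.symm A B))
  tensor_comonoidal :=
    letI : MonoidalCategory C := BiSymMonoidal.ten
    letI : SymmetricCategory C := BiSymMonoidal.tenSymm
    have h := (isMedialLinear_id C).tensor_comonoidal
    @IsSymmComonoidal.mk C _ BiSymMonoidal.ten BiSymMonoidal.tenSymm (Bim C) _ BiSymMonoidal.ten
      BiSymMonoidal.tenSymm _ _ _
      (fun f g => hom_ext (h.natural f g))
      (fun A B E => hom_ext (h.assoc A B E))
      (fun A => hom_ext (h.unit_left A))
      (fun A => hom_ext (h.unit_right A))
      (fun A B => hom_ext (h.symm A B))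
  t_Δbot := bot_ext _ _
  -- The target is the canonical bimonoid on ⊤ rather than the chosen unit bimonoid, so terminality
  -- is invoked only for the underlying maps. The other uses of `hom_ext` with `top_ext` or
  -- `bot_ext` below have the same reason.
  t_nabTop := hom_ext (top_ext _ _)
  t_mix := bot_ext _ _
  t_med A B A' B' := hom_ext (((isMedialLinear_id C).t_med A B A' B').trans
    (congrArg (fun m => m ≫ _) (cmed_f (ofObj A) (ofObj B) (ofObj A') (ofObj B')).symm))
  p_Δbot := hom_ext (bot_ext _ _)
  p_nabTop := top_ext _ _
  p_mix := top_ext _ _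
  p_med A B A' B' := hom_ext (((isMedialLinear_id C).p_med A B A' B').trans
    (congrArg (fun m => _ ≫ _ ≫ m) (cmed_f (ofObj A) (ofObj B) (ofObj A') (ofObj B')).symm))
  ν_Δbot := hom_ext (bot_ext _ _)
  ν_nabTop := hom_ext (top_ext _ _)
  νRt_med A B A' B' := hom_ext (((isMedialLinear_id C).νRt_med A B A' B').trans
    (congrArg (fun m => _ ≫ _ ≫ m) (cmed_f (ofObj A) (ofObj B) (ofObj A') (ofObj B')).symm))
  νRp_med A B A' B' := hom_ext (((isMedialLinear_id C).νRp_med A B A' B').trans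
    (congrArg (fun m => m ≫ _) (cmed_f (ofObj A) (ofObj B) (ofObj A') (ofObj B')).symm))
  νRt_mPar A B E := hom_ext ((isMedialLinear_id C).νRt_mPar A B E)
  νRp_nTen A B E := hom_ext ((isMedialLinear_id C).νRp_nTen A B E)

end

end Bim

/-- The structure maps of the composite are composites of two identities, equal to identities
without being so by computation. -/
theorem MedialData.id_comp_id (C : Type u) [Category.{v} C] [SMLDC C] :
    (MedialData.id C).comp (MedialData.id C) = MedialData.id C := by
  unfold MedialData.comp MedialData.id
  congr 1 <;> simp

theorem MedialIso.refl (C : Type u) [Category.{v} C] (S : SMLDC C) : MedialIso C S C S :=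
  ⟨MedialData.id C, MedialData.id C, isMedialLinear_id C, isMedialLinear_id C,
    MedialData.id_comp_id C, MedialData.id_comp_id C⟩

/-! ### The two composites, and the isomorphism with the category of bimonoids. -/

namespace Bim

noncomputable section

attribute [local instance] inc

variable (C : Type u) [Category.{v} C] [CLDC C]

variable {C} in
/-- A medial endofunctor of bimonoids is the identity if it is so on underlying objects and
morphisms. -/
theorem eq_id (K : MedialData (Bim C) (Bim C))
    (hFt : ∀ A, K.Ft.obj A = A) (hFp : ∀ A, K.Fp.obj A = A)
    (hmt : ∀ {A B : Bim C} (f : A ⟶ B), (K.Ft.map f).f ≍ f.f)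
    (hmp : ∀ {A B : Bim C} (f : A ⟶ B), (K.Fp.map f).f ≍ f.f)
    (h₁ : K.mTop.hom.f ≍ 𝟙 (⊤ᵒ : Bim C).X) (h₂ : ∀ A B, (K.mTen A B).hom.f ≍ 𝟙 (A ⊗ᵒ B).X)
    (h₃ : K.mBot.f ≍ 𝟙 (⊥ᵒ : Bim C).X) (h₄ : ∀ A B, (K.mPar A B).f ≍ 𝟙 (A ⊕ᵒ B).X)
    (h₅ : K.nBot.hom.f ≍ 𝟙 (⊥ᵒ : Bim C).X) (h₆ : ∀ A B, (K.nPar A B).hom.f ≍ 𝟙 (A ⊕ᵒ B).X)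
    (h₇ : K.nTop.f ≍ 𝟙 (⊤ᵒ : Bim C).X) (h₈ : ∀ A B, (K.nTen A B).f ≍ 𝟙 (A ⊗ᵒ B).X)
    (h₉ : ∀ A B, (K.νRt A B).f ≍ 𝟙 (A ⊕ᵒ B).X) (h₁₀ : ∀ A B, (K.νRp A B).f ≍ 𝟙 (A ⊗ᵒ B).X) :
    K = MedialData.id (Bim C) := by
  obtain ⟨⟨o, m, _, _⟩, ⟨o', m', _, _⟩, a₁, a₂, a₃, a₄, a₅, a₆, a₇, a₈, a₉, a₁₀⟩ := K
  -- Objects are identified first: all later types depend on them, and only then do the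
  -- heterogeneous equalities become equalities of underlying maps, which determine bimonoid
  -- morphisms.
  obtain rfl : o = fun A => A := funext hFt
  obtain rfl : o' = fun A => A := funext hFp
  obtain rfl : @m = fun _ _ f => f := by
    funext A B f; exact hom_ext (eq_of_heq (hmt f))
  obtain rfl : @m' = fun _ _ f => f := by
    funext A B f; exact hom_ext (eq_of_heq (hmp f))
  obtain rfl : a₁ = Iso.refl _ := Iso.ext (hom_ext (eq_of_heq h₁))
  obtain rfl : a₂ = fun _ _ => Iso.refl _ := by
    funext A B; exact Iso.ext (hom_ext (eq_of_heq (h₂ A B)))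
  obtain rfl : a₃ = 𝟙 _ := hom_ext (eq_of_heq h₃)
  obtain rfl : a₄ = fun _ _ => 𝟙 _ := by funext A B; exact hom_ext (eq_of_heq (h₄ A B))
  obtain rfl : a₅ = Iso.refl _ := Iso.ext (hom_ext (eq_of_heq h₅))
  obtain rfl : a₆ = fun _ _ => Iso.refl _ := by
    funext A B; exact Iso.ext (hom_ext (eq_of_heq (h₆ A B)))
  obtain rfl : a₇ = 𝟙 _ := hom_ext (eq_of_heq h₇)
  obtain rfl : a₈ = fun _ _ => 𝟙 _ := by funext A B; exact hom_ext (eq_of_heq (h₈ A B))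
  obtain rfl : a₉ = fun _ _ => 𝟙 _ := by funext A B; exact hom_ext (eq_of_heq (h₉ A B))
  obtain rfl : a₁₀ = fun _ _ => 𝟙 _ := by funext A B; exact hom_ext (eq_of_heq (h₁₀ A B))
  rfl

/-- Forgetting the canonical structure returns the same object by computation, so this composite
unfolds to the identity composed with itself. -/
theorem canonical_comp_forget : (canonicalData C).comp (forgetData C) = MedialData.id C :=
  MedialData.id_comp_id C

/-- A bimonoid agrees with the canonical one on its carrier only by the uniqueness argument of
`ofObj_X_eq`. The carriers do agree by computation, so on underlying maps ordinary equalities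
suffice for `eq_id`, each of them saying that an identity composed with itself is the identity. -/
theorem forget_comp_canonical : (forgetData C).comp (canonicalData C) = MedialData.id (Bim C) :=
  have h : ∀ A : C, 𝟙 A ≫ 𝟙 A = 𝟙 A := fun _ => Category.comp_id _
  eq_id _ ofObj_X_eq ofObj_X_eq (fun _ => .rfl) (fun _ => .rfl) (heq_of_eq (h _))
    (fun _ _ => heq_of_eq (h _)) (heq_of_eq (h _)) (fun _ _ => heq_of_eq (h _))
    (heq_of_eq (h _)) (fun _ _ => heq_of_eq (h _)) (heq_of_eq (h _)) (fun _ _ => heq_of_eq (h _))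
    (fun _ _ => heq_of_eq (h _)) (fun _ _ => heq_of_eq (h _))

/-- A cartesian linearly distributive category is isomorphic to its category of bimonoids. -/
theorem medialIso : MedialIso C (inc C) (Bim C) (inc (Bim C)) :=
  ⟨canonicalData C, forgetData C, isMedialLinear_canonical C, isMedialLinear_forget C, canonical_comp_forget C,
    forget_comp_canonical C⟩

end

end Bim

end LD

/-! ### Assembly of the equivalences. -/

theorem mainTheorem11 {X : Type u} [Category.{v} X] [S : LD.SMLDC X] :
    (LD.IsCartesian X ↔
      ∃ (Δ : ∀ A : X, A ⟶ A ⊗ᵒ A) (e : ∀ A : X, A ⟶ ⊤ᵒ)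
        (nab : ∀ A : X, A ⊕ᵒ A ⟶ A) (u : ∀ A : X, ⊥ᵒ ⟶ A),
        -- naturality
        (∀ {A B : X} (f : A ⟶ B), f ≫ Δ B = Δ A ≫ f ⊗ʰ f) ∧
        (∀ {A B : X} (f : A ⟶ B), f ≫ e B = e A) ∧
        (∀ {A B : X} (f : A ⟶ B), nab A ≫ f = f ⊕ʰ f ≫ nab B) ∧
        (∀ {A B : X} (f : A ⟶ B), u A ≫ f = u B) ∧
        (∀ A : X, LD.IsBicommMedialBimonoid A (Δ A) (e A) (nab A) (u A)) ∧
        -- compatibility with the tensor product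
        (∀ A B : X, Δ (A ⊗ᵒ B) = Δ A ⊗ʰ Δ B ≫ LD.tτ A A B B) ∧
        (∀ A B : X, e (A ⊗ᵒ B) = e A ⊗ʰ e B ≫ (LD.tR ⊤ᵒ).inv) ∧
        (∀ A B : X, nab (A ⊗ᵒ B) = LD.SMLDC.med A B A B ≫ nab A ⊗ʰ nab B) ∧
        (∀ A B : X, u (A ⊗ᵒ B) = LD.SMLDC.Δbot ≫ u A ⊗ʰ u B) ∧
        -- compatibility with the par product
        (∀ A B : X, Δ (A ⊕ᵒ B) = Δ A ⊕ʰ Δ B ≫ LD.SMLDC.med A A B B) ∧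
        (∀ A B : X, e (A ⊕ᵒ B) = e A ⊕ʰ e B ≫ LD.SMLDC.nabTop) ∧
        (∀ A B : X, nab (A ⊕ᵒ B) = LD.pτ A B A B ≫ nab A ⊕ʰ nab B) ∧
        (∀ A B : X, u (A ⊕ᵒ B) = (LD.pR ⊥ᵒ).inv ≫ u A ⊕ʰ u B) ∧
        -- compatibility with the units
        Δ ⊤ᵒ = (LD.tR ⊤ᵒ).hom ∧ e ⊤ᵒ = 𝟙 ⊤ᵒ ∧ nab ⊥ᵒ = (LD.pR ⊥ᵒ).hom ∧ u ⊥ᵒ = 𝟙 ⊥ᵒ ∧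
        e ⊥ᵒ = LD.SMLDC.mix ∧ u ⊤ᵒ = LD.SMLDC.mix) ∧
    (LD.IsCartesian X ↔ ∃ (Y : Type u) (_ : Category.{v} Y) (_ : LD.CLDC Y),
      LD.MedialIso X S Y (LD.inc Y)) ∧
    ((∃ (Y : Type u) (_ : Category.{v} Y) (_ : LD.CLDC Y), LD.MedialIso X S Y (LD.inc Y)) ↔
      LD.MedialIso X S (LD.Bim X) (LD.inc (LD.Bim X))) := by
  have hY : LD.IsCartesian X ↔ ∃ (Y : Type u) (_ : Category.{v} Y) (_ : LD.CLDC Y),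
      LD.MedialIso X S Y (LD.inc Y) := by
    constructor
    · intro h
      refine ⟨X, _, h.toCLDC, ?_⟩
      -- X itself serves as Y: its medial structure is already the canonical one, so the reflexive
      -- isomorphism is enough.
      rw [← h.eq_inc]
      exact LD.MedialIso.refl X S
    · rintro ⟨Y, _, _, h⟩
      exact h.isCartesian (LD.isCartesian_inc Y)
  -- The last equivalence passes through being cartesian; an isomorphism with the bimonoids gives
  -- this because they always form a cartesian linearly distributive category.
  refine ⟨⟨fun h => ?_, ?_⟩, hY, hY.symm.trans ⟨fun h => ?_, fun h =>
    h.isCartesian (LD.isCartesian_inc (LD.Bim X))⟩⟩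
  -- Replacing the given structure by `inc Y` makes its Δ_⊥, ∇_⊤, m and medial maps the canonical
  -- ones, for which the diagonal and codiagonal identities were proved. Conditions on maps into ⊤
  -- or out of ⊥ need no computation.
  · obtain ⟨Y, rfl⟩ : ∃ Y : LD.CLDC X, S = @LD.inc X _ Y := ⟨_, h.eq_inc⟩
    exact ⟨LD.diag, LD.toTop, LD.codiag, LD.ofBot, LD.diag_natural, fun _ => LD.top_ext _ _,
      LD.codiag_natural, fun _ => LD.bot_ext _ _, LD.isBicommMedialBimonoid_diag,
      LD.diag_ten, fun _ _ => LD.top_ext _ _, LD.codiag_ten, fun _ _ => LD.bot_ext _ _,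
      LD.diag_par, fun _ _ => LD.top_ext _ _, LD.codiag_par, fun _ _ => LD.bot_ext _ _,
      LD.diag_top, LD.top_ext _ _, LD.codiag_bot, LD.bot_ext _ _, LD.top_ext _ _, LD.bot_ext _ _⟩
  · rintro ⟨Δ, e, nab, u, hΔ, he, hnab, hu, hbim, hΔt, het, -, -, -, -, hnabp, hup, -, heone, -,
      huone, -, -⟩
    -- Fox's theorem for ⊗ with the comonoid half of the bimonoids, and its dual for ⊕ with the
    -- monoid half.
    exact ⟨@LD.IsCartesianMon.of_comon X _ LD.BiSymMonoidal.ten LD.BiSymMonoidal.tenSymm Δ e hΔ he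
        (fun A => (hbim A).comon) hΔt het heone,
      @LD.IsCocartesianMon.of_mon X _ LD.BiSymMonoidal.par LD.BiSymMonoidal.parSymm nab u hnab hu
        (fun A => (hbim A).mon) hnabp hup huone⟩
  · obtain ⟨Y, rfl⟩ : ∃ Y : LD.CLDC X, S = @LD.inc X _ Y := ⟨_, h.eq_inc⟩
    exact LD.Bim.medialIso X
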